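/- **Setting.** For a security parameter $\lambda$ let $q=q(\lambda)\ge 1$ be a modulus, $n_{\max}$ a maximal number of clients, $m_{\max}$ a maximal vector length ($n_{\max}$, $m_{\max}$ and $\log q$ at most polynomial in $\lambda$), $\mathcal L=\{0,1\}^*\cup\{\bot\}$ the label set, $m_\ell\le m_{\max}$ the vector length that belongs to the label $\ell$, and $\mathsf{PRF}:\{0,1\}^\lambda\times\mathcal L\to\mathbb Z_q^{m_{\max}}$ a deterministic keyed function; all of these are computable in polynomial time. PPT algorithms run in strict polynomial time and may sample uniformly from $\{0,\dots,n\}$. **Scheme $\mathsf{DyNo}$.** $\mathsf{Setup}$ outputs an empty master secret key. $\mathsf{EKeyGen}(i)$ draws a uniform $\mathsf{ek}_i\in\{0,1\}^\lambda$ and stores it. Let $\zeta_{i,\ell}\in\mathbb Z_q^{m_\ell}$ be the first $m_\ell$ entries of $\mathsf{PRF}(\mathsf{ek}_i,\ell)$. $\mathsf{Enc}(\mathsf{ek}_i,x_i,\ell)$, for $x_i\in\mathbb Z_q^{m_\ell}$, is $(i,\ell,x_i+\zeta_{i,\ell})$. $\mathsf{KeyGen}(S,y,\ell,\mathcal D)$,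 for $S\subseteq[n_{\max}]$ and $y=(y_i)_{i\in S}$ with $y_i\in\mathbb Z_q^{m_\ell}$, draws $\nu\leftarrow\mathcal D$ and returns $(\ell,y,\sum_{i\in S}\langle\zeta_{i,\ell},y_i\rangle-\nu)$, or $\bot$ if some $i\in S$ has no key. Decryption computes $\sum_{i\in S}\langle c_i,y_i\rangle-z$. **Game $\mathsf{IND}_\beta$.** The adversary gets the public parameters. Before all other queries it may corrupt clients, each of which is thereby registered and whose keys it receives (static corruptions). Then it adaptively registers clients (without seeing their keys; each client gets only one key), asks encryption queries $(i,x^0,x^1,\ell)$, answered by an encryption of $x^\beta$ under $\mathsf{ek}_i$ and $\ell$ if $i$ is registered or corrupted and $(i,\ell)$ has not been answered before, and decryption key queries $(S,f_y,\ell,\nu^0,\nu^1)$, answered with noise $\nu^\beta$ if all $i\in S$ are registered or corrupted. All other queries are ignored. The outcome is the bit output by the adversary, replaced by $0$ unless: (i) $x^0=x^1$ in all answered encryption queries for corrupted clients; (ii) for every answered key query $(S,f_y,\ell,\cdot,\cdot)$, every honest $i\in S$ has an answered encryption query under $\ell$; (iii) for every answered key query, $f_y((x_i^0)_{i\in S})+\nu^0=f_y((x_i^1)_{i\in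 S})+\nu^1$, where $x_i^0,x_i^1$ are the queried plaintexts for honest $i$, and $x_i^0=x_i^1$ is arbitrary for corrupted $i$. The advantage is $|\Pr(\mathsf{IND}_0=1)-\Pr(\mathsf{IND}_1=1)|$; the scheme is $\mathsf{IND}$-secure if every PPT adversary has negligible advantage. The advantage against $\mathsf{PRF}$ is the difference of the probabilities of output $1$ with oracle $\mathsf{PRF}(K,\cdot)$, $K$ uniform, and with a random function oracle; $\mathsf{PRF}$ is secure if this is negligible for every PPT adversary. $\mathsf{NMIFE}^{\mathrm{ot}}$ is the one-time scheme for $n_{\max}$ clients with uniform keys $\mathsf{ek}_i\in\mathbb Z_q^{m_{\max}}$, ciphertexts $(i,x_i+\mathsf{ek}_i)$ and decryption keys $(y,\sum_i\langle\mathsf{ek}_i,y_i\rangle-\nu)$; its $\mathsf{IND}$ game is the one above without labels, corruptions and registration, and with $S=[n_{\max}]$. **Theorem.** If $\mathsf{PRF}$ is secure, then $\mathsf{DyNo}$ is $\mathsf{IND}$-secure. In particular, for every PPT adversary $\mathcal A$ there exist PPT adversaries $\mathcal B_1$ and $\mathcal B_2$ such that, for every $\lambda$, $$\mathsf{Adv}^{\mathsf{IND}}_{\mathsf{DyNo},\mathcal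 A}(\lambda)\le 2\,n_{\max}\,q_\ell\cdot\mathsf{Adv}_{\mathsf{PRF},\mathcal B_1}(\lambda)+q_\ell\cdot\mathsf{Adv}^{\mathsf{IND}}_{\mathsf{NMIFE}^{\mathrm{ot}},\mathcal B_2}(\lambda),$$ where $q_\ell=q_\ell(\lambda)$ is (any upper bound for) the number of distinct labels that $\mathcal A$ uses in its encryption and decryption key queries. (The bound holds whether or not $\mathsf{PRF}$ is secure.) -/

import Mathlib

noncomputable section

namespace DyNoFE

/-! ## Probabilistic polynomial time

A small first-order programming language with oracle calls, uniform sampling and an explicit cost.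
Data are binary trees whose leaves are natural numbers.  Pairing, projections, comparison,
addition and truncated subtraction cost one unit; multiplication, division and remainder also pay
for the bit length of their operands, and an oracle call pays for the whole message it sends.  In
time `t` only numbers of `O(t)` more bits than the data received can be formed, and trees can be
stored with sharing, so polynomial time in this language is the usual polynomial time.
Uniform sampling from `{0, …, n}` is a basic operation, because the schemes below sample from
`ℤ_q`. -/

/-- Data: binary trees with natural numbers at the leaves. -/
inductive Val : Type
  | num (n : ℕ) : Val
  | pair (a b : Val) : Val

namespace Val

def fst : Val → Val
  | num _ => num 0
  | pair a _ => a

def snd : Val → Val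
  | num _ => num 0
  | pair _ b => b

def toNat : Val → ℕ
  | num n => n
  | pair _ _ => 0

def isPair : Val → ℕ
  | num _ => 0
  | pair _ _ => 1

/-- The length of the tree written out in full, with numbers in binary. -/
def size : Val → ℕ
  | num n => 1 + Nat.size n
  | pair a b => 1 + a.size + b.size

/-- Lists are nested pairs that end in `num 0`. -/
def ofList : List Val → Val
  | [] => num 0
  | a :: l => pair a (ofList l)

/-- The entry with index `j` of a list. -/
def nth (v : Val) : ℕ → Val
  | 0 => v.fst
  | j + 1 => nth v.snd j

def ofFn {m : ℕ} (f : Fin m → Val) : Val := ofList (List.ofFn f)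

theorem nth_ofList (l : List Val) (j : ℕ) (h : j < l.length) : (ofList l).nth j = l[j] := by
  induction l generalizing j with
  | nil => simp at h
  | cons a l ih =>
    cases j with
    | zero => rfl
    | succ j => simpa [ofList, nth, snd] using ih j (by simpa using h)

theorem nth_ofFn {m : ℕ} (f : Fin m → Val) (j : Fin m) : (ofFn f).nth j = f j := by
  rw [ofFn, nth_ofList _ _ (by simp)]
  simp

end Val

/-- Interactive randomized computations with result in `α`.  `tick c` spends `c` time units,
`rand n` draws a uniform element of `{0, …, n}`, `query m` sends the message `m` to the oracle
and waits for its answer, and `fail` marks a computation that was cut off. -/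
inductive Comp (α : Type) : Type
  | ret (a : α) : Comp α
  | fail : Comp α
  | tick (c : ℕ) (k : Comp α) : Comp α
  | rand (n : ℕ) (k : Fin (n + 1) → Comp α) : Comp α
  | query (m : Val) (k : Val → Comp α) : Comp α

namespace Comp

variable {α β σ : Type}

def bind : Comp α → (α → Comp β) → Comp β
  | ret a, g => g a
  | fail, _ => fail
  | tick c k, g => tick c (k.bind g)
  | rand n k, g => rand n fun i => (k i).bind g
  | query m k, g => query m fun v => (k v).bind g

/-- The computation ends in time at most `t`, whatever the random choices and the answers of the
oracle are. -/
def Within : Comp α → ℕ → Prop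
  | ret _, _ => True
  | fail, _ => False
  | tick c k, t => c ≤ t ∧ k.Within (t - c)
  | rand _ k, t => ∀ i, (k i).Within t
  | query _ k, t => ∀ v, (k v).Within t

/-- The computation uses neither randomness nor the oracle and returns `a` in time at most `t`. -/
def ReturnsIn : Comp α → α → ℕ → Prop
  | ret b, a, _ => b = a
  | fail, _, _ => False
  | tick c k, a, t => c ≤ t ∧ k.ReturnsIn a (t - c)
  | rand _ _, _, _ => False
  | query _ _, _, _ => False

/-- Execution against a randomized oracle `O` with internal state in `σ`. -/
def run (O : σ → Val → PMF (Val × σ)) : Comp α → σ → PMF (Option α × σ)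
  | ret a, s => PMF.pure (some a, s)
  | fail, s => PMF.pure (none, s)
  | tick _ k, s => k.run O s
  | rand n k, s => (PMF.uniformOfFintype (Fin (n + 1))).bind fun i => (k i).run O s
  | query m k, s => (O s m).bind fun r => (k r.1).run O r.2

/-- `while test v ≠ 0 do v := body v`, cut off after `fuel` rounds. -/
def whileLoop (test body : Val → Comp Val) : ℕ → Val → Comp Val
  | 0, _ => fail
  | fuel + 1, v => tick 1 ((test v).bind fun b =>
      if b.toNat = 0 then ret v else (body v).bind (whileLoop test body fuel))

end Comp

/-- Programs; each one transforms one value.  `seq f g` runs `f` and then `g` on the result,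
`pair f g` runs first `f` and then `g` on the same value and returns both results. -/
inductive Code : Type
  | id : Code
  | const (n : ℕ) : Code
  | fst : Code
  | snd : Code
  | isPair : Code
  | pair (f g : Code) : Code
  | seq (f g : Code) : Code
  | cond (c f g : Code) : Code
  | loop (c f : Code) : Code
  | add : Code
  | sub : Code
  | mul : Code
  | div : Code
  | mod : Code
  | eq : Code
  | lt : Code
  | rand : Code
  | query : Code

namespace Code

/-- Evaluation of a program on a value.  The binary operations act on the two components of a
pair; `fuel` bounds the number of rounds of each execution of a loop. -/
def eval (fuel : ℕ) : Code → Val → Comp Val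
  | .id, v => .tick 1 (.ret v)
  | .const n, _ => .tick 1 (.ret (.num n))
  | .fst, v => .tick 1 (.ret v.fst)
  | .snd, v => .tick 1 (.ret v.snd)
  | .isPair, v => .tick 1 (.ret (.num v.isPair))
  | .pair f g, v => .tick 1 ((eval fuel f v).bind fun a => (eval fuel g v).bind fun b =>
      .ret (.pair a b))
  | .seq f g, v => .tick 1 ((eval fuel f v).bind (eval fuel g))
  | .cond c f g, v => .tick 1 ((eval fuel c v).bind fun b =>
      if b.toNat = 0 then eval fuel g v else eval fuel f v)
  | .loop c f, v => Comp.whileLoop (eval fuel c) (eval fuel f) fuel v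
  | .add, v => .tick 1 (.ret (.num (v.fst.toNat + v.snd.toNat)))
  | .sub, v => .tick 1 (.ret (.num (v.fst.toNat - v.snd.toNat)))
  | .mul, v => .tick (1 + Nat.size v.fst.toNat + Nat.size v.snd.toNat)
      (.ret (.num (v.fst.toNat * v.snd.toNat)))
  | .div, v => .tick (1 + Nat.size v.fst.toNat + Nat.size v.snd.toNat)
      (.ret (.num (v.fst.toNat / v.snd.toNat)))
  | .mod, v => .tick (1 + Nat.size v.fst.toNat + Nat.size v.snd.toNat)
      (.ret (.num (v.fst.toNat % v.snd.toNat)))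
  | .eq, v => .tick 1 (.ret (.num (if v.fst.toNat = v.snd.toNat then 1 else 0)))
  | .lt, v => .tick 1 (.ret (.num (if v.fst.toNat < v.snd.toNat then 1 else 0)))
  | .rand, v => .tick (1 + Nat.size v.toNat) (.rand v.toNat fun i => .ret (.num i))
  | .query, v => .tick (1 + v.size) (.query v .ret)

end Code

/-- Probabilistic polynomial-time interactive algorithms: one program that, on the security
parameter `κ` and any further public input `v`, stops within `time κ` steps, whatever the random
choices and the answers it receives are.  (A loop round costs at least one unit, so the fuel
`time κ` never cuts off such a computation.) -/
structure PPT where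
  code : Code
  time : Polynomial ℕ
  within : ∀ (κ : ℕ) (v : Val),
    (code.eval (time.eval κ) (.pair (.num κ) v)).Within (time.eval κ)

def PPT.comp (A : PPT) (κ : ℕ) (v : Val) : Comp Val :=
  A.code.eval (A.time.eval κ) (.pair (.num κ) v)

/-- The map `inp d ↦ out d` is computed by one deterministic program in time polynomial in
`len d`. -/
def PolyTimeFun {D : Type} (len : D → ℕ) (inp out : D → Val) : Prop :=
  ∃ (c : Code) (p : Polynomial ℕ), ∀ d,
    (c.eval (p.eval (len d)) (inp d)).ReturnsIn (out d) (p.eval (len d))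

/-- Negligible functions. -/
def Negligible (f : ℕ → ℝ) : Prop :=
  ∀ c : ℕ, ∃ τ : ℕ, ∀ x : ℕ, τ < x → |f x| < 1 / (x : ℝ) ^ c

/-- The distance between the probabilities of output `1` in two games; `G β` is the game with
challenge bit `β`. -/
def advantage (G : Bool → PMF Bool) : ℝ :=
  |(G false true).toReal - (G true true).toReal|

/-- The final output is the bit `1` (any other output counts as `0`). -/
def OutputsOne (r : Option Val) : Prop := ∃ v, r = some v ∧ v.toNat = 1

/-! ## Labels and encodings of messages -/

/-- The label set `{0,1}* ∪ {⊥}`. -/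
abbrev Label : Type := Option (List Bool)

/-- Labels as numbers: `⊥` is `0`, and a bit string `w` is the number with binary digits `w`
(lowest digit first) and an additional leading digit `1`. -/
def Label.code : Label → ℕ
  | none => 0
  | some w => w.foldr Nat.bit 1

def Label.ofCode (n : ℕ) : Label := if n = 0 then none else some n.bits.dropLast

theorem Label.bits_foldr (w : List Bool) : (w.foldr Nat.bit 1).bits = w ++ [true] := by
  induction w with
  | nil => simp
  | cons b w ih =>
    have h : w.foldr Nat.bit 1 ≠ 0 := by
      intro h
      rw [h] at ih
      simp at ih
    rw [List.foldr_cons, Nat.bits_append_bit _ _ (fun h' => absurd h' h), ih, List.cons_append]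

theorem Label.ofCode_code (l : Label) : Label.ofCode l.code = l := by
  cases l with
  | none => rfl
  | some w =>
    have h : w.foldr Nat.bit 1 ≠ 0 := by
      intro h
      have := Label.bits_foldr w
      rw [h] at this
      simp at this
    simp [Label.code, Label.ofCode, h, Label.bits_foldr]

/-- Types whose elements can be sent to an adversary. -/
class Writable (α : Type) where
  toVal : α → Val
  toVal_injective : Function.Injective toVal

/-- Types whose elements can be sent by an adversary.  A message may denote no element, and
several messages may denote the same one. -/
class Readable (α : Type) where
  ofVal : Val → Option α
  ofVal_surjective : ∀ a, ∃ v, ofVal v = some a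

instance : Readable Label where
  ofVal v := some (Label.ofCode v.toNat)
  ofVal_surjective l := ⟨.num l.code, by simp [Val.toNat, Label.ofCode_code]⟩

instance (n : ℕ) : Readable (Fin n) where
  ofVal v := if h : v.toNat < n then some ⟨v.toNat, h⟩ else none
  ofVal_surjective i := ⟨.num i, by simp [Val.toNat]⟩

/-- Vectors over `ℤ_q`. -/
abbrev Vec (q m : ℕ) : Type := Fin m → ZMod q

/-- One-time-pad encryption, in `ℤ_q`. -/
def mask {q m : ℕ} (x k : Vec q m) : Vec q m := x + k

/-- A residue is sent as its least nonnegative representative; every number is accepted as a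
representative of its residue class. -/
instance (q : ℕ) [NeZero q] : Readable (ZMod q) where
  ofVal v := some (v.toNat : ZMod q)
  ofVal_surjective a := ⟨.num a.val, by simp [Val.toNat]⟩

def Vec.toVal {q m : ℕ} (x : Vec q m) : Val := Val.ofFn fun j => .num (x j).val

def Vec.ofVal (q m : ℕ) (v : Val) : Vec q m := fun j => ((v.nth j).toNat : ZMod q)

theorem Vec.ofVal_toVal {q m : ℕ} [NeZero q] (x : Vec q m) : Vec.ofVal q m x.toVal = x := by
  funext j
  simp [Vec.ofVal, Vec.toVal, Val.nth_ofFn, Val.toNat]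

instance (q m : ℕ) [NeZero q] : Readable (Vec q m) where
  ofVal v := some (Vec.ofVal q m v)
  ofVal_surjective x := ⟨x.toVal, by rw [Vec.ofVal_toVal]⟩

instance (n q m : ℕ) [NeZero q] : Readable (Fin n → Vec q m) where
  ofVal v := some fun i => Vec.ofVal q m (v.nth i)
  ofVal_surjective x := ⟨Val.ofFn fun i => (x i).toVal, by
    simp [Val.nth_ofFn, Vec.ofVal_toVal]⟩

/-- A family of vectors indexed by `S ⊆ [n]`, as a list of length `n`: the entry with index `i`
is `(1, y_i)` if `i ∈ S` and `0` otherwise. -/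
def famToVal {n q m : ℕ} {S : Finset (Fin n)} (y : S → Vec q m) : Val :=
  Val.ofFn fun i : Fin n => if h : i ∈ S then .pair (.num 1) (y ⟨i, h⟩).toVal else .num 0

def famSupport (n : ℕ) (v : Val) : Finset (Fin n) :=
  Finset.univ.filter fun i => (v.nth i).fst.toNat ≠ 0

def famOfVal (n q m : ℕ) (v : Val) : (S : Finset (Fin n)) × (S → Vec q m) :=
  ⟨famSupport n v, fun i => Vec.ofVal q m (v.nth i.1).snd⟩

theorem famOfVal_famToVal {n q m : ℕ} [NeZero q] {S : Finset (Fin n)} (y : S → Vec q m) :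
    famOfVal n q m (famToVal y) = ⟨S, y⟩ := by
  have hS : famSupport n (famToVal y) = S := by
    ext i
    by_cases h : i ∈ S <;>
      simp [famSupport, famToVal, Val.nth_ofFn, h, Val.fst, Val.toNat]
  have hy : ∀ i : S, Vec.ofVal q m ((famToVal y).nth i.1).snd = y i := by
    rintro ⟨i, h⟩
    simp [famToVal, Val.nth_ofFn, h, Val.snd, Vec.ofVal_toVal]
  unfold famOfVal
  generalize famToVal y = v at hS hy
  subst hS
  congr 1
  funext i
  exact hy i

theorem famToVal_injective {n q m : ℕ} [NeZero q] {S : Finset (Fin n)} :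
    Function.Injective (famToVal : (S → Vec q m) → Val) := by
  intro y y' h
  have := (famOfVal_famToVal y).symm.trans ((congrArg (famOfVal n q m) h).trans
    (famOfVal_famToVal y'))
  simpa using this

instance (n q m : ℕ) [NeZero q] : Readable ((S : Finset (Fin n)) × (S → Vec q m)) where
  ofVal v := some (famOfVal n q m v)
  ofVal_surjective f := ⟨famToVal f.2, by rw [famOfVal_famToVal]⟩

/-- The answer to a query that is ignored, or that has no return value. -/
def ignored : Val := .num 0

/-- The answer to a query that returns `v`. -/
def answer (v : Val) : Val := .pair (.num 1) v

/-! ## Dynamic noisy multi-client functional encryption -/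

/-- A function family for at most `n` clients: the plaintext space `X ℓ` of a client and the
range `Y ℓ` for each label `ℓ`, and the functions in `F ℓ S`, which take one plaintext for each
client in `S`. -/
structure FunctionFamily where
  n : ℕ
  X : Label → Type
  Y : Label → Type
  F : Label → Finset (Fin n) → Type
  apply : ∀ {ℓ : Label} {S : Finset (Fin n)}, F ℓ S → (S → X ℓ) → Y ℓ
  [addY : ∀ ℓ, AddCommGroup (Y ℓ)]
  [readX : ∀ ℓ, Readable (X ℓ)]
  [readY : ∀ ℓ, Readable (Y ℓ)]
  [readF : ∀ ℓ, Readable ((S : Finset (Fin n)) × F ℓ S)]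

attribute [instance] FunctionFamily.addY FunctionFamily.readX FunctionFamily.readY
  FunctionFamily.readF

/-- The five algorithms of a DyNMCFE scheme, for a fixed security parameter and fixed maxima of
the vector length and of the number of clients.  `ekeygen` returns the encryption key and the
updated master secret key; the outcome `none` of `keygen` is `⊥`. -/
structure DyNMCFE (𝓕 : FunctionFamily) where
  PP : Type
  MSK : Type
  EK : Type
  CT : Label → Type
  DK : Label → Finset (Fin 𝓕.n) → Type
  [writePP : Writable PP]
  [writeEK : Writable EK]
  [writeCT : ∀ ℓ, Writable (CT ℓ)]
  [writeDK : ∀ ℓ S, Writable (DK ℓ S)]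
  setup : PMF (PP × MSK)
  ekeygen : PP → MSK → Fin 𝓕.n → PMF (EK × MSK)
  enc : PP → Fin 𝓕.n → EK → (ℓ : Label) → 𝓕.X ℓ → PMF (CT ℓ)
  keygen : PP → MSK → (S : Finset (Fin 𝓕.n)) → (ℓ : Label) → 𝓕.F ℓ S → PMF (𝓕.Y ℓ) →
    PMF (Option (DK ℓ S))
  dec : PP → (S : Finset (Fin 𝓕.n)) → (ℓ : Label) → DK ℓ S → (S → CT ℓ) → PMF (𝓕.Y ℓ)

attribute [instance] DyNMCFE.writePP DyNMCFE.writeEK DyNMCFE.writeCT DyNMCFE.writeDK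

/-- `QEnc(i, x⁰, x¹, ℓ)`, with `x β` for `x^β`. -/
structure EncQuery (𝓕 : FunctionFamily) where
  i : Fin 𝓕.n
  ℓ : Label
  x : Bool → 𝓕.X ℓ

/-- `QKeyGen(S, f, ℓ, ν⁰, ν¹)`, with `ν β` for `ν^β`. -/
structure KeyQuery (𝓕 : FunctionFamily) where
  S : Finset (Fin 𝓕.n)
  ℓ : Label
  f : 𝓕.F ℓ S
  ν : Bool → 𝓕.Y ℓ

inductive Query (𝓕 : FunctionFamily) : Type
  | cor (i : Fin 𝓕.n) : Query 𝓕
  | ekeygen (i : Fin 𝓕.n) : Query 𝓕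
  | enc (Q : EncQuery 𝓕) : Query 𝓕
  | keygen (Q : KeyQuery 𝓕) : Query 𝓕

/-- How a message of the adversary is read as a query: `(0, i)`, `(1, i)`,
`(2, [i, ℓ, x⁰, x¹])` or `(3, [ℓ, (S, f), ν⁰, ν¹])`. -/
def Query.read (𝓕 : FunctionFamily) (v : Val) : Option (Query 𝓕) :=
  match v.fst.toNat with
  | 0 => (Readable.ofVal v.snd : Option (Fin 𝓕.n)).map .cor
  | 1 => (Readable.ofVal v.snd : Option (Fin 𝓕.n)).map .ekeygen
  | 2 =>
    (Readable.ofVal (v.snd.nth 0) : Option (Fin 𝓕.n)).bind fun i =>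
    (Readable.ofVal (v.snd.nth 1) : Option Label).bind fun ℓ =>
    (Readable.ofVal (v.snd.nth 2) : Option (𝓕.X ℓ)).bind fun x0 =>
    (Readable.ofVal (v.snd.nth 3) : Option (𝓕.X ℓ)).bind fun x1 =>
    some (.enc ⟨i, ℓ, fun β => if β then x1 else x0⟩)
  | 3 =>
    (Readable.ofVal (v.snd.nth 0) : Option Label).bind fun ℓ =>
    (Readable.ofVal (v.snd.nth 1) : Option ((S : Finset (Fin 𝓕.n)) × 𝓕.F ℓ S)).bind fun f =>
    (Readable.ofVal (v.snd.nth 2) : Option (𝓕.Y ℓ)).bind fun ν0 =>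
    (Readable.ofVal (v.snd.nth 3) : Option (𝓕.Y ℓ)).bind fun ν1 =>
    some (.keygen ⟨f.1, ℓ, f.2, fun β => if β then ν1 else ν0⟩)
  | _ => none

namespace DyNMCFE

variable {𝓕 : FunctionFamily}

/-- The state of the challenger. -/
structure State (E : DyNMCFE 𝓕) where
  /-- the master secret key -/
  msk : E.MSK
  /-- the encryption keys generated so far -/
  ek : Fin 𝓕.n → Option E.EK
  /-- the set `CS` of corrupted clients; the other clients are honest -/
  CS : Finset (Fin 𝓕.n)
  /-- whether a query other than a corruption query has been made -/
  started : Bool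
  /-- the encryption queries that were answered -/
  encLog : List (EncQuery 𝓕)
  /-- the decryption key queries that were answered -/
  keyLog : List (KeyQuery 𝓕)
  /-- the labels that occurred in encryption and decryption key queries -/
  labels : Finset Label

def State.init (E : DyNMCFE 𝓕) (msk : E.MSK) : State E where
  msk := msk
  ek := fun _ => none
  CS := ∅
  started := false
  encLog := []
  keyLog := []
  labels := ∅

variable (E : DyNMCFE 𝓕) (pp : E.PP) (β : Bool)

/-- Corruption queries are allowed only before all other queries. -/
def onCor (s : State E) (i : Fin 𝓕.n) : PMF (Val × State E) :=
  if s.started then PMF.pure (ignored, s) else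
  match s.ek i with
  | some k => PMF.pure (answer (Writable.toVal k), s)
  | none => (E.ekeygen pp s.msk i).map fun r => (answer (Writable.toVal r.1),
      { s with msk := r.2, ek := Function.update s.ek i (some r.1), CS := insert i s.CS })

/-- Registration of a client; without effect if the client already has a key. -/
def onEKeyGen (s : State E) (i : Fin 𝓕.n) : PMF (Val × State E) :=
  match s.ek i with
  | some _ => PMF.pure (ignored, { s with started := true })
  | none => (E.ekeygen pp s.msk i).map fun r => (ignored,
      { s with started := true, msk := r.2, ek := Function.update s.ek i (some r.1) })

open Classical in
/-- Encryption queries: at most one answer for each pair of a client and a label. -/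
def onEnc (s : State E) (Q : EncQuery 𝓕) : PMF (Val × State E) :=
  match s.ek Q.i with
  | none => PMF.pure (ignored, { s with started := true, labels := insert Q.ℓ s.labels })
  | some k =>
    if ∃ Q' ∈ s.encLog, Q'.i = Q.i ∧ Q'.ℓ = Q.ℓ then
      PMF.pure (ignored, { s with started := true, labels := insert Q.ℓ s.labels })
    else (E.enc pp Q.i k Q.ℓ (Q.x β)).map fun c => (answer (Writable.toVal c),
      { s with started := true, labels := insert Q.ℓ s.labels, encLog := Q :: s.encLog })

/-- Decryption key queries, with the distribution concentrated in `ν^β`. -/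
def onKeyGen (s : State E) (Q : KeyQuery 𝓕) : PMF (Val × State E) :=
  if ∀ i ∈ Q.S, (s.ek i).isSome then
    (E.keygen pp s.msk Q.S Q.ℓ Q.f (PMF.pure (Q.ν β))).map fun d =>
      (match d with
        | none => ignored
        | some k => answer (Writable.toVal k),
      { s with started := true, labels := insert Q.ℓ s.labels, keyLog := Q :: s.keyLog })
  else PMF.pure (ignored, { s with started := true, labels := insert Q.ℓ s.labels })

def oracle (s : State E) (m : Val) : PMF (Val × State E) :=
  match Query.read 𝓕 m with
  | none => PMF.pure (ignored, s)
  | some (.cor i) => onCor E pp s i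
  | some (.ekeygen i) => onEKeyGen E pp s i
  | some (.enc Q) => onEnc E pp β s Q
  | some (.keygen Q) => onKeyGen E pp β s Q

variable {E}

/-- Admissibility of the adversary. -/
structure Admissible (s : State E) : Prop where
  corrupted : ∀ Q ∈ s.encLog, Q.i ∈ s.CS → Q.x false = Q.x true
  complete : ∀ K ∈ s.keyLog, ∀ i ∈ K.S, i ∉ s.CS → ∃ Q ∈ s.encLog, Q.i = i ∧ Q.ℓ = K.ℓ
  balanced : ∀ K ∈ s.keyLog, ∀ x : Bool → K.S → 𝓕.X K.ℓ,
    (∀ i : K.S, i.1 ∉ s.CS → (⟨i.1, K.ℓ, fun β => x β i⟩ : EncQuery 𝓕) ∈ s.encLog) →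
    (∀ i : K.S, i.1 ∈ s.CS → x false i = x true i) →
    𝓕.apply K.f (x false) + K.ν false = 𝓕.apply K.f (x true) + K.ν true

variable (E)

/-- The execution of the game with challenge bit `β`: the output of the adversary and the final
state of the challenger. -/
def exec (A : PPT) (κ : ℕ) (β : Bool) : PMF (Option Val × State E) :=
  E.setup.bind fun r =>
    (A.comp κ (Writable.toVal r.1)).run (E.oracle r.1 β) (State.init E r.2)

open Classical in
/-- The outcome of the game with challenge bit `β`, which is the guess of the adversary, replaced
by `0` if the adversary was not admissible. -/
def game (A : PPT) (κ : ℕ) (β : Bool) : PMF Bool :=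
  (E.exec A κ β).map fun r => decide (OutputsOne r.1 ∧ Admissible r.2)

/-- In every execution of either game, the adversary uses at most `N` distinct labels in its
encryption and decryption key queries. -/
def LabelBound (A : PPT) (κ N : ℕ) : Prop :=
  ∀ β, ∀ r ∈ (E.exec A κ β).support, r.2.labels.card ≤ N

end DyNMCFE

/-- The advantage of `A` against a family of schemes indexed by the security parameter. -/
def DyNMCFE.adv {𝓕 : ℕ → FunctionFamily} (E : ∀ κ, DyNMCFE (𝓕 κ)) (A : PPT) (κ : ℕ) : ℝ :=
  advantage ((E κ).game A κ)

def DyNMCFE.INDSecure {𝓕 : ℕ → FunctionFamily} (E : ∀ κ, DyNMCFE (𝓕 κ)) : Prop :=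
  ∀ A : PPT, Negligible (DyNMCFE.adv E A)

/-! ## Noisy multi-input functional encryption

The same notions without labels, corruptions and dynamic registration. -/

structure MultiInputFamily where
  n : ℕ
  X : Type
  Y : Type
  F : Type
  apply : F → (Fin n → X) → Y
  [addY : AddCommGroup Y]
  [readX : Readable X]
  [readY : Readable Y]
  [readF : Readable F]

attribute [instance] MultiInputFamily.addY MultiInputFamily.readX MultiInputFamily.readY
  MultiInputFamily.readF

structure NMIFE (𝓕 : MultiInputFamily) where
  PP : Type
  MSK : Type
  EK : Type
  CT : Type
  DK : Type
  [writePP : Writable PP]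
  [writeCT : Writable CT]
  [writeDK : Writable DK]
  setup : PMF (PP × MSK × (Fin 𝓕.n → EK))
  enc : PP → Fin 𝓕.n → EK → 𝓕.X → PMF CT
  keygen : PP → MSK → 𝓕.F → PMF 𝓕.Y → PMF DK
  dec : PP → DK → (Fin 𝓕.n → CT) → PMF 𝓕.Y

attribute [instance] NMIFE.writePP NMIFE.writeCT NMIFE.writeDK

namespace NMIFE

variable {𝓕 : MultiInputFamily}

structure EncQuery (𝓕 : MultiInputFamily) where
  i : Fin 𝓕.n
  x : Bool → 𝓕.X

structure KeyQuery (𝓕 : MultiInputFamily) where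
  f : 𝓕.F
  ν : Bool → 𝓕.Y

/-- Messages `(0, [i, x⁰, x¹])` are encryption queries and messages `(1, [f, ν⁰, ν¹])` are
decryption key queries. -/
def readQuery (𝓕 : MultiInputFamily) (v : Val) : Option (EncQuery 𝓕 ⊕ KeyQuery 𝓕) :=
  match v.fst.toNat with
  | 0 =>
    (Readable.ofVal (v.snd.nth 0) : Option (Fin 𝓕.n)).bind fun i =>
    (Readable.ofVal (v.snd.nth 1) : Option 𝓕.X).bind fun x0 =>
    (Readable.ofVal (v.snd.nth 2) : Option 𝓕.X).bind fun x1 =>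
    some (.inl ⟨i, fun β => if β then x1 else x0⟩)
  | 1 =>
    (Readable.ofVal (v.snd.nth 0) : Option 𝓕.F).bind fun f =>
    (Readable.ofVal (v.snd.nth 1) : Option 𝓕.Y).bind fun ν0 =>
    (Readable.ofVal (v.snd.nth 2) : Option 𝓕.Y).bind fun ν1 =>
    some (.inr ⟨f, fun β => if β then ν1 else ν0⟩)
  | _ => none

/-- The queries answered so far. -/
structure State (𝓕 : MultiInputFamily) where
  encLog : List (EncQuery 𝓕)
  keyLog : List (KeyQuery 𝓕)

open Classical in
def oracle (E : NMIFE 𝓕) (pp : E.PP) (msk : E.MSK) (ek : Fin 𝓕.n → E.EK) (β : Bool)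
    (s : State 𝓕) (m : Val) : PMF (Val × State 𝓕) :=
  match readQuery 𝓕 m with
  | none => PMF.pure (ignored, s)
  | some (.inl Q) =>
    if ∃ Q' ∈ s.encLog, Q'.i = Q.i then PMF.pure (ignored, s)
    else (E.enc pp Q.i (ek Q.i) (Q.x β)).map fun c => (answer (Writable.toVal c),
      { s with encLog := Q :: s.encLog })
  | some (.inr K) =>
    (E.keygen pp msk K.f (PMF.pure (K.ν β))).map fun d => (answer (Writable.toVal d),
      { s with keyLog := K :: s.keyLog })

structure Admissible (s : State 𝓕) : Prop where
  complete : ∀ K ∈ s.keyLog, ∀ i, ∃ Q ∈ s.encLog, Q.i = i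
  balanced : ∀ K ∈ s.keyLog, ∀ x : Bool → Fin 𝓕.n → 𝓕.X,
    (∀ i, (⟨i, fun β => x β i⟩ : EncQuery 𝓕) ∈ s.encLog) →
    𝓕.apply K.f (x false) + K.ν false = 𝓕.apply K.f (x true) + K.ν true

open Classical in
def game (E : NMIFE 𝓕) (A : PPT) (κ : ℕ) (β : Bool) : PMF Bool :=
  E.setup.bind fun r =>
    ((A.comp κ (Writable.toVal r.1)).run (E.oracle r.1 r.2.1 r.2.2 β) ⟨[], []⟩).map
      fun r => decide (OutputsOne r.1 ∧ Admissible r.2)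

def adv {𝓕 : ℕ → MultiInputFamily} (E : ∀ κ, NMIFE (𝓕 κ)) (A : PPT) (κ : ℕ) : ℝ :=
  advantage ((E κ).game A κ)

end NMIFE

/-! ## Public parameters and ciphertexts of the inner-product schemes -/

/-- The public parameters: the modulus, the (maximal) vector length and the (maximal) number of
clients. -/
structure PublicParams where
  q : ℕ
  m : ℕ
  n : ℕ

instance : Writable PublicParams where
  toVal p := .ofList [.num p.q, .num p.m, .num p.n]
  toVal_injective := by
    rintro ⟨q, m, n⟩ ⟨q', m', n'⟩ h
    simpa [Val.ofList] using h

theorem Vec.toVal_injective {q m : ℕ} [NeZero q] :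
    Function.Injective (Vec.toVal : Vec q m → Val) :=
  Function.LeftInverse.injective Vec.ofVal_toVal

/-- A ciphertext `(i, c)` of the one-time scheme. -/
instance (n q m : ℕ) [NeZero q] : Writable (Fin n × Vec q m) where
  toVal c := .ofList [.num c.1, c.2.toVal]
  toVal_injective := by
    rintro ⟨i, c⟩ ⟨i', c'⟩ h
    simp only [Val.ofList, Val.pair.injEq, Val.num.injEq, and_true] at h
    exact Prod.ext (Fin.ext h.1) (Vec.toVal_injective h.2)

/-- A decryption key `(y, z)` of the one-time scheme. -/
instance (n q m : ℕ) [NeZero q] : Writable ((Fin n → Vec q m) × ZMod q) where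
  toVal d := .ofList [.ofFn fun i => (d.1 i).toVal, .num d.2.val]
  toVal_injective := by
    rintro ⟨y, z⟩ ⟨y', z'⟩ h
    simp only [Val.ofList, Val.pair.injEq, Val.num.injEq, and_true] at h
    refine Prod.ext (funext fun i => Vec.toVal_injective ?_) (ZMod.val_injective q h.2)
    simpa [Val.nth_ofFn] using congrArg (fun v => v.nth i) h.1

/-- The one-time scheme `NMIFE^ot` for `n` clients and inner products of vectors in `ℤ_q^m`. -/
def innerProducts (q m n : ℕ) [NeZero q] : MultiInputFamily where
  n := n
  X := Vec q m
  Y := ZMod q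
  F := Fin n → Vec q m
  apply y x := ∑ i, x i ⬝ᵥ y i

def nmifeOt (q m n : ℕ) [NeZero q] : NMIFE (innerProducts q m n) where
  PP := PublicParams
  MSK := Fin n → Vec q m
  EK := Vec q m
  CT := Fin n × Vec q m
  DK := (Fin n → Vec q m) × ZMod q
  setup := (PMF.uniformOfFintype (Fin n → Vec q m)).map fun ek => (⟨q, m, n⟩, ek, ek)
  enc _ i ek x := PMF.pure (i, mask x ek)
  keygen _ msk y D := D.map fun ν => (y, ∑ i, msk i ⬝ᵥ y i - ν)
  dec _ d c := PMF.pure (∑ i, (c i).2 ⬝ᵥ d.1 i - d.2)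

/-! ## Pseudorandom functions and the scheme DyNo -/

/-- The ingredients of DyNo, as functions of the security parameter `κ`: the modulus `q`, the
maximal number `nmax` of clients, the maximal vector length `mmax`, the vector length
`len κ ℓ ≤ mmax κ` that belongs to the label `ℓ`, and a keyed function
`prf κ : {0,1}^κ × L → ℤ_q^mmax`. -/
structure Params where
  q : ℕ → ℕ
  nmax : ℕ → ℕ
  mmax : ℕ → ℕ
  len : ℕ → Label → ℕ
  prf : (κ : ℕ) → BitVec κ → Label → Vec (q κ) (mmax κ)
  [q_ne_zero : ∀ κ, NeZero (q κ)]
  len_le : ∀ κ ℓ, len κ ℓ ≤ mmax κ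

attribute [instance] Params.q_ne_zero

instance (κ : ℕ) : Writable (BitVec κ) where
  toVal w := .num w.toNat
  toVal_injective := by
    intro w w' h
    exact BitVec.eq_of_toNat_eq (by simpa using h)

namespace Params

/-- The ingredients are efficient: `nmax`, `mmax` and the bit length of `q` are at most polynomial
in `κ`, and all of them can be computed in polynomial time. -/
structure Efficient (P : Params) : Prop where
  size_q_le : ∃ p : Polynomial ℕ, ∀ κ, Nat.size (P.q κ) ≤ p.eval κ
  nmax_le : ∃ p : Polynomial ℕ, ∀ κ, P.nmax κ ≤ p.eval κ
  mmax_le : ∃ p : Polynomial ℕ, ∀ κ, P.mmax κ ≤ p.eval κ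
  q_poly : PolyTimeFun (fun κ : ℕ => κ) (fun κ => .num κ) (fun κ => .num (P.q κ))
  nmax_poly : PolyTimeFun (fun κ : ℕ => κ) (fun κ => .num κ) (fun κ => .num (P.nmax κ))
  mmax_poly : PolyTimeFun (fun κ : ℕ => κ) (fun κ => .num κ) (fun κ => .num (P.mmax κ))
  len_poly : PolyTimeFun (fun d : ℕ × Label => d.1 + Nat.size d.2.code)
    (fun d => .pair (.num d.1) (.num d.2.code)) (fun d => .num (P.len d.1 d.2))
  prf_poly : PolyTimeFun (fun d : (κ : ℕ) × BitVec κ × Label => d.1 + Nat.size d.2.2.code)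
    (fun d => .ofList [.num d.1, .num d.2.1.toNat, .num d.2.2.code])
    (fun d => (P.prf d.1 d.2.1 d.2.2).toVal)

variable (P : Params)

/-- The oracle of the pseudorandomness game: the keyed function if `β = 0`, and a random function,
whose values are drawn when they are first needed, if `β = 1`. -/
def prfOracle (κ : ℕ) (K : BitVec κ) (β : Bool) (T : Label → Option (Vec (P.q κ) (P.mmax κ)))
    (m : Val) : PMF (Val × (Label → Option (Vec (P.q κ) (P.mmax κ)))) :=
  let ℓ := Label.ofCode m.toNat
  if β then
    match T ℓ with
    | some y => PMF.pure (y.toVal, T)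
    | none => (PMF.uniformOfFintype (Vec (P.q κ) (P.mmax κ))).map fun y =>
        (y.toVal, Function.update T ℓ (some y))
  else PMF.pure ((P.prf κ K ℓ).toVal, T)

open Classical in
def prfGame (B : PPT) (κ : ℕ) (β : Bool) : PMF Bool :=
  (PMF.uniformOfFintype (BitVec κ)).bind fun K =>
    ((B.comp κ (.num 0)).run (P.prfOracle κ K β) fun _ => none).map
      fun r => decide (OutputsOne r.1)

def prfAdv (B : PPT) (κ : ℕ) : ℝ := advantage (P.prfGame B κ)

def PRFSecure : Prop := ∀ B : PPT, Negligible (P.prfAdv B)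

/-- The first `len κ ℓ` entries of the value of the keyed function. -/
def pad (κ : ℕ) (K : BitVec κ) (ℓ : Label) : Vec (P.q κ) (P.len κ ℓ) :=
  fun j => P.prf κ K ℓ (Fin.castLE (P.len_le κ ℓ) j)

/-- The inner products over `ℤ_q` for the subsets of the `nmax` clients. -/
def family (κ : ℕ) : FunctionFamily where
  n := P.nmax κ
  X ℓ := Vec (P.q κ) (P.len κ ℓ)
  Y _ := ZMod (P.q κ)
  F ℓ S := S → Vec (P.q κ) (P.len κ ℓ)
  apply y x := ∑ i, x i ⬝ᵥ y i

/-- A ciphertext `(i, ℓ, c)`. -/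
structure Ciphertext (κ : ℕ) (ℓ : Label) where
  i : Fin (P.nmax κ)
  c : Vec (P.q κ) (P.len κ ℓ)

instance (κ : ℕ) (ℓ : Label) : Writable (P.Ciphertext κ ℓ) where
  toVal c := .ofList [.num c.i, .num ℓ.code, c.c.toVal]
  toVal_injective := by
    rintro ⟨i, c⟩ ⟨i', c'⟩ h
    simp only [Val.ofList, Val.pair.injEq, Val.num.injEq, and_true, true_and] at h
    obtain rfl := Fin.ext h.1
    obtain rfl := Vec.toVal_injective h.2
    rfl

/-- A decryption key `(ℓ, y, z)`. -/
structure DecKey (κ : ℕ) (ℓ : Label) (S : Finset (Fin (P.nmax κ))) where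
  y : S → Vec (P.q κ) (P.len κ ℓ)
  z : ZMod (P.q κ)

instance writableDecKey (κ : ℕ) (ℓ : Label) (S : Finset (Fin (P.nmax κ))) :
    Writable (P.DecKey κ ℓ S) where
  toVal d := .ofList [.num ℓ.code, famToVal d.y, .num d.z.val]
  toVal_injective := by
    rintro ⟨y, z⟩ ⟨y', z'⟩ h
    simp only [Val.ofList, Val.pair.injEq, Val.num.injEq, and_true, true_and] at h
    obtain rfl := famToVal_injective h.1
    obtain rfl := ZMod.val_injective _ h.2
    rfl

/-- The scheme DyNo.  The master secret key is the partial map from clients to their keys. -/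
def dyNo (κ : ℕ) : DyNMCFE (P.family κ) where
  PP := PublicParams
  MSK := Fin (P.nmax κ) → Option (BitVec κ)
  EK := BitVec κ
  CT ℓ := P.Ciphertext κ ℓ
  DK ℓ S := P.DecKey κ ℓ S
  writeDK ℓ S := P.writableDecKey κ ℓ S
  setup := PMF.pure (⟨P.q κ, P.mmax κ, P.nmax κ⟩, fun _ => none)
  ekeygen _ msk i := (PMF.uniformOfFintype (BitVec κ)).map fun k =>
    (k, Function.update msk i (some k))
  enc _ i k ℓ x := PMF.pure ⟨i, mask x (P.pad κ k ℓ)⟩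
  keygen _ msk S ℓ y D :=
    if h : ∀ i : S, (msk i.1).isSome then
      D.map fun ν => some ⟨y, ∑ i, P.pad κ ((msk i.1).get (h i)) ℓ ⬝ᵥ y i - ν⟩
    else PMF.pure none
  dec _ _ _ d c := PMF.pure (∑ i, (c i).c ⬝ᵥ d.y i - d.z)

/-- The one-time scheme for `nmax` clients and vectors of length `mmax`. -/
def oneTime (κ : ℕ) : NMIFE (innerProducts (P.q κ) (P.mmax κ) (P.nmax κ)) :=
  nmifeOt (P.q κ) (P.mmax κ) (P.nmax κ)

end Params

end DyNoFE

end

/-!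
The security of the scheme is shown by a hybrid argument over the clients, which is carried out for
programs: the model of computation is concrete, so that the reduction has to be given as a program
together with a polynomial bound for its time.

*The reduction to the keyed function.* In the hybrid game at position `j`, the pads of the honest
clients with index less than `j` are uniformly random, and those of all other clients come from
their keys. At position `0` this is the game (`game_eq_hybrid`). At position `nmax` the pads of all
honest clients are random, and the one-time pad is perfect: as an admissible adversary satisfies the
balance condition for its decryption key queries, its view with bit `0` is its view with bit `1` in
which every pad is shifted by the difference of the two plaintexts (`gameAns_shift`), so that the
probabilities of winning agree (`hybrid_last`). The reduction draws a bit `β` and a position `j` at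
random and gives the client `j` the answers of its own oracle as pads; it thereby plays the hybrid
game at position `j` if the oracle is the keyed function, and at position `j + 1` if the oracle is
random (`toHybrid_oracle`, `prfGame_reduction`). It outputs whether the adversary wins, or the
negation of this if `β = 1`. The sums over `j` telescope, and this gives the advantage of the
adversary as *exactly* `2 * nmax` times the advantage of the reduction (`adv_eq`). No factor for the
number of labels is lost, since one random function serves all labels.

*From this to the theorem.* Since `nmax` is bounded by a polynomial, security of the keyed function
yields security of the scheme. For the concrete bound with `qℓ ≥ 1`, the first summand alone is large
enough. The advantage against the one-time scheme only has to be nonnegative: its place in the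
argument is that of the last hybrid game, where the perfect security of the one-time pad is used
directly. If `qℓ = 0`, then the adversary makes no encryption or decryption key queries and sees
nothing of the bit (`game_eq_of_labelBound`).

*Corruptions and lazy sampling.* The challenger draws keys when clients are registered, a random
function draws its values when they are asked for, and the reduction draws fresh numbers for each
message. All of these are compared with games in which the answers are functions of a table drawn in
advance (`run_lazyOracle`). Since corruptions are static, whether a client is corrupted is known when
its first pad is needed; a client has two places in the table of keys, one for the case that it is
corrupted. The state of the challenger is a function of the messages and the keys
(`oracle_toState`, `admissible_toState`), so that games are described in terms of lists of messages
only.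

*Efficiency.* `Poly f` says that `f` is computed by a deterministic program without queries in time
polynomial in the size of the input; this notion is closed under the constructions that are needed,
among them loops over lists. `Code.lift` turns the program of the adversary into one in which each
oracle query is replaced by a subroutine that acts on an additional state. A query uses as much of
the adversary's time as its size, and this pays for the subroutine (`lift_wp`), so that a simulator
described by functions that are computable in polynomial time is an adversary again
(`Simulator.Efficient.exists_ppt`).
-/

noncomputable section

set_option linter.unusedSimpArgs false

namespace DyNoFE

/-! ### Computations up to time, and up to being cut off -/

namespace Comp

variable {α β γ σ τ S : Type}

theorem bind_assoc (c : Comp α) (g : α → Comp β) (g' : β → Comp γ) :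
    (c.bind g).bind g' = c.bind fun a => (g a).bind g' := by
  induction c with
  | ret a => rfl
  | fail => rfl
  | tick n k ih => simp [bind, ih]
  | rand n k ih => simp [bind, ih]
  | query m k ih => simp [bind, ih]

/-- The computation without its time annotations. -/
def erase : Comp α → Comp α
  | ret a => ret a
  | fail => fail
  | tick _ k => k.erase
  | rand n k => rand n fun i => (k i).erase
  | query m k => query m fun v => (k v).erase

@[simp] theorem erase_ret (a : α) : (ret a).erase = ret a := rfl
@[simp] theorem erase_fail : (fail : Comp α).erase = fail := rfl
@[simp] theorem erase_tick (n : ℕ) (k : Comp α) : (tick n k).erase = k.erase := rfl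
@[simp] theorem erase_rand (n : ℕ) (k : Fin (n + 1) → Comp α) :
    (rand n k).erase = rand n fun i => (k i).erase := rfl
@[simp] theorem erase_query (m : Val) (k : Val → Comp α) :
    (query m k).erase = query m fun v => (k v).erase := rfl

@[simp] theorem ret_bind (a : α) (g : α → Comp β) : (ret a).bind g = g a := rfl
@[simp] theorem fail_bind (g : α → Comp β) : (fail : Comp α).bind g = fail := rfl
@[simp] theorem tick_bind (n : ℕ) (k : Comp α) (g : α → Comp β) :
    (tick n k).bind g = tick n (k.bind g) := rfl
@[simp] theorem rand_bind (n : ℕ) (k : Fin (n + 1) → Comp α) (g : α → Comp β) :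
    (rand n k).bind g = rand n fun i => (k i).bind g := rfl
@[simp] theorem query_bind (m : Val) (k : Val → Comp α) (g : α → Comp β) :
    (query m k).bind g = query m fun v => (k v).bind g := rfl

@[simp] theorem erase_bind (c : Comp α) (g : α → Comp β) :
    (c.bind g).erase = c.erase.bind fun a => (g a).erase := by
  induction c with
  | ret a => rfl
  | fail => rfl
  | tick n k ih => simp [ih]
  | rand n k ih => simp [ih]
  | query m k ih => simp [ih]

theorem run_erase (O : σ → Val → PMF (Val × σ)) (c : Comp α) (s : σ) :
    c.erase.run O s = c.run O s := by
  induction c generalizing s with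
  | ret a => rfl
  | fail => rfl
  | tick n k ih => simp [run, ih]
  | rand n k ih => simp [run, ih]
  | query m k ih => simp [run, ih]

/-- `c.Le d`: the computation `d` is `c`, except that it may go on where `c` is cut off. -/
def Le : Comp α → Comp α → Prop
  | fail, _ => True
  | ret a, d => d = ret a
  | tick n k, d => ∃ k', d = tick n k' ∧ k.Le k'
  | rand n k, d => ∃ k', d = rand n k' ∧ ∀ i, (k i).Le (k' i)
  | query m k, d => ∃ k', d = query m k' ∧ ∀ v, (k v).Le (k' v)

theorem Le.refl (c : Comp α) : c.Le c := by
  induction c with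
  | ret a => rfl
  | fail => trivial
  | tick n k ih => exact ⟨k, rfl, ih⟩
  | rand n k ih => exact ⟨k, rfl, ih⟩
  | query m k ih => exact ⟨k, rfl, ih⟩

theorem Le.bind {c d : Comp α} {g g' : α → Comp β} (h : c.Le d) (hg : ∀ a, (g a).Le (g' a)) :
    (c.bind g).Le (d.bind g') := by
  induction c generalizing d with
  | ret a => obtain rfl := h; exact hg a
  | fail => trivial
  | tick n k ih => obtain ⟨k', rfl, h⟩ := h; exact ⟨_, rfl, ih h⟩
  | rand n k ih => obtain ⟨k', rfl, h⟩ := h; exact ⟨_, rfl, fun i => ih i (h i)⟩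
  | query m k ih => obtain ⟨k', rfl, h⟩ := h; exact ⟨_, rfl, fun i => ih i (h i)⟩

theorem Le.trans {c d e : Comp α} (h : c.Le d) (h' : d.Le e) : c.Le e := by
  induction c generalizing d e with
  | ret a => obtain rfl := h; exact h'
  | fail => trivial
  | tick n k ih =>
    obtain ⟨k', rfl, h⟩ := h
    obtain ⟨k'', rfl, h'⟩ := h'
    exact ⟨_, rfl, ih h h'⟩
  | rand n k ih =>
    obtain ⟨k', rfl, h⟩ := h
    obtain ⟨k'', rfl, h'⟩ := h'
    exact ⟨_, rfl, fun i => ih i (h i) (h' i)⟩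
  | query m k ih =>
    obtain ⟨k', rfl, h⟩ := h
    obtain ⟨k'', rfl, h'⟩ := h'
    exact ⟨_, rfl, fun i => ih i (h i) (h' i)⟩

theorem Le.bind_map {c : Comp β} {d : Comp α} {φ : α → β} {g : β → Comp γ} {g' : α → Comp γ}
    (h : c.Le (d.bind fun r => ret (φ r))) (hg : ∀ r, (g (φ r)).Le (g' r)) :
    (c.bind g).Le (d.bind g') :=
  (h.bind fun a => Le.refl (g a)).trans (by
    rw [bind_assoc]
    exact (Le.refl d).bind hg)

theorem Le.bind_of_ret {c : Comp α} {g : α → Comp β} {d : Comp β} {a : α} (h : c.Le (ret a))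
    (hg : (g a).Le d) : (c.bind g).Le d := by
  cases c with
  | ret b => cases h; exact hg
  | fail => trivial
  | tick n k => obtain ⟨k', h, -⟩ := h; cases h
  | rand n k => obtain ⟨k', h, -⟩ := h; cases h
  | query n k => obtain ⟨k', h, -⟩ := h; cases h

theorem Le.erase {c d : Comp α} (h : c.Le d) : c.erase.Le d.erase := by
  induction c generalizing d with
  | ret a => obtain rfl := h; rfl
  | fail => trivial
  | tick n k ih => obtain ⟨k', rfl, h⟩ := h; exact ih (d := k') h
  | rand n k ih => obtain ⟨k', rfl, h⟩ := h; exact ⟨_, rfl, fun i => ih i (h i)⟩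
  | query m k ih => obtain ⟨k', rfl, h⟩ := h; exact ⟨_, rfl, fun i => ih i (h i)⟩

/-- The computation is never cut off. -/
def NoFail : Comp α → Prop
  | ret _ => True
  | fail => False
  | tick _ k => k.NoFail
  | rand _ k => ∀ i, (k i).NoFail
  | query _ k => ∀ v, (k v).NoFail

theorem NoFail.erase {c : Comp α} (h : c.NoFail) : c.erase.NoFail := by
  induction c with
  | ret a => trivial
  | fail => exact h
  | tick n k ih => exact ih h
  | rand n k ih => exact fun i => ih i (h i)
  | query m k ih => exact fun i => ih i (h i)

theorem Le.eq_of_noFail {c d : Comp α} (h : c.Le d) (hc : c.NoFail) : d = c := by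
  induction c generalizing d with
  | ret a => exact h
  | fail => exact hc.elim
  | tick n k ih => obtain ⟨k', rfl, h⟩ := h; rw [ih h hc]
  | rand n k ih =>
    obtain ⟨k', rfl, h⟩ := h
    rw [show k' = k from funext fun i => ih i (h i) (hc i)]
  | query m k ih =>
    obtain ⟨k', rfl, h⟩ := h
    rw [show k' = k from funext fun i => ih i (h i) (hc i)]

theorem NoFail.isSome {c : Comp α} (hc : c.NoFail) (O : σ → Val → PMF (Val × σ)) (s : σ)
    {r : Option α × σ} (hr : r ∈ (c.run O s).support) : r.1.isSome := by
  induction c generalizing s with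
  | ret a => simp only [run, PMF.support_pure, Set.mem_singleton_iff] at hr; simp [hr]
  | fail => exact hc.elim
  | tick n k ih => exact ih hc s hr
  | rand n k ih =>
    simp only [run, PMF.support_bind, Set.mem_iUnion] at hr
    obtain ⟨i, -, hr⟩ := hr
    exact ih i (hc i) s hr
  | query m k ih =>
    simp only [run, PMF.support_bind, Set.mem_iUnion] at hr
    obtain ⟨i, -, hr⟩ := hr
    exact ih i.1 (hc i.1) i.2 hr

theorem run_bind (O : σ → Val → PMF (Val × σ)) (c : Comp α) (g : α → Comp β) (s : σ) :
    (c.bind g).run O s = (c.run O s).bind fun r =>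
      match r.1 with
      | none => PMF.pure (none, r.2)
      | some a => (g a).run O r.2 := by
  induction c generalizing s with
  | ret a => simp [run]
  | fail => simp [run]
  | tick n k ih => simp [run, ih]
  | rand n k ih => simp [run, ih, PMF.bind_bind]
  | query m k ih => simp [run, ih, PMF.bind_bind]

/-- Time bounds with a postcondition: the computation ends in time at most `t` with a result `a`
and a rest `t'` of the time for which `Q a t'` holds. -/
def WP : Comp α → ℕ → (α → ℕ → Prop) → Prop
  | ret a, t, Q => Q a t
  | fail, _, _ => False
  | tick c k, t, Q => c ≤ t ∧ k.WP (t - c) Q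
  | rand _ k, t, Q => ∀ i, (k i).WP t Q
  | query _ k, t, Q => ∀ v, (k v).WP t Q

theorem within_iff (c : Comp α) (t : ℕ) : c.Within t ↔ c.WP t fun _ _ => True := by
  induction c generalizing t with
  | ret a => rfl
  | fail => rfl
  | tick n k ih => simp [Within, WP, ih]
  | rand n k ih => simp [Within, WP, ih]
  | query m k ih => simp [Within, WP, ih]

theorem wp_bind (c : Comp α) (g : α → Comp β) (t : ℕ) (Q : β → ℕ → Prop) :
    (c.bind g).WP t Q ↔ c.WP t fun a t' => (g a).WP t' Q := by
  induction c generalizing t with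
  | ret a => rfl
  | fail => rfl
  | tick n k ih => simp [WP, ih]
  | rand n k ih => simp [WP, ih]
  | query m k ih => simp [WP, ih]

theorem WP.mono {c : Comp α} {t t₁ : ℕ} {Q Q' : α → ℕ → Prop} (h : c.WP t Q) (ht : t ≤ t₁)
    (hQ : ∀ a t' t₁', t' ≤ t → t' ≤ t₁' → t₁' + t ≤ t' + t₁ → t' + t₁ ≤ t₁' + t →
      Q a t' → Q' a t₁') : c.WP t₁ Q' := by
  induction c generalizing t t₁ with
  | ret a => exact hQ a t t₁ le_rfl ht (by omega) (by omega) h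
  | fail => exact h
  | tick n k ih =>
    exact ⟨h.1.trans ht, ih h.2 (by omega) fun a t' t₁' h1 h2 h3 h4 =>
      hQ a t' t₁' (by omega) h2 (by have := h.1; omega) (by have := h.1; omega)⟩
  | rand n k ih => exact fun i => ih i (h i) ht hQ
  | query m k ih => exact fun i => ih i (h i) ht hQ

theorem WP.imp {c : Comp α} {t : ℕ} {Q Q' : α → ℕ → Prop} (h : c.WP t Q)
    (hQ : ∀ a t', t' ≤ t → Q a t' → Q' a t') : c.WP t Q' :=
  h.mono le_rfl fun a t' t₁' h1 h2 h3 _ h5 => by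
    obtain rfl : t' = t₁' := by omega
    exact hQ a t' h1 h5

theorem WP.noFail {c : Comp α} {t : ℕ} {Q : α → ℕ → Prop} (h : c.WP t Q) : c.NoFail := by
  induction c generalizing t with
  | ret a => trivial
  | fail => exact h
  | tick n k ih => exact ih h.2
  | rand n k ih => exact fun i => ih i (h i)
  | query m k ih => exact fun i => ih i (h i)

theorem ReturnsIn.wp {c : Comp α} {a : α} {t s : ℕ} (h : c.ReturnsIn a t) :
    c.WP (t + s) fun b t' => b = a ∧ s ≤ t' := by
  induction c generalizing t with
  | ret b => exact ⟨h, Nat.le_add_left s t⟩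
  | fail => exact h
  | tick n k ih =>
    obtain ⟨h1, h2⟩ := h
    refine ⟨by omega, ?_⟩
    have := ih h2
    rwa [show t - n + s = t + s - n by omega] at this
  | rand n k ih => exact h.elim
  | query m k ih => exact h.elim

theorem ReturnsIn.mono {c : Comp α} {a : α} {t t' : ℕ} (h : c.ReturnsIn a t) (ht : t ≤ t') :
    c.ReturnsIn a t' := by
  induction c generalizing t t' with
  | ret b => exact h
  | fail => exact h
  | tick n k ih => exact ⟨h.1.trans ht, ih h.2 (by omega)⟩
  | rand n k ih => exact h.elim
  | query m k ih => exact h.elim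

theorem ReturnsIn.noFail {c : Comp α} {a : α} {t : ℕ} (h : c.ReturnsIn a t) : c.NoFail :=
  (h.wp (s := 0)).noFail

theorem ReturnsIn.erase {c : Comp α} {a : α} {t : ℕ} (h : c.ReturnsIn a t) :
    c.erase = ret a := by
  induction c generalizing t with
  | ret b => exact congrArg ret h
  | fail => exact h.elim
  | tick n k ih => exact ih h.2
  | rand n k ih => exact h.elim
  | query m k ih => exact h.elim

theorem ReturnsIn.bind {c : Comp α} {g : α → Comp β} {a : α} {b : β} {t t' : ℕ}
    (h : c.ReturnsIn a t) (hg : (g a).ReturnsIn b t') : (c.bind g).ReturnsIn b (t + t') := by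
  induction c generalizing t with
  | ret x => obtain rfl : x = a := h; exact hg.mono (by omega)
  | fail => exact h
  | tick n k ih =>
    refine ⟨h.1.trans (by omega), ?_⟩
    have h1 := h.1
    rw [show t + t' - n = t - n + t' by omega]
    exact ih h.2
  | rand n k ih => exact h.elim
  | query m k ih => exact h.elim

/-! ### Answering the queries of a computation by another computation -/

/-- The computation `c` in which each query is answered by the stateful computation `H`. -/
def interp (H : S → Val → Comp (Val × S)) : Comp α → S → Comp (α × S)
  | ret a, s => ret (a, s)
  | fail, _ => fail
  | tick n k, s => tick n (interp H k s)
  | rand n k, s => rand n fun i => interp H (k i) s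
  | query m k, s => (H s m).bind fun r => interp H (k r.1) r.2

theorem interp_bind (H : S → Val → Comp (Val × S)) (c : Comp α) (g : α → Comp β) (s : S) :
    interp H (c.bind g) s = (interp H c s).bind fun r => interp H (g r.1) r.2 := by
  induction c generalizing s with
  | ret a => rfl
  | fail => rfl
  | tick n k ih => simp [interp, ih]
  | rand n k ih => simp [interp, ih]
  | query m k ih => simp [interp, ih, bind_assoc]

/-- Running a computation whose queries are answered by `H` amounts to running it with a combined
oracle whose state includes the state of `H`. -/
theorem run_interp (O : τ → Val → PMF (Val × τ)) (H : S → Val → Comp (Val × S))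
    (O' : S × τ → Val → PMF (Val × (S × τ)))
    (hO : ∀ s t m, (H s m).run O t = (O' (s, t) m).map fun r => (some (r.1, r.2.1), r.2.2))
    (c : Comp α) (s : S) (t : τ) :
    (interp H c s).run O t =
      (c.run O' (s, t)).map fun r => (r.1.map fun a => (a, r.2.1), r.2.2) := by
  induction c generalizing s t with
  | ret a => simp [interp, run, PMF.pure_map]
  | fail => simp [interp, run, PMF.pure_map]
  | tick n k ih => simp [interp, run, ih]
  | rand n k ih => simp [interp, run, ih, PMF.map_bind]
  | query m k ih =>
    simp only [interp, run_bind, run, PMF.map_bind, hO, PMF.bind_map]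
    congr 1
    funext r
    simp [ih]

end Comp

/-! ### The role of the fuel -/

namespace Code

theorem whileLoop_le {test body test' body' : Val → Comp Val} (ht : ∀ v, (test v).Le (test' v))
    (hb : ∀ v, (body v).Le (body' v)) {n n' : ℕ} (h : n ≤ n') (v : Val) :
    (Comp.whileLoop test body n v).Le (Comp.whileLoop test' body' n' v) := by
  induction n generalizing n' v with
  | zero => trivial
  | succ n ih =>
    obtain ⟨n', rfl⟩ : ∃ k, n' = k + 1 := ⟨n' - 1, by omega⟩
    refine ⟨_, rfl, (ht v).bind fun b => ?_⟩
    split_ifs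
    · rfl
    · exact (hb v).bind fun w => ih (by omega) w

theorem eval_le (c : Code) {n n' : ℕ} (h : n ≤ n') (v : Val) :
    (c.eval n v).Le (c.eval n' v) := by
  induction c generalizing v with
  | pair f g ihf ihg =>
    exact ⟨_, rfl, (ihf v).bind fun a => (ihg v).bind fun b => Comp.Le.refl _⟩
  | seq f g ihf ihg => exact ⟨_, rfl, (ihf v).bind fun a => ihg a⟩
  | cond c f g ihc ihf ihg =>
    refine ⟨_, rfl, (ihc v).bind fun b => ?_⟩
    split_ifs
    · exact ihg v
    · exact ihf v
  | loop c f ihc ihf => exact whileLoop_le ihc ihf h v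
  | _ => exact Comp.Le.refl _

/-- More fuel does not change a computation that is not cut off. -/
theorem eval_eq_of_noFail {c : Code} {n n' : ℕ} (h : n ≤ n') {v : Val}
    (hc : (c.eval n v).NoFail) : c.eval n' v = c.eval n v :=
  (eval_le c h v).eq_of_noFail hc

/-- With fuel at least `t`, the program `c` returns `a` on the input `v` in time at most `t`. -/
def Runs (c : Code) (v a : Val) (t : ℕ) : Prop :=
  ∀ n, t ≤ n → (c.eval n v).ReturnsIn a t

theorem Runs.mono {c : Code} {v a : Val} {t t' : ℕ} (h : c.Runs v a t) (ht : t ≤ t') :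
    c.Runs v a t' :=
  fun n hn => (h n (ht.trans hn)).mono ht

/-- With too little fuel, a terminating program is cut off, but it does not go astray. -/
theorem Runs.le {c : Code} {v a : Val} {t : ℕ} (h : c.Runs v a t) (n : ℕ) :
    (c.eval n v).erase.Le (.ret a) := by
  have := (eval_le c (le_max_left n t) v).erase
  rwa [(h _ (le_max_right n t)).erase] at this

theorem Runs.wp {c : Code} {v a : Val} {t s n : ℕ} (h : c.Runs v a t) (hn : t ≤ n) :
    (c.eval n v).WP (t + s) fun b t' => b = a ∧ s ≤ t' :=
  (h n hn).wp

theorem runs_of_returnsIn {c : Code} {v a : Val} {t : ℕ} (h : (c.eval t v).ReturnsIn a t) :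
    c.Runs v a t := fun n hn => by
  rw [eval_eq_of_noFail hn h.noFail]
  exact h

theorem runs_id (v : Val) : Code.id.Runs v v 1 := fun _ _ => ⟨le_rfl, rfl⟩
theorem runs_const (k : ℕ) (v : Val) : (Code.const k).Runs v (.num k) 1 := fun _ _ => ⟨le_rfl, rfl⟩
theorem runs_fst (v : Val) : Code.fst.Runs v v.fst 1 := fun _ _ => ⟨le_rfl, rfl⟩
theorem runs_snd (v : Val) : Code.snd.Runs v v.snd 1 := fun _ _ => ⟨le_rfl, rfl⟩
theorem runs_isPair (v : Val) : Code.isPair.Runs v (.num v.isPair) 1 := fun _ _ => ⟨le_rfl, rfl⟩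
theorem runs_add (v : Val) : Code.add.Runs v (.num (v.fst.toNat + v.snd.toNat)) 1 :=
  fun _ _ => ⟨le_rfl, rfl⟩
theorem runs_sub (v : Val) : Code.sub.Runs v (.num (v.fst.toNat - v.snd.toNat)) 1 :=
  fun _ _ => ⟨le_rfl, rfl⟩
theorem runs_mul (v : Val) : Code.mul.Runs v (.num (v.fst.toNat * v.snd.toNat))
    (1 + Nat.size v.fst.toNat + Nat.size v.snd.toNat) := fun _ _ => ⟨le_rfl, rfl⟩
theorem runs_div (v : Val) : Code.div.Runs v (.num (v.fst.toNat / v.snd.toNat))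
    (1 + Nat.size v.fst.toNat + Nat.size v.snd.toNat) := fun _ _ => ⟨le_rfl, rfl⟩
theorem runs_mod (v : Val) : Code.mod.Runs v (.num (v.fst.toNat % v.snd.toNat))
    (1 + Nat.size v.fst.toNat + Nat.size v.snd.toNat) := fun _ _ => ⟨le_rfl, rfl⟩
theorem runs_eq (v : Val) :
    Code.eq.Runs v (.num (if v.fst.toNat = v.snd.toNat then 1 else 0)) 1 :=
  fun _ _ => ⟨le_rfl, rfl⟩
theorem runs_lt (v : Val) :
    Code.lt.Runs v (.num (if v.fst.toNat < v.snd.toNat then 1 else 0)) 1 :=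
  fun _ _ => ⟨le_rfl, rfl⟩

theorem Runs.seq {f g : Code} {v a b : Val} {t t' : ℕ} (hf : f.Runs v a t) (hg : g.Runs a b t') :
    (Code.seq f g).Runs v b (1 + t + t') := fun n hn => by
  refine ⟨by omega, ?_⟩
  rw [show 1 + t + t' - 1 = t + t' by omega]
  exact (hf n (by omega)).bind (hg n (by omega))

theorem Runs.pair {f g : Code} {v a b : Val} {t t' : ℕ} (hf : f.Runs v a t) (hg : g.Runs v b t') :
    (Code.pair f g).Runs v (.pair a b) (1 + t + t') := fun n hn => by
  refine ⟨by omega, ?_⟩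
  rw [show 1 + t + t' - 1 = t + (t' + 0) by omega]
  exact (hf n (by omega)).bind ((hg n (by omega)).bind rfl)

theorem Runs.cond_true {c f g : Code} {v b a : Val} {t t' : ℕ} (hc : c.Runs v b t)
    (hb : b.toNat ≠ 0) (hf : f.Runs v a t') : (Code.cond c f g).Runs v a (1 + t + t') :=
  fun n hn => by
  refine ⟨by omega, ?_⟩
  rw [show 1 + t + t' - 1 = t + t' by omega]
  refine (hc n (by omega)).bind ?_
  rw [if_neg hb]
  exact hf n (by omega)

theorem Runs.cond_false {c f g : Code} {v b a : Val} {t t' : ℕ} (hc : c.Runs v b t)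
    (hb : b.toNat = 0) (hg : g.Runs v a t') : (Code.cond c f g).Runs v a (1 + t + t') :=
  fun n hn => by
  refine ⟨by omega, ?_⟩
  rw [show 1 + t + t' - 1 = t + t' by omega]
  refine (hc n (by omega)).bind ?_
  rw [if_pos hb]
  exact hg n (by omega)

/-- A loop that passes through the values `w 0, …, w k`, with at most `t` time units for each test
and each round. -/
theorem Runs.loop {c f : Code} {w : ℕ → Val} {k t : ℕ}
    (hc : ∀ i ≤ k, ∃ b, c.Runs (w i) b t ∧ (b.toNat = 0 ↔ i = k))
    (hf : ∀ i < k, f.Runs (w i) (w (i + 1)) t) :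
    (Code.loop c f).Runs (w 0) (w k) ((k + 1) * (1 + 2 * t)) := by
  intro n hn
  have key : ∀ (j i fuel : ℕ), i + j = k → j + 1 ≤ fuel →
      (Comp.whileLoop (c.eval n) (f.eval n) fuel (w i)).ReturnsIn (w k)
        ((j + 1) * (1 + 2 * t)) := by
    have htn : t ≤ n := by nlinarith
    intro j
    induction j with
    | zero =>
      intro i fuel hi hfuel
      obtain ⟨fuel, rfl⟩ : ∃ l, fuel = l + 1 := ⟨fuel - 1, by omega⟩
      obtain rfl : i = k := by omega
      obtain ⟨b, hb, hb'⟩ := hc i le_rfl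
      refine ⟨by omega, ?_⟩
      refine Comp.ReturnsIn.mono ((hb n htn).bind (t' := 0) ?_) (by omega)
      rw [if_pos (hb'.2 rfl)]
      rfl
    | succ j ih =>
      intro i fuel hi hfuel
      obtain ⟨fuel, rfl⟩ : ∃ l, fuel = l + 1 := ⟨fuel - 1, by omega⟩
      obtain ⟨b, hb, hb'⟩ := hc i (by omega)
      refine ⟨by nlinarith, ?_⟩
      refine Comp.ReturnsIn.mono
        ((hb n htn).bind (t' := t + (j + 1) * (1 + 2 * t)) ?_) ?_
      · rw [if_neg (fun h => by have := hb'.1 h; omega)]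
        exact ((hf i (by omega)) n htn).bind (ih (i + 1) fuel (by omega) (by omega))
      · have : (j + 1 + 1) * (1 + 2 * t) = (j + 1) * (1 + 2 * t) + (1 + 2 * t) := by ring
        omega
  exact key k 0 n (by omega) (by nlinarith)

end Code

/-! ### Polynomial bounds -/

theorem polynomial_eval_mono (p : Polynomial ℕ) {a b : ℕ} (h : a ≤ b) : p.eval a ≤ p.eval b := by
  rw [Polynomial.eval_eq_sum, Polynomial.eval_eq_sum]
  exact Finset.sum_le_sum fun i _ => Nat.mul_le_mul_left _ (Nat.pow_le_pow_left h i)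

/-- The quantity `F` is at most polynomial in the quantity `m`. -/
def PolyIn {α : Type} (m F : α → ℕ) : Prop :=
  ∃ p : Polynomial ℕ, ∀ a, F a ≤ p.eval (m a)

namespace PolyIn

variable {α β : Type} {m F G : α → ℕ}

theorem of_le (hG : PolyIn m G) (h : ∀ a, F a ≤ G a) : PolyIn m F :=
  let ⟨p, hp⟩ := hG
  ⟨p, fun a => (h a).trans (hp a)⟩

theorem self : PolyIn m m := ⟨Polynomial.X, fun a => by simp⟩

theorem const (n : ℕ) : PolyIn m fun _ => n := ⟨Polynomial.C n, fun a => by simp⟩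

theorem add (hF : PolyIn m F) (hG : PolyIn m G) : PolyIn m fun a => F a + G a :=
  let ⟨p, hp⟩ := hF
  let ⟨r, hr⟩ := hG
  ⟨p + r, fun a => by simpa using Nat.add_le_add (hp a) (hr a)⟩

theorem mul (hF : PolyIn m F) (hG : PolyIn m G) : PolyIn m fun a => F a * G a :=
  let ⟨p, hp⟩ := hF
  let ⟨r, hr⟩ := hG
  ⟨p * r, fun a => by simpa using Nat.mul_le_mul (hp a) (hr a)⟩

theorem eval (p : Polynomial ℕ) (hF : PolyIn m F) : PolyIn m fun a => p.eval (F a) :=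
  let ⟨r, hr⟩ := hF
  ⟨p.comp r, fun a => by
    simpa [Polynomial.eval_comp] using polynomial_eval_mono p (hr a)⟩

theorem comp {m' : β → ℕ} {H : β → ℕ} (hH : PolyIn m' H) {g : α → β}
    (hg : PolyIn m fun a => m' (g a)) : PolyIn m fun a => H (g a) :=
  let ⟨p, hp⟩ := hH
  (hg.eval p).of_le fun a => hp (g a)

end PolyIn

/-! ### Functions computable in polynomial time -/

/-- Representation of data by trees. -/
class Rep (α : Type) where
  rep : α → Val

open DyNoFE.Rep

instance : Rep Val := ⟨id⟩
instance : Rep ℕ := ⟨Val.num⟩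
instance : Rep Bool := ⟨fun b => .num b.toNat⟩
instance {α β : Type} [Rep α] [Rep β] : Rep (α × β) := ⟨fun a => .pair (rep a.1) (rep a.2)⟩
instance {α : Type} [Rep α] : Rep (List α) := ⟨fun l => .ofList (l.map rep)⟩

@[simp] theorem Val.fst_pair (a b : Val) : (Val.pair a b).fst = a := rfl
@[simp] theorem Val.snd_pair (a b : Val) : (Val.pair a b).snd = b := rfl
@[simp] theorem Val.toNat_num (n : ℕ) : (Val.num n).toNat = n := rfl

@[simp] theorem rep_val (v : Val) : rep v = v := rfl
theorem rep_nat (n : ℕ) : rep n = .num n := rfl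
theorem rep_bool (b : Bool) : rep b = .num b.toNat := rfl
theorem rep_decide (p : Prop) [Decidable p] : rep (decide p) = .num (if p then 1 else 0) := by
  by_cases h : p <;> simp [rep_bool, h]
@[simp] theorem rep_prod {α β : Type} [Rep α] [Rep β] (a : α × β) :
    rep a = .pair (rep a.1) (rep a.2) := rfl
@[simp] theorem rep_nil {α : Type} [Rep α] : rep ([] : List α) = .num 0 := rfl
@[simp] theorem rep_cons {α : Type} [Rep α] (a : α) (l : List α) :
    rep (a :: l) = .pair (rep a) (rep l) := rfl

/-- The size of the tree that represents `a`. -/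
def sz {α : Type} [Rep α] (a : α) : ℕ := (rep a).size

theorem sz_nat (n : ℕ) : sz n = 1 + Nat.size n := rfl

theorem sz_bool_le (b : Bool) : sz b ≤ 2 := by cases b <;> decide

@[simp] theorem sz_prod {α β : Type} [Rep α] [Rep β] (a : α × β) :
    sz a = 1 + sz a.1 + sz a.2 := rfl

@[simp] theorem sz_nil {α : Type} [Rep α] : sz ([] : List α) = 1 := by
  simp [sz, Val.size]

@[simp] theorem sz_cons {α : Type} [Rep α] (a : α) (l : List α) :
    sz (a :: l) = 1 + sz a + sz l := rfl

theorem one_le_sz {α : Type} [Rep α] (a : α) : 1 ≤ sz a := by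
  unfold sz
  cases rep a <;> simp only [Val.size] <;> omega

theorem sz_append {α : Type} [Rep α] (l l' : List α) : sz (l ++ l') + 1 = sz l + sz l' := by
  induction l with
  | nil => simp; omega
  | cons a l ih => simp only [List.cons_append, sz_cons]; omega

theorem sz_reverse {α : Type} [Rep α] (l : List α) : sz l.reverse = sz l := by
  induction l with
  | nil => rfl
  | cons a l ih =>
    have := sz_append l.reverse [a]
    simp only [List.reverse_cons, sz_cons, sz_nil] at *
    omega

theorem length_le_sz {α : Type} [Rep α] (l : List α) : l.length ≤ sz l := by
  induction l with
  | nil => simp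
  | cons a l ih => simp; omega

theorem sz_le_of_mem {α : Type} [Rep α] {l : List α} {a : α} (h : a ∈ l) : sz a ≤ sz l := by
  induction l with
  | nil => simp at h
  | cons b l ih =>
    rcases List.mem_cons.1 h with rfl | h
    · simp; omega
    · have := ih h; simp; omega

theorem sz_le_of_forall {α : Type} [Rep α] {l : List α} {B : ℕ} (h : ∀ a ∈ l, sz a ≤ B) :
    sz l ≤ 1 + l.length * (1 + B) := by
  induction l with
  | nil => simp
  | cons b l ih =>
    have h1 := ih fun a ha => h a (List.mem_cons_of_mem _ ha)
    have h2 := h b List.mem_cons_self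
    simp only [sz_cons, List.length_cons]
    nlinarith

theorem size_add_le (a b : ℕ) : Nat.size (a + b) ≤ 1 + Nat.size a + Nat.size b := by
  rw [Nat.size_le]
  have h1 := Nat.lt_size_self a
  have h2 := Nat.lt_size_self b
  have h3 : 1 ≤ 2 ^ Nat.size a := Nat.one_le_two_pow
  have h4 : 1 ≤ 2 ^ Nat.size b := Nat.one_le_two_pow
  rw [pow_add, pow_add]
  nlinarith

theorem size_mul_le (a b : ℕ) : Nat.size (a * b) ≤ Nat.size a + Nat.size b := by
  rw [Nat.size_le, pow_add]
  exact Nat.mul_lt_mul'' (Nat.lt_size_self a) (Nat.lt_size_self b)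

theorem size_le_self (n : ℕ) : Nat.size n ≤ n := by
  rw [Nat.size_le]
  exact Nat.lt_two_pow_self

/-- The function `f` is computed by a deterministic program; time and size of the result are at
most polynomial in the size of the argument. -/
def Poly {α β : Type} [Rep α] [Rep β] (f : α → β) : Prop :=
  ∃ (c : Code) (T : α → ℕ), PolyIn sz T ∧
    ∀ a, sz (f a) ≤ T a ∧ c.Runs (rep a) (rep (f a)) (T a)

/-- The program that returns the value `v`. -/
def Code.ofVal : Val → Code
  | .num n => .const n
  | .pair a b => .pair (ofVal a) (ofVal b)

theorem Code.runs_ofVal (v w : Val) : (Code.ofVal v).Runs w v (2 * v.size) := by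
  induction v with
  | num n => exact (Code.runs_const n w).mono (by simp only [Val.size]; omega)
  | pair a b iha ihb => exact (iha.pair ihb).mono (by simp only [Val.size]; omega)

namespace Poly

variable {α β γ δ : Type} [Rep α] [Rep β] [Rep γ] [Rep δ]

theorem id : Poly fun a : α => a :=
  ⟨.id, fun a => 1 + sz a, (PolyIn.const 1).add .self, fun _ =>
    ⟨Nat.le_add_left _ _, (Code.runs_id _).mono (Nat.le_add_right _ _)⟩⟩

theorem const (b : β) : Poly fun _ : α => b :=
  ⟨.ofVal (rep b), fun _ => 2 * sz b, .const _, fun _ =>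
    ⟨Nat.le_mul_of_pos_left _ two_pos, Code.runs_ofVal _ _⟩⟩

theorem comp {g : β → γ} {f : α → β} (hg : Poly g) (hf : Poly f) : Poly fun a => g (f a) := by
  obtain ⟨c, T, hT, h⟩ := hf
  obtain ⟨c', T', hT', h'⟩ := hg
  refine ⟨.seq c c', fun a => 1 + T a + T' (f a),
    ((PolyIn.const 1).add hT).add (hT'.comp (hT.of_le fun a => (h a).1)), fun a => ⟨?_, ?_⟩⟩
  · exact (h' (f a)).1.trans (Nat.le_add_left _ _)
  · exact (h a).2.seq (h' (f a)).2

theorem polyIn {f : α → β} (hf : Poly f) : PolyIn sz fun a => sz (f a) :=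
  let ⟨_, _, hT, h⟩ := hf
  hT.of_le fun a => (h a).1

/-- A change of type that leaves the representation alone. -/
theorem of_rep_eq {f : α → β} {g : α → γ} (hf : Poly f) (h : ∀ a, rep (g a) = rep (f a)) :
    Poly g := by
  obtain ⟨c, T, hT, h'⟩ := hf
  refine ⟨c, T, hT, fun a => ?_⟩
  rw [sz, h]
  exact h' a

theorem of_eq {f g : α → β} (hf : Poly f) (h : ∀ a, g a = f a) : Poly g := by
  rwa [show g = f from funext h]

theorem mk {f : α → β} {g : α → γ} (hf : Poly f) (hg : Poly g) : Poly fun a => (f a, g a) := by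
  obtain ⟨c, T, hT, h⟩ := hf
  obtain ⟨c', T', hT', h'⟩ := hg
  refine ⟨.pair c c', fun a => 1 + T a + T' a, ((PolyIn.const 1).add hT).add hT',
    fun a => ⟨?_, (h a).2.pair (h' a).2⟩⟩
  have := (h a).1
  have := (h' a).1
  simp only [sz_prod]
  omega

/-- Operations that take one step. -/
theorem of_runs {f : β → γ} (c : Code) {T : β → ℕ} (hT : PolyIn sz T)
    (h : ∀ b, sz (f b) ≤ T b ∧ c.Runs (rep b) (rep (f b)) (T b)) : Poly f := ⟨c, T, hT, h⟩

theorem fst {f : α → β × γ} (hf : Poly f) : Poly fun a => (f a).1 :=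
  comp (g := fun b : β × γ => b.1) (of_runs .fst (T := fun b => 1 + sz b)
    ((PolyIn.const 1).add .self) fun b => ⟨by simp only [sz_prod]; omega,
      (Code.runs_fst _).mono (by omega)⟩) hf

theorem snd {f : α → β × γ} (hf : Poly f) : Poly fun a => (f a).2 :=
  comp (g := fun b : β × γ => b.2) (of_runs .snd (T := fun b => 1 + sz b)
    ((PolyIn.const 1).add .self) fun b => ⟨by simp only [sz_prod]; omega,
      (Code.runs_snd _).mono (by omega)⟩) hf

theorem ite {p : α → Prop} [DecidablePred p] {f g : α → β} (hp : Poly fun a => decide (p a))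
    (hf : Poly f) (hg : Poly g) : Poly fun a => if p a then f a else g a := by
  obtain ⟨c, T, hT, h⟩ := hf
  obtain ⟨c', T', hT', h'⟩ := hg
  obtain ⟨c₀, T₀, hT₀, h₀⟩ := hp
  refine ⟨.cond c₀ c c', fun a => 1 + T₀ a + (T a + T' a),
    ((PolyIn.const 1).add hT₀).add (hT.add hT'), fun a => ⟨?_, ?_⟩⟩
  · have := (h a).1
    have := (h' a).1
    dsimp only
    split_ifs <;> omega
  · dsimp only at h₀ ⊢
    by_cases hpa : p a
    · rw [if_pos hpa]
      exact ((h₀ a).2.cond_true (by simp [rep_bool, Val.toNat, hpa]) (h a).2).mono (by omega)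
    · rw [if_neg hpa]
      exact ((h₀ a).2.cond_false (by simp [rep_bool, Val.toNat, hpa]) (h' a).2).mono (by omega)

theorem iteBool {c : α → Bool} {f g : α → β} (hc : Poly c) (hf : Poly f) (hg : Poly g) :
    Poly fun a => if c a = true then f a else g a :=
  ite (p := fun a => c a = true) (hc.of_eq fun a => by simp) hf hg

theorem add {f g : α → ℕ} (hf : Poly f) (hg : Poly g) : Poly fun a => f a + g a :=
  comp (g := fun b : ℕ × ℕ => b.1 + b.2) (of_runs .add (T := fun b => 1 + sz b)
    ((PolyIn.const 1).add .self) fun b => ⟨by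
      have := size_add_le b.1 b.2
      simp only [sz_prod, sz_nat]; omega, (Code.runs_add _).mono (by omega)⟩) (hf.mk hg)

theorem sub {f g : α → ℕ} (hf : Poly f) (hg : Poly g) : Poly fun a => f a - g a :=
  comp (g := fun b : ℕ × ℕ => b.1 - b.2) (of_runs .sub (T := fun b => 1 + sz b)
    ((PolyIn.const 1).add .self) fun b => ⟨by
      have := Nat.size_le_size (Nat.sub_le b.1 b.2)
      simp only [sz_prod, sz_nat]; omega, (Code.runs_sub _).mono (by omega)⟩) (hf.mk hg)

theorem mul {f g : α → ℕ} (hf : Poly f) (hg : Poly g) : Poly fun a => f a * g a :=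
  comp (g := fun b : ℕ × ℕ => b.1 * b.2) (of_runs .mul (T := fun b => 1 + sz b)
    ((PolyIn.const 1).add .self) fun b => ⟨by
      have := size_mul_le b.1 b.2
      simp only [sz_prod, sz_nat]; omega,
      (Code.runs_mul _).mono (by
        simp only [sz_prod, sz_nat, rep_prod, rep_nat, Val.fst, Val.snd, Val.toNat]
        omega)⟩) (hf.mk hg)

theorem div {f g : α → ℕ} (hf : Poly f) (hg : Poly g) : Poly fun a => f a / g a :=
  comp (g := fun b : ℕ × ℕ => b.1 / b.2) (of_runs .div (T := fun b => 1 + sz b)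
    ((PolyIn.const 1).add .self) fun b => ⟨by
      have := Nat.size_le_size (Nat.div_le_self b.1 b.2)
      simp only [sz_prod, sz_nat]; omega,
      (Code.runs_div _).mono (by
        simp only [sz_prod, sz_nat, rep_prod, rep_nat, Val.fst, Val.snd, Val.toNat]
        omega)⟩) (hf.mk hg)

theorem mod {f g : α → ℕ} (hf : Poly f) (hg : Poly g) : Poly fun a => f a % g a :=
  comp (g := fun b : ℕ × ℕ => b.1 % b.2) (of_runs .mod (T := fun b => 1 + sz b)
    ((PolyIn.const 1).add .self) fun b => ⟨by
      have := Nat.size_le_size (Nat.mod_le b.1 b.2)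
      simp only [sz_prod, sz_nat]; omega,
      (Code.runs_mod _).mono (by
        simp only [sz_prod, sz_nat, rep_prod, rep_nat, Val.fst, Val.snd, Val.toNat]
        omega)⟩) (hf.mk hg)

theorem natEq {f g : α → ℕ} (hf : Poly f) (hg : Poly g) : Poly fun a => decide (f a = g a) :=
  comp (g := fun b : ℕ × ℕ => decide (b.1 = b.2)) (of_runs .eq (T := fun b => 2) (.const 2)
    fun b => ⟨sz_bool_le _, by
      rw [rep_decide]
      exact (Code.runs_eq _).mono (by omega)⟩) (hf.mk hg)

theorem natLt {f g : α → ℕ} (hf : Poly f) (hg : Poly g) : Poly fun a => decide (f a < g a) :=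
  comp (g := fun b : ℕ × ℕ => decide (b.1 < b.2)) (of_runs .lt (T := fun b => 2) (.const 2)
    fun b => ⟨sz_bool_le _, by
      rw [rep_decide]
      exact (Code.runs_lt _).mono (by omega)⟩) (hf.mk hg)

theorem and {f g : α → Bool} (hf : Poly f) (hg : Poly g) : Poly fun a => f a && g a :=
  (ite (p := fun a => f a = true) (hf.of_eq fun a => by simp) hg (const false)).of_eq
    fun a => by cases f a <;> simp

theorem or {f g : α → Bool} (hf : Poly f) (hg : Poly g) : Poly fun a => f a || g a :=
  (ite (p := fun a => f a = true) (hf.of_eq fun a => by simp) (const true) hg).of_eq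
    fun a => by cases f a <;> simp

theorem not {f : α → Bool} (hf : Poly f) : Poly fun a => !f a :=
  (ite (p := fun a => f a = true) (hf.of_eq fun a => by simp) (const false) (const true)).of_eq
    fun a => by cases f a <;> simp

theorem valFst {f : α → Val} (hf : Poly f) : Poly fun a => (f a).fst :=
  comp (g := Val.fst) (of_runs .fst (T := fun b => 1 + sz b)
    ((PolyIn.const 1).add .self) fun b => ⟨by
      cases b <;> simp only [Val.fst, sz, rep_val, Val.size, Nat.size_zero] <;> omega,
      (Code.runs_fst _).mono (by omega)⟩) hf

theorem valSnd {f : α → Val} (hf : Poly f) : Poly fun a => (f a).snd :=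
  comp (g := Val.snd) (of_runs .snd (T := fun b => 1 + sz b)
    ((PolyIn.const 1).add .self) fun b => ⟨by
      cases b <;> simp only [Val.snd, sz, rep_val, Val.size, Nat.size_zero] <;> omega,
      (Code.runs_snd _).mono (by omega)⟩) hf

theorem toNat {f : α → Val} (hf : Poly f) : Poly fun a => (f a).toNat :=
  comp (g := Val.toNat) (of_runs (.seq (.pair .id (.const 0)) .add) (T := fun b => 5 + sz b)
    ((PolyIn.const 5).add .self) fun b => ⟨by
      cases b <;> simp only [Val.toNat, sz, rep_val, rep_nat, Val.size, Nat.size_zero] <;> omega,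
      (((Code.runs_id b).pair (Code.runs_const 0 b)).seq (Code.runs_add _)).mono (by omega)⟩) hf

theorem valPair {f g : α → Val} (hf : Poly f) (hg : Poly g) : Poly fun a => Val.pair (f a) (g a) :=
  (hf.mk hg).of_rep_eq fun _ => rfl

theorem valNum {f : α → ℕ} (hf : Poly f) : Poly fun a => Val.num (f a) :=
  hf.of_rep_eq fun _ => rfl

theorem ofList {f : α → List Val} (hf : Poly f) : Poly fun a => Val.ofList (f a) :=
  hf.of_rep_eq fun a => by
    change _ = Val.ofList ((f a).map fun v => v)
    simp

theorem cons {f : α → β} {g : α → List β} (hf : Poly f) (hg : Poly g) :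
    Poly fun a => f a :: g a :=
  (hf.mk hg).of_rep_eq fun _ => rfl

/-! ### Loops over lists -/

/-- Iteration over a list, provided that the intermediate results are of polynomial size. -/
theorem foldl {f : α → List β} {init : α → γ} {step : α → γ → β → γ} (hf : Poly f)
    (hi : Poly init) (hs : Poly fun x : α × γ × β => step x.1 x.2.1 x.2.2)
    (hB : ∃ B : α → ℕ, PolyIn sz B ∧
      ∀ a l, l <+: f a → sz (l.foldl (step a) (init a)) ≤ B a) :
    Poly fun a => (f a).foldl (step a) (init a) := by
  obtain ⟨cf, Tf, hTf, hf'⟩ := hf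
  obtain ⟨ci, Ti, hTi, hi'⟩ := hi
  obtain ⟨cs, Ts, ⟨ps, hps⟩, hs'⟩ := hs
  obtain ⟨B, hB, hBB⟩ := hB
  let S : α → ℕ := fun a => ps.eval (2 + sz a + B a + Tf a)
  have hS : PolyIn sz S := ((((PolyIn.const 2).add .self).add hB).add hTf).eval ps
  refine ⟨.seq (.pair (.pair .id ci) cf) (.seq
    (.loop (.seq .snd .isPair) (.pair (.pair (.seq .fst .fst)
      (.seq (.pair (.seq .fst .fst) (.pair (.seq .fst .snd) (.seq .snd .fst))) cs))
        (.seq .snd .snd))) (.seq .fst .snd)),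
    fun a => 8 + Ti a + Tf a + B a + (Tf a + 1) * (1 + 2 * (30 + S a)), ?_, fun a => ⟨?_, ?_⟩⟩
  · exact ((((PolyIn.const 8).add hTi).add hTf).add hB).add
      ((hTf.add (.const 1)).mul ((PolyIn.const 1).add ((PolyIn.const 2).mul
        ((PolyIn.const 30).add hS))))
  · have := hBB a _ (List.prefix_refl _)
    nlinarith
  · set l := f a with hl
    let w : ℕ → Val := fun i => .pair (.pair (rep a) (rep ((l.take i).foldl (step a) (init a))))
      (rep (l.drop i))
    have hlen : l.length ≤ Tf a := (length_le_sz l).trans (hf' a).1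
    have h1 : (Code.pair (.pair .id ci) cf).Runs (rep a) (w 0) (1 + (1 + 1 + Ti a) + Tf a) := by
      simpa [w] using ((Code.runs_id _).pair (hi' a).2).pair (hf' a).2
    have h2 := Code.Runs.loop (c := .seq .snd .isPair) (f := .pair (.pair (.seq .fst .fst)
      (.seq (.pair (.seq .fst .fst) (.pair (.seq .fst .snd) (.seq .snd .fst))) cs))
        (.seq .snd .snd)) (w := w) (k := l.length) (t := 30 + S a) (fun i hi => by
          refine ⟨_, ((Code.runs_snd _).seq (Code.runs_isPair _)).mono (by omega), ?_⟩
          rcases hi.lt_or_eq with h | h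
          · have : l.drop i = l[i] :: l.drop (i + 1) := List.drop_eq_getElem_cons h
            simp only [w, Val.snd, this, rep_cons, Val.isPair, Val.toNat]
            omega
          · simp [w, h, Val.snd, Val.isPair, Val.toNat]) (fun i hi => by
          have hd : l.drop i = l[i] :: l.drop (i + 1) := List.drop_eq_getElem_cons hi
          have ht : l.take (i + 1) = l.take i ++ [l[i]] := by simp
          have hw : w i = .pair (.pair (rep a) (rep ((l.take i).foldl (step a) (init a))))
            (.pair (rep l[i]) (rep (l.drop (i + 1)))) := by simp only [w, hd, rep_cons]
          have hw' : w (i + 1) = .pair (.pair (rep a)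
              (rep (step a ((l.take i).foldl (step a) (init a)) l[i])))
              (rep (l.drop (i + 1))) := by
            simp only [w, ht, List.foldl_append, List.foldl_cons, List.foldl_nil]
          rw [hw, hw']
          have hstep := (hs' (a, (l.take i).foldl (step a) (init a), l[i])).2
          have hT : Ts (a, (l.take i).foldl (step a) (init a), l[i]) ≤ S a := by
            refine (hps _).trans (polynomial_eval_mono ps ?_)
            have h1 := hBB a _ (List.take_prefix i l)
            have h2 := (sz_le_of_mem (List.getElem_mem hi)).trans (hf' a).1
            simp only [sz_prod]
            omega
          refine ((((Code.runs_fst _).seq (Code.runs_fst _)).pair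
            ((((Code.runs_fst _).seq (Code.runs_fst _)).pair
              (((Code.runs_fst _).seq (Code.runs_snd _)).pair
                ((Code.runs_snd _).seq (Code.runs_fst _)))).seq hstep)).pair
                  ((Code.runs_snd _).seq (Code.runs_snd _))).mono (by omega))
    have h3 : (Code.seq .fst .snd).Runs (w l.length) (rep (l.foldl (step a) (init a)))
        (1 + 1 + 1) := by
      simpa [w, Val.fst, Val.snd] using
        (Code.runs_fst (w l.length)).seq (Code.runs_snd (w l.length).fst)
    refine (h1.seq (h2.seq h3)).mono ?_
    have : (l.length + 1) * (1 + 2 * (30 + S a)) ≤ (Tf a + 1) * (1 + 2 * (30 + S a)) :=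
      Nat.mul_le_mul_right _ (by omega)
    dsimp only
    omega

theorem reverse {f : α → List β} (hf : Poly f) : Poly fun a => (f a).reverse := by
  have h : Poly fun a => (f a).foldl (fun g b => b :: g) [] :=
    foldl hf (const []) (cons (snd (snd id)) (fst (snd id)))
      ⟨fun a => sz (f a), hf.polyIn, fun a l ⟨l', hl'⟩ => by
        have := sz_append l l'
        have := one_le_sz l'
        simp only [List.foldl_flip_cons_eq_append, ← hl', List.append_nil, List.map_id', sz_reverse]
        omega⟩
  exact h.of_eq fun a => by simp

theorem map {f : α → List β} {g : α → β → γ} (hf : Poly f) (hg : Poly fun x : α × β => g x.1 x.2) :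
    Poly fun a => (f a).map (g a) := by
  have key : ∀ a (l : List β) (acc : List γ),
      l.foldl (fun r b => g a b :: r) acc = (l.map (g a)).reverse ++ acc := by
    intro a l
    induction l with
    | nil => simp
    | cons b l ih => simp [ih]
  have h : Poly fun a => (f a).foldl (fun r b => g a b :: r) [] := by
    refine foldl hf (const []) (cons (hg.comp ((fst id).mk (snd (snd id)))) (fst (snd id))) ?_
    obtain ⟨p, hp⟩ := hg.polyIn
    refine ⟨fun a => 1 + sz (f a) * (1 + p.eval (1 + sz a + sz (f a))),
      (PolyIn.const 1).add (hf.polyIn.mul ((PolyIn.const 1).add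
        ((((PolyIn.const 1).add .self).add hf.polyIn).eval p))), fun a l hl => ?_⟩
    rw [key, List.append_nil, sz_reverse]
    refine (sz_le_of_forall (B := p.eval (1 + sz a + sz (f a))) ?_).trans ?_
    · intro c hc
      obtain ⟨b, hb, rfl⟩ := List.mem_map.1 hc
      refine (hp (a, b)).trans (polynomial_eval_mono p ?_)
      have := sz_le_of_mem (hl.subset hb)
      simp only [sz_prod]
      omega
    · rw [List.length_map]
      exact Nat.add_le_add_left (Nat.mul_le_mul_right _
        (hl.length_le.trans (length_le_sz _))) _
  exact h.reverse.of_eq fun a => by simp [key]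

theorem any {f : α → List β} {g : α → β → Bool} (hf : Poly f)
    (hg : Poly fun x : α × β => g x.1 x.2) : Poly fun a => (f a).any (g a) := by
  have h : Poly fun a => (f a).foldl (fun r b => r || g a b) false :=
    foldl hf (const false) ((fst (snd id)).or (hg.comp ((fst id).mk (snd (snd id)))))
      ⟨fun _ => 2, .const 2, fun a l _ => sz_bool_le _⟩
  refine h.of_eq fun a => ?_
  have key : ∀ (l : List β) (r : Bool), l.foldl (fun r b => r || g a b) r = (r || l.any (g a)) := by
    intro l
    induction l with
    | nil => simp
    | cons b l ih => intro r; simp [ih, Bool.or_assoc]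
  simp [key]

theorem all {f : α → List β} {g : α → β → Bool} (hf : Poly f)
    (hg : Poly fun x : α × β => g x.1 x.2) : Poly fun a => (f a).all (g a) :=
  (any hf (g := fun a b => !g a b) hg.not).not.of_eq fun a => by
    simp [List.all_eq_not_any_not]

theorem sum {f : α → List ℕ} (hf : Poly f) : Poly fun a => (f a).sum := by
  have key : ∀ (l : List ℕ) (r : ℕ), l.foldl (fun r b => r + b) r = r + l.sum := by
    intro l
    induction l with
    | nil => simp
    | cons b l ih => intro r; simp [ih, add_assoc]
  have hle : ∀ l : List ℕ, sz l.sum ≤ sz l := by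
    intro l
    induction l with
    | nil => simp [sz_nat]
    | cons b l ih =>
      have := size_add_le b l.sum
      simp only [List.sum_cons, sz_cons, sz_nat] at *
      omega
  have h : Poly fun a => (f a).foldl (fun r b => r + b) 0 :=
    foldl hf (const 0) ((fst (snd id)).add (snd (snd id)))
      ⟨fun a => sz (f a), hf.polyIn, fun a l ⟨l', hl'⟩ => by
        simp only [key, zero_add, ← hl']
        have := sz_append l l'
        have := one_le_sz l'
        have := hle l
        omega⟩
  exact h.of_eq fun a => by simp [key]

theorem length {f : α → List β} (hf : Poly f) : Poly fun a => (f a).length :=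
  (hf.map (g := fun _ _ => 1) (const 1)).sum.of_eq fun a => by simp

theorem getD {f : α → List β} {i : α → ℕ} {d : α → β} (hf : Poly f) (hi : Poly i) (hd : Poly d) :
    Poly fun a => (f a).getD (i a) (d a) := by
  have h : Poly fun a => (f a).foldl
      (fun (r : ℕ × β) b => (r.1 - 1, if r.1 = 1 then b else r.2)) (i a + 1, d a) := by
    refine foldl hf ((hi.add (const 1)).mk hd) (((fst (fst (snd id))).sub (const 1)).mk
      (ite ((fst (fst (snd id))).natEq (const 1)) (snd (snd id)) (snd (fst (snd id))))) ?_
    refine ⟨fun a => 1 + sz (i a + 1) + (sz (d a) + sz (f a)),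
      ((PolyIn.const 1).add (hi.add (const 1)).polyIn).add (hd.polyIn.add hf.polyIn),
      fun a l hl => ?_⟩
    have key : ∀ (l : List β) (r : ℕ × β), (∀ b ∈ l, sz b ≤ sz (f a)) →
        let r' := l.foldl (fun (r : ℕ × β) b => (r.1 - 1, if r.1 = 1 then b else r.2)) r
        r'.1 ≤ r.1 ∧ sz r'.2 ≤ max (sz r.2) (sz (f a)) := by
      intro l
      induction l with
      | nil => simp
      | cons b l ih =>
        intro r hr
        have h1 := ih (r.1 - 1, if r.1 = 1 then b else r.2)
          fun c hc => hr c (List.mem_cons_of_mem _ hc)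
        have h2 := hr b List.mem_cons_self
        simp only [List.foldl_cons] at h1 ⊢
        refine ⟨h1.1.trans (by simp), h1.2.trans ?_⟩
        split_ifs
        · exact max_le (h2.trans (le_max_right _ _)) (le_max_right _ _)
        · exact le_rfl
    have := key l (i a + 1, d a) fun b hb => sz_le_of_mem (hl.subset hb)
    have h1 := Nat.size_le_size this.1
    have h2 := this.2.trans (max_le_add_of_nonneg (Nat.zero_le _) (Nat.zero_le _))
    simp only [sz_prod, sz_nat] at *
    omega
  refine h.snd.of_eq fun a => ?_
  have key0 : ∀ (l : List β) (d : β),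
      (l.foldl (fun (r : ℕ × β) b => (r.1 - 1, if r.1 = 1 then b else r.2)) (0, d)).2 = d := by
    intro l
    induction l with
    | nil => simp
    | cons b l ih => intro d; simpa using ih d
  have key : ∀ (l : List β) (i : ℕ) (d : β), l.getD i d =
      (l.foldl (fun (r : ℕ × β) b => (r.1 - 1, if r.1 = 1 then b else r.2)) (i + 1, d)).2 := by
    intro l
    induction l with
    | nil => simp
    | cons b l ih =>
      intro i d
      cases i with
      | zero => simp [key0]
      | succ i => simpa using ih i d
  exact key _ _ _

/-- Powers with an exponent given in unary. -/
theorem pow {b : α → ℕ} {f : α → List β} (hb : Poly b) (hf : Poly f) :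
    Poly fun a => b a ^ (f a).length := by
  have key : ∀ (x : ℕ) (l : List β) (r : ℕ), l.foldl (fun r _ => r * x) r = r * x ^ l.length := by
    intro x l
    induction l with
    | nil => simp
    | cons b l ih => intro r; simp only [List.foldl_cons, ih, List.length_cons]; ring
  have hle : ∀ x n : ℕ, Nat.size (x ^ n) ≤ 1 + n * Nat.size x := by
    intro x n
    induction n with
    | zero => simp
    | succ n ih =>
      have := size_mul_le (x ^ n) x
      rw [pow_succ]
      nlinarith
  have h : Poly fun a => (f a).foldl (fun r _ => r * b a) 1 :=
    foldl hf (const 1) ((fst (snd id)).mul (hb.comp (fst id)))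
      ⟨fun a => 1 + (1 + sz (f a) * sz (b a)),
        (PolyIn.const 1).add ((PolyIn.const 1).add (hf.polyIn.mul hb.polyIn)), fun a l hl => by
        rw [key, one_mul, sz_nat]
        have h1 := hle (b a) l.length
        have h2 : l.length * Nat.size (b a) ≤ sz (f a) * sz (b a) :=
          Nat.mul_le_mul (hl.length_le.trans (length_le_sz _)) (by rw [sz_nat]; omega)
        dsimp only
        omega⟩
  exact h.of_eq fun a => by simp [key]

end Poly

/-- The `k` lowest digits of `d` in base `q`, lowest digit first. -/
def digits (q d k : ℕ) : List ℕ := (List.range k).map fun t => d / q ^ t % q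

theorem Poly.digits {α β : Type} [Rep α] [Rep β] {q d : α → ℕ} {f : α → List β} (hq : Poly q)
    (hd : Poly d) (hf : Poly f) : Poly fun a => digits (q a) (d a) (f a).length := by
  have key : ∀ (x : ℕ) (l : List β) (r : ℕ × List ℕ),
      l.foldl (fun (r : ℕ × List ℕ) _ => (r.1 / x, (r.1 % x) :: r.2)) r =
        (r.1 / x ^ l.length, (DyNoFE.digits x r.1 l.length).reverse ++ r.2) := by
    intro x l
    induction l with
    | nil => simp [DyNoFE.digits]
    | cons b l ih =>
      intro r
      rw [List.foldl_cons, ih]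
      simp only [List.length_cons, DyNoFE.digits, List.range_succ_eq_map, List.map_cons,
        List.map_map, List.reverse_cons, List.append_assoc, List.singleton_append, pow_zero,
        Nat.div_one, Nat.div_div_eq_div_mul, pow_succ', Function.comp_def, Nat.succ_eq_add_one]
  have h : Poly fun a => (f a).foldl
      (fun (r : ℕ × List ℕ) _ => (r.1 / q a, (r.1 % q a) :: r.2)) (d a, []) := by
    refine Poly.foldl hf (hd.mk (.const [])) ((Poly.div (.fst (.fst (.snd .id)))
      (hq.comp (.fst .id))).mk ((Poly.mod (.fst (.fst (.snd .id))) (hq.comp (.fst .id))).cons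
        (.snd (.fst (.snd .id))))) ?_
    refine ⟨fun a => 1 + sz (d a) + (1 + sz (f a) * (1 + sz (d a))),
      ((PolyIn.const 1).add hd.polyIn).add ((PolyIn.const 1).add (hf.polyIn.mul
        ((PolyIn.const 1).add hd.polyIn))), fun a l hl => ?_⟩
    rw [key, List.append_nil, sz_prod, sz_reverse]
    refine Nat.add_le_add (Nat.add_le_add le_rfl ?_) ?_
    · have := Nat.size_le_size (Nat.div_le_self (d a) (q a ^ l.length))
      simp only [sz_nat]
      omega
    · refine (sz_le_of_forall (B := sz (d a)) ?_).trans ?_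
      · intro c hc
        obtain ⟨t, -, rfl⟩ := List.mem_map.1 hc
        have := Nat.size_le_size ((Nat.mod_le (d a / q a ^ t) (q a)).trans
          (Nat.div_le_self (d a) (q a ^ t)))
        simp only [sz_nat]
        omega
      · have : (DyNoFE.digits (q a) (d a) l.length).length ≤ sz (f a) := by
          simpa [DyNoFE.digits] using hl.length_le.trans (length_le_sz _)
        gcongr
  exact h.snd.reverse.of_eq fun a => by simp [key]

/-! ### Ranges, entries of lists, and sanitized vectors -/

/-- The program that turns `n` into the list `[0, …, n - 1]`. -/
def Code.range : Code :=
  .seq (.pair .id (.const 0)) (.seq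
    (.loop .fst (.pair (.seq (.pair .fst (.const 1)) .sub)
      (.pair (.seq (.pair .fst (.const 1)) .sub) .snd))) .snd)

theorem Code.runs_range (n : ℕ) :
    Code.range.Runs (.num n) (rep (List.range n)) (10 + (n + 1) * 41) := by
  let w : ℕ → Val := fun i => .pair (.num (n - i)) (rep (List.range' (n - i) i))
  have h1 : (Code.pair .id (.const 0)).Runs (.num n) (w 0) 3 :=
    (Code.runs_id _).pair (Code.runs_const 0 _)
  have h2 := Code.Runs.loop (c := .fst) (f := .pair (.seq (.pair .fst (.const 1)) .sub)
      (.pair (.seq (.pair .fst (.const 1)) .sub) .snd)) (w := w) (k := n) (t := 20)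
    (fun i hi => ⟨_, (Code.runs_fst _).mono (by omega), by
      simp only [w, Val.fst, Val.toNat]; omega⟩) (fun i hi => by
      have hw : w (i + 1) = .pair (.num (n - i - 1))
          (.pair (.num (n - i - 1)) (rep (List.range' (n - i) i))) := by
        simp only [w, List.range'_succ, rep_cons, rep_nat]
        rw [show n - (i + 1) = n - i - 1 by omega, show n - i - 1 + 1 = n - i by omega]
      rw [hw]
      have hd : (Code.seq (.pair .fst (.const 1)) .sub).Runs (w i) (.num (n - i - 1)) 5 :=
        ((Code.runs_fst _).pair (Code.runs_const 1 _)).seq (Code.runs_sub _)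
      exact (hd.pair (hd.pair (Code.runs_snd _))).mono (by omega))
  have h3 : Code.snd.Runs (w n) (rep (List.range n)) 1 := by
    have : rep (List.range n) = (w n).snd := by simp [w, Val.snd, List.range_eq_range']
    rw [this]
    exact Code.runs_snd _
  exact (h1.seq (h2.seq h3)).mono (by omega)

theorem sz_range_le (n : ℕ) : sz (List.range n) ≤ 1 + n * (2 + n) := by
  have := sz_le_of_forall (l := List.range n) (B := 1 + n) fun a ha => by
    rw [sz_nat]
    have := size_le_self a
    have := List.mem_range.1 ha
    omega
  rw [List.length_range] at this
  convert this using 2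
  ring

namespace Poly

variable {α β γ δ : Type} [Rep α] [Rep β] [Rep γ] [Rep δ]

theorem range {f : α → ℕ} (hf : Poly f) (hB : PolyIn sz f) : Poly fun a => List.range (f a) := by
  obtain ⟨c, T, hT, h⟩ := hf
  refine ⟨.seq c .range, fun a => 1 + T a + (10 + (f a + 1) * 41) + (1 + f a * (2 + f a)),
    (((PolyIn.const 1).add hT).add ((PolyIn.const 10).add ((hB.add (.const 1)).mul
      (.const 41)))).add ((PolyIn.const 1).add (hB.mul ((PolyIn.const 2).add hB))), fun a => ⟨?_, ?_⟩⟩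
  · exact (sz_range_le _).trans (Nat.le_add_left _ _)
  · exact ((h a).2.seq (Code.runs_range (f a))).mono (Nat.le_add_right _ _)

end Poly

theorem Val.size_fst_le (v : Val) : v.fst.size ≤ v.size := by
  cases v <;> simp only [Val.fst, Val.size, Nat.size_zero] <;> omega

theorem Val.size_snd_le (v : Val) : v.snd.size ≤ v.size := by
  cases v <;> simp only [Val.snd, Val.size, Nat.size_zero] <;> omega

theorem Val.size_iterate_snd_le (v : Val) (i : ℕ) : (Val.snd^[i] v).size ≤ v.size := by
  induction i with
  | zero => rfl
  | succ i ih =>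
    rw [Function.iterate_succ_apply']
    exact (Val.size_snd_le _).trans ih

theorem Val.nth_eq_iterate (v : Val) (i : ℕ) : v.nth i = (Val.snd^[i] v).fst := by
  induction i generalizing v with
  | zero => rfl
  | succ i ih => rw [Function.iterate_succ_apply]; exact ih v.snd

/-- The number of entries of a list, whatever its terminator is. -/
def Val.depth : Val → ℕ
  | .num _ => 0
  | .pair _ b => b.depth + 1

theorem Val.depth_le_size (v : Val) : v.depth ≤ v.size := by
  induction v with
  | num n => simp [Val.depth]
  | pair a b _ ih => simp only [Val.depth, Val.size]; omega

theorem Val.isPair_iterate_snd (v : Val) (i : ℕ) :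
    (Val.snd^[i] v).isPair = if i < v.depth then 1 else 0 := by
  induction i generalizing v with
  | zero => cases v <;> simp [Val.isPair, Val.depth]
  | succ i ih =>
    rw [Function.iterate_succ_apply, ih]
    cases v with
    | num n => simp [Val.snd, Val.depth]
    | pair a b =>
      simp only [Val.snd, Val.depth]
      exact if_congr (by omega) rfl rfl

theorem Val.nth_of_depth_le {v : Val} {i : ℕ} (h : v.depth ≤ i) : v.nth i = .num 0 := by
  induction i generalizing v with
  | zero =>
    cases v with
    | num n => rfl
    | pair a b => simp [Val.depth] at h
  | succ i ih =>
    refine ih (v := v.snd) ?_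
    cases v with
    | num n => simp [Val.snd, Val.depth]
    | pair a b => simp only [Val.depth, Val.snd] at *; omega

theorem Poly.nth {α : Type} [Rep α] {f : α → Val} {i : α → ℕ} (hf : Poly f) (hi : Poly i) :
    Poly fun a => (f a).nth (i a) := by
  refine Poly.comp (g := fun b : Val × ℕ => b.1.nth b.2) ?_ (hf.mk hi)
  refine Poly.of_runs (.seq (.loop (.cond (.seq .fst .isPair) .snd (.const 0))
    (.pair (.seq .fst .snd) (.seq (.pair .snd (.const 1)) .sub))) (.seq .fst .fst))
    (T := fun b => 10 + 1 * sz b + (sz b + 1) * 61)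
    (((PolyIn.const 10).add ((PolyIn.const 1).mul .self)).add
      ((PolyIn.self.add (.const 1)).mul (.const 61))) ?_
  rintro ⟨v, i⟩
  let w : ℕ → Val := fun t => .pair (Val.snd^[t] v) (.num (i - t))
  obtain ⟨k, hk⟩ : ∃ k, k = min i v.depth := ⟨_, rfl⟩
  have hks : k ≤ sz (v, i) := by
    have := v.depth_le_size
    change k ≤ 1 + v.size + (1 + Nat.size i)
    omega
  have h2 := Code.Runs.loop (c := .cond (.seq .fst .isPair) .snd (.const 0))
    (f := .pair (.seq .fst .snd) (.seq (.pair .snd (.const 1)) .sub)) (w := w) (k := k) (t := 30)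
    (fun t ht => by
      by_cases h : t < v.depth
      · refine ⟨_, (Code.Runs.cond_true ((Code.runs_fst _).seq (Code.runs_isPair _)) ?_
          (Code.runs_snd _)).mono (by omega), ?_⟩
        · simp [w, Val.fst, Val.isPair_iterate_snd, h, Val.toNat]
        · simp only [w, Val.snd_pair, Val.toNat_num]
          omega
      · refine ⟨_, (Code.Runs.cond_false ((Code.runs_fst _).seq (Code.runs_isPair _)) ?_
          (Code.runs_const 0 _)).mono (by omega), ?_⟩
        · simp [w, Val.fst, Val.isPair_iterate_snd, h, Val.toNat]
        · exact iff_of_true rfl (by omega)) (fun t ht => by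
      have hw : w (t + 1) = .pair (Val.snd^[t] v).snd (.num (i - t - 1)) := by
        simp only [w, Function.iterate_succ_apply', Nat.sub_sub]
      rw [hw]
      exact (((Code.runs_fst _).seq (Code.runs_snd _)).pair
        (((Code.runs_snd _).pair (Code.runs_const 1 _)).seq (Code.runs_sub _))).mono (by omega))
  have h3 : (Code.seq .fst .fst).Runs (w k) (v.nth i) 3 := by
    have : v.nth i = (w k).fst.fst := by
      have h : (w k).fst.fst = v.nth k := (Val.nth_eq_iterate v k).symm
      rw [h]
      rcases le_total i v.depth with h | h
      · rw [hk, min_eq_left h]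
      · rw [hk, min_eq_right h, Val.nth_of_depth_le h, Val.nth_of_depth_le le_rfl]
    rw [this]
    exact (Code.runs_fst _).seq (Code.runs_fst _)
  have hwz : w 0 = rep (v, i) := rfl
  rw [hwz] at h2
  refine ⟨?_, (h2.seq h3).mono ?_⟩
  · have := (Val.nth_eq_iterate v i) ▸
      (Val.size_fst_le (Val.snd^[i] v)).trans (Val.size_iterate_snd_le v i)
    change (v.nth i).size ≤ 10 + 1 * (1 + v.size + (1 + Nat.size i)) + _
    omega
  · have : (k + 1) * (1 + 2 * 30) ≤ (sz (v, i) + 1) * 61 := Nat.mul_le_mul_right _ (by omega)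
    omega

/-- The first `k` entries of `v`, where every entry that is not a number less than `q` is replaced
by `0`. -/
def sanitize (q k : ℕ) (v : Val) : List ℕ :=
  (List.range k).map fun j => if (v.nth j).toNat < q then (v.nth j).toNat else 0

/-- The program that computes `sanitize` on `((q, l), v)`, where the list `l` gives the number of
entries. -/
def Code.sanitize : Code :=
  .seq (.pair .fst (.pair (.const 0) .snd)) (.seq
    (.loop (.seq (.seq .fst .snd) .isPair)
      (.pair (.pair (.seq .fst .fst) (.seq (.seq .fst .snd) .snd))
        (.pair (.pair (.cond (.seq (.pair (.seq (.seq .snd .snd) .fst) (.seq .fst .fst)) .lt)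
            (.seq (.pair (.seq (.seq .snd .snd) .fst) (.const 0)) .add) (.const 0))
          (.seq .snd .fst)) (.seq (.seq .snd .snd) .snd))))
    (.seq .snd .fst))

/-- Sanitizing takes a time that does not depend on the value `v`, which comes from outside and
may be of any size. The entries appear in reverse order. -/
theorem Code.runs_sanitize {α : Type} [Rep α] (q : ℕ) (l : List α) (v : Val) :
    Code.sanitize.Runs (.pair (rep (q, l)) v) (rep (DyNoFE.sanitize q l.length v).reverse)
      (20 + (l.length + 1) * 201) := by
  let w : ℕ → Val := fun i => .pair (rep (q, l.drop i))
    (.pair (rep (DyNoFE.sanitize q i v).reverse) (Val.snd^[i] v))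
  have h1 : (Code.pair .fst (.pair (.const 0) .snd)).Runs (.pair (rep (q, l)) v) (w 0) 5 :=
    (Code.runs_fst _).pair ((Code.runs_const 0 _).pair (Code.runs_snd _))
  have h2 := Code.Runs.loop (c := .seq (.seq .fst .snd) .isPair)
    (f := .pair (.pair (.seq .fst .fst) (.seq (.seq .fst .snd) .snd))
        (.pair (.pair (.cond (.seq (.pair (.seq (.seq .snd .snd) .fst) (.seq .fst .fst)) .lt)
            (.seq (.pair (.seq (.seq .snd .snd) .fst) (.const 0)) .add) (.const 0))
          (.seq .snd .fst)) (.seq (.seq .snd .snd) .snd))) (w := w) (k := l.length) (t := 100)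
    (fun i hi => by
      refine ⟨_, (((Code.runs_fst _).seq (Code.runs_snd _)).seq (Code.runs_isPair _)).mono
        (by omega), ?_⟩
      rcases hi.lt_or_eq with h | h
      · have : l.drop i = l[i] :: l.drop (i + 1) := List.drop_eq_getElem_cons h
        simp only [w, Val.snd, Val.fst, rep_prod, this, rep_cons, Val.isPair, Val.toNat]
        omega
      · simp [w, h, Val.snd, Val.fst, Val.isPair, Val.toNat]) (fun i hi => by
      have hd : l.drop i = l[i] :: l.drop (i + 1) := List.drop_eq_getElem_cons hi
      have hs : (DyNoFE.sanitize q (i + 1) v).reverse =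
          (if (v.nth i).toNat < q then (v.nth i).toNat else 0) ::
            (DyNoFE.sanitize q i v).reverse := by
        simp [DyNoFE.sanitize, List.range_succ]
      have hw' : w (i + 1) = .pair (.pair (.num q) (rep (l.drop (i + 1))))
          (.pair (.pair (.num (if (v.nth i).toNat < q then (v.nth i).toNat else 0))
            (rep (DyNoFE.sanitize q i v).reverse)) (Val.snd^[i] v).snd) := by
        simp only [w, hs, rep_cons, rep_prod, rep_nat, Function.iterate_succ_apply']
      have hw : w i = .pair (.pair (.num q) (.pair (rep l[i]) (rep (l.drop (i + 1)))))
          (.pair (rep (DyNoFE.sanitize q i v).reverse) (Val.snd^[i] v)) := by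
        simp only [w, hd, rep_cons, rep_prod, rep_nat]
      rw [hw, hw']
      refine ((((Code.runs_fst _).seq (Code.runs_fst _)).pair
        (((Code.runs_fst _).seq (Code.runs_snd _)).seq (Code.runs_snd _))).pair
        ((Code.Runs.pair (t := 50) ?_ ((Code.runs_snd _).seq (Code.runs_fst _))).pair
          (((Code.runs_snd _).seq (Code.runs_snd _)).seq (Code.runs_snd _)))).mono (by omega)
      have hlt := (((((Code.runs_snd _).seq (Code.runs_snd _)).seq (Code.runs_fst _)).pair
          ((Code.runs_fst _).seq (Code.runs_fst _))).seq (Code.runs_lt _) :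
        (Code.seq (.pair (.seq (.seq .snd .snd) .fst) (.seq .fst .fst)) .lt).Runs
          (.pair (.pair (.num q) (.pair (rep l[i]) (rep (l.drop (i + 1)))))
          (.pair (rep (DyNoFE.sanitize q i v).reverse) (Val.snd^[i] v))) _ _)
      have hv : (Val.snd^[i] v).fst = v.nth i := (Val.nth_eq_iterate v i).symm
      simp only [Val.fst_pair, Val.snd_pair, Val.toNat_num, hv] at hlt
      by_cases hq : (v.nth i).toNat < q
      · rw [if_pos hq]
        have hadd := (((((Code.runs_snd _).seq (Code.runs_snd _)).seq (Code.runs_fst _)).pair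
            (Code.runs_const 0 _)).seq (Code.runs_add _) :
          (Code.seq (.pair (.seq (.seq .snd .snd) .fst) (.const 0)) .add).Runs
            (.pair (.pair (.num q) (.pair (rep l[i]) (rep (l.drop (i + 1)))))
            (.pair (rep (DyNoFE.sanitize q i v).reverse) (Val.snd^[i] v))) _ _)
        simp only [Val.fst_pair, Val.snd_pair, Val.toNat_num, hv, add_zero] at hadd
        exact (hlt.cond_true (by rw [if_pos hq]; simp [Val.toNat]) hadd).mono (by omega)
      · rw [if_neg hq]
        exact (hlt.cond_false (by rw [if_neg hq]; rfl) (Code.runs_const 0 _)).mono (by omega))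
  have h3 : (Code.seq .snd .fst).Runs (w l.length)
      (rep (DyNoFE.sanitize q l.length v).reverse) 3 :=
    (Code.runs_snd _).seq (Code.runs_fst _)
  exact (h1.seq (h2.seq h3)).mono (by omega)

attribute [fun_prop] Poly Poly.id Poly.const Poly.comp Poly.mk Poly.fst Poly.snd Poly.ite Poly.iteBool Poly.add
  Poly.sub Poly.mul Poly.div Poly.mod Poly.natEq Poly.natLt Poly.and Poly.or Poly.not Poly.valFst
  Poly.valSnd Poly.toNat Poly.valPair Poly.valNum Poly.ofList Poly.cons Poly.nth
  Poly.map Poly.any Poly.all Poly.sum Poly.length Poly.getD Poly.reverse Poly.pow Poly.digits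

/-! ### Programs with simulated oracle -/

namespace Code

/-- The program `c` with a state `σ` that is threaded through and changes with each query: it acts
on pairs `(σ, v)`, and `h` takes the place of the oracle. -/
def lift (h : Code) : Code → Code
  | .query => h
  | .pair f g => .seq (.pair (lift h f) .snd)
      (.seq (.pair (.seq (.pair (.seq .fst .fst) .snd) (lift h g)) (.seq .fst .snd))
        (.pair (.seq .fst .fst) (.pair .snd (.seq .fst .snd))))
  | .seq f g => .seq (lift h f) (lift h g)
  | .cond c f g => .seq (.pair (lift h c) .snd) (.cond (.seq .fst .snd)
      (.seq (.pair (.seq .fst .fst) .snd) (lift h f))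
      (.seq (.pair (.seq .fst .fst) .snd) (lift h g)))
  | .loop c f => .seq (.pair (lift h c) .snd)
      (.seq (.loop (.seq .fst .snd) (.seq (.pair (.seq .fst .fst) .snd)
        (.seq (lift h f) (.pair (lift h c) .snd)))) (.pair (.seq .fst .fst) .snd))
  | c => .pair .fst (.seq .snd c)

variable {S : Type}

/-- Up to time, and unless the fuel is too small, the lifted program does what the original program
does with the simulated oracle. -/
theorem lift_le {h : Code} {n n' : ℕ} (hn : n < n') {H : S → Val → Comp (Val × S)} {E : S → Val}
    (hh : ∀ s m, ((h.eval n (.pair (E s) m)).erase).Le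
      ((H s m).bind fun r => .ret (.pair (E r.2) r.1)).erase) (c : Code) (v : Val) (s : S) :
    ((lift h c).eval n (.pair (E s) v)).erase.Le
      ((Comp.interp H (c.eval n' v) s).bind fun r => .ret (.pair (E r.2) r.1)).erase := by
  induction c generalizing v s with
  | query =>
    have := hh s v
    simpa [lift, eval, Comp.interp, Comp.bind_assoc] using this
  | pair f g ihf ihg =>
    simp only [lift, eval, Comp.interp, Comp.interp_bind, Comp.bind_assoc, Comp.erase_tick,
      Comp.erase_bind, Comp.tick_bind, Comp.ret_bind, Comp.erase_ret] at ihf ihg ⊢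
    exact (ihf v s).bind_map fun r => (ihg v r.2).bind_map fun r' => rfl
  | seq f g ihf ihg =>
    simp only [lift, eval, Comp.interp, Comp.interp_bind, Comp.bind_assoc, Comp.erase_tick,
      Comp.erase_bind, Comp.tick_bind, Comp.ret_bind, Comp.erase_ret] at ihf ihg ⊢
    exact (ihf v s).bind_map fun r => ihg r.1 r.2
  | cond c f g ihc ihf ihg =>
    simp only [lift, eval, Comp.interp, Comp.interp_bind, Comp.bind_assoc, Comp.erase_tick,
      Comp.erase_bind, Comp.tick_bind, Comp.ret_bind, Comp.erase_ret] at ihc ihf ihg ⊢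
    refine (ihc v s).bind_map fun r => ?_
    simp only [Val.fst_pair, Val.snd_pair]
    by_cases hr : r.1.toNat = 0
    · simp only [hr, if_true, Comp.erase_tick]
      exact ihg v r.2
    · simp only [hr, if_false, Comp.erase_tick]
      exact ihf v r.2
  | loop c f ihc ihf =>
    have key : ∀ (k k' : ℕ) (v : Val) (s : S), k < k' →
        (((eval n (.pair (lift h c) .snd) (.pair (E s) v)).bind
          (Comp.whileLoop (eval n (.seq .fst .snd)) (eval n (.seq (.pair (.seq .fst .fst) .snd)
            (.seq (lift h f) (.pair (lift h c) .snd)))) k)).bind fun w =>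
              .ret (Val.pair w.fst.fst w.snd)).erase.Le
        ((Comp.interp H (Comp.whileLoop (c.eval n') (f.eval n') k' v) s).bind
          fun r => .ret (Val.pair (E r.2) r.1)).erase := by
      intro k
      induction k with
      | zero =>
        intro k' v s hk
        obtain ⟨k', rfl⟩ : ∃ l, k' = l + 1 := ⟨k' - 1, by omega⟩
        simp only [lift, eval, Comp.whileLoop, Comp.interp, Comp.interp_bind, Comp.bind_assoc,
          Comp.erase_tick, Comp.erase_bind, Comp.tick_bind, Comp.ret_bind, Comp.erase_ret,
          Comp.erase_fail, Comp.fail_bind] at ihc ⊢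
        exact (ihc v s).bind_map fun r => trivial
      | succ k ih =>
        intro k' v s hk
        obtain ⟨k', rfl⟩ : ∃ l, k' = l + 1 := ⟨k' - 1, by omega⟩
        have hk : k < k' := by omega
        simp only [lift, eval, Comp.whileLoop, Comp.interp, Comp.interp_bind, Comp.bind_assoc,
          Comp.erase_tick, Comp.erase_bind, Comp.tick_bind, Comp.ret_bind, Comp.erase_ret]
          at ihc ihf ih ⊢
        refine (ihc v s).bind_map fun r => ?_
        simp only [Val.fst_pair, Val.snd_pair]
        by_cases hr : r.1.toNat = 0
        · simp only [hr, if_true, Comp.interp, Comp.erase_ret, Comp.ret_bind]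
          rfl
        · simp only [hr, if_false, Comp.interp_bind, Comp.bind_assoc, Comp.erase_tick,
            Comp.erase_bind, Comp.erase_ret, Comp.ret_bind, Comp.tick_bind]
          exact (ihf v r.2).bind_map fun r' => ih k' r'.1 r'.2 hk
    have := key n n' v s hn
    simpa only [lift, eval, Comp.interp, Comp.interp_bind, Comp.bind_assoc, Comp.erase_tick,
      Comp.erase_bind, Comp.tick_bind, Comp.ret_bind, Comp.erase_ret] using this
  | _ => simp [lift, eval, Comp.interp, Val.fst, Val.snd]; exact Comp.Le.refl _

/-- The conclusion of `lift_wp`: if the original program `c` satisfies a postcondition within time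
`t`, then the lifted one does so in time `K * t + s`, with `s` units left. -/
def LiftWP (h : Code) (n K : ℕ) (Inv : ℕ → Val → Prop) (n₀ : ℕ) (c : Code) : Prop :=
  ∀ (v : Val) (t : ℕ) (Q : Val → ℕ → Prop) (σ : Val) (s : ℕ),
    (c.eval n₀ v).WP t Q → Inv t σ →
      ((lift h c).eval n (.pair σ v)).WP (K * t + s) fun r b =>
        ∃ σ' a t', r = .pair σ' a ∧ Inv t' σ' ∧ K * t' + s ≤ b ∧ Q a t'

/-- The form in which the postcondition of a part of a program is used for the rest of the program:
time that is not needed for the part is kept for later. -/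
theorem LiftWP.bind {h : Code} {n K : ℕ} {Inv : ℕ → Val → Prop} {n₀ : ℕ} {c : Code}
    (hc : LiftWP h n K Inv n₀ c) {v : Val} {t : ℕ} {Q : Val → ℕ → Prop} {σ : Val} {s B : ℕ}
    {R : Val → ℕ → Prop}
    (hQ : (c.eval n₀ v).WP t Q) (hI : Inv t σ) (hB : K * t + s ≤ B)
    (hR : ∀ σ' a t' b, Inv t' σ' → K * t' + s ≤ b → Q a t' → R (.pair σ' a) b) :
    ((lift h c).eval n (.pair σ v)).WP B R := by
  obtain ⟨d, rfl⟩ := Nat.exists_eq_add_of_le hB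
  rw [add_assoc]
  refine (hc v t Q σ (s + d) hQ hI).imp ?_
  rintro r b - ⟨σ', a, t', rfl, h1, h2, h3⟩
  exact hR σ' a t' b h1 (by omega) h3

/-- Time of the lifted program. `Inv t σ` is a property of the state that holds as long as the
original program has `t` time units left; a query uses up as many units as its size, and each of
them pays for `K` units of the lifted program. -/
theorem lift_wp {h : Code} {n K : ℕ} (hK : 60 ≤ K) {Inv : ℕ → Val → Prop}
    (hh : ∀ t σ m s, 1 + m.size ≤ t → Inv t σ →
      (h.eval n (.pair σ m)).WP (K + s) fun r b =>
        ∃ σ' a, r = .pair σ' a ∧ Inv (t - (1 + m.size)) σ' ∧ s ≤ b)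
    (hanti : ∀ t t' σ, t' ≤ t → Inv t σ → Inv t' σ) {n₀ : ℕ} (hn : n₀ ≤ n) (c : Code) :
    LiftWP h n K Inv n₀ c := by
  have prim : ∀ (k t s b : ℕ), 1 ≤ k → k ≤ t → b + 4 + k = K * t + s → K * (t - k) + s ≤ b := by
    intro k t s b h1 h2 h3
    obtain ⟨d, rfl⟩ := Nat.exists_eq_add_of_le h2
    rw [Nat.add_sub_cancel_left]
    nlinarith
  have hle : ∀ (k t s : ℕ), 1 ≤ k → k ≤ t → 40 * k ≤ K * t + s := by
    intro k t s h1 h2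
    nlinarith
  have hstep : ∀ t, 1 ≤ t → K * t = K * (t - 1) + K := by
    intro t ht
    obtain ⟨d, rfl⟩ := Nat.exists_eq_add_of_le ht
    rw [Nat.add_sub_cancel_left]
    ring
  induction c with
  | query =>
    intro v t Q σ s hQ hI
    obtain ⟨h1, h2⟩ := hQ
    have h3 : K ≤ K * (1 + v.size) := Nat.le_mul_of_pos_right _ (by omega)
    obtain ⟨d, rfl⟩ := Nat.exists_eq_add_of_le h1
    rw [show K * (1 + v.size + d) + s = K + (K * d + s + (K * (1 + v.size) - K)) by
      rw [Nat.mul_add]; omega]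
    refine (hh _ _ _ _ h1 hI).imp ?_
    rintro r b - ⟨σ', a, rfl, h4, h5⟩
    refine ⟨σ', a, _, rfl, h4, ?_, h2 a⟩
    rw [Nat.add_sub_cancel_left]
    omega
  | pair f g ihf ihg =>
    intro v t Q σ s hQ hI
    obtain ⟨h1, h2⟩ := hQ
    have h3 := hstep t h1
    simp only [Comp.wp_bind, Comp.WP] at h2
    simp only [lift, eval, Comp.wp_bind, Comp.WP, Comp.tick_bind, Comp.ret_bind]
    repeat (refine And.intro (by omega) ?_)
    refine ihf.bind (s := s + 50) h2 (hanti _ _ _ (Nat.sub_le _ _) hI) (by omega) ?_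
    intro σ₁ a t₁ b hI₁ hb hQ₁
    simp only [Val.fst_pair, Val.snd_pair]
    repeat (refine And.intro (by omega) ?_)
    refine ihg.bind (s := s + 25) hQ₁ hI₁ (by omega) ?_
    intro σ₂ a₂ t₂ b₂ hI₂ hb₂ hQ₂
    simp only [Val.fst_pair, Val.snd_pair]
    repeat (refine And.intro (by omega) ?_)
    exact ⟨σ₂, _, t₂, rfl, hI₂, by omega, hQ₂⟩
  | seq f g ihf ihg =>
    intro v t Q σ s hQ hI
    obtain ⟨h1, h2⟩ := hQ
    have h3 := hstep t h1
    simp only [Comp.wp_bind] at h2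
    simp only [lift, eval, Comp.wp_bind, Comp.WP]
    refine And.intro (by omega) ?_
    refine ihf.bind (s := s) h2 (hanti _ _ _ (Nat.sub_le _ _) hI) (by omega) ?_
    intro σ₁ a t₁ b hI₁ hb hQ₁
    refine ihg.bind (s := s) hQ₁ hI₁ (by omega) ?_
    intro σ₂ a₂ t₂ b₂ hI₂ hb₂ hQ₂
    exact ⟨σ₂, _, t₂, rfl, hI₂, by omega, hQ₂⟩
  | cond c f g ihc ihf ihg =>
    intro v t Q σ s hQ hI
    obtain ⟨h1, h2⟩ := hQ
    have h3 := hstep t h1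
    simp only [Comp.wp_bind] at h2
    simp only [lift, eval, Comp.wp_bind, Comp.WP, Comp.tick_bind, Comp.ret_bind]
    repeat (refine And.intro (by omega) ?_)
    refine ihc.bind (s := s + 30) h2 (hanti _ _ _ (Nat.sub_le _ _) hI) (by omega) ?_
    intro σ₁ a t₁ b hI₁ hb hQ₁
    simp only [Val.fst_pair, Val.snd_pair]
    by_cases ha : a.toNat = 0
    · simp only [ha, if_true] at hQ₁
      simp only [ha, if_true, Comp.WP]
      repeat (refine And.intro (by omega) ?_)
      refine ihg.bind (s := s) hQ₁ hI₁ (by omega) ?_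
      intro σ₂ a₂ t₂ b₂ hI₂ hb₂ hQ₂
      exact ⟨σ₂, _, t₂, rfl, hI₂, by omega, hQ₂⟩
    · simp only [ha, if_false] at hQ₁
      simp only [ha, if_false, Comp.WP]
      repeat (refine And.intro (by omega) ?_)
      refine ihf.bind (s := s) hQ₁ hI₁ (by omega) ?_
      intro σ₂ a₂ t₂ b₂ hI₂ hb₂ hQ₂
      exact ⟨σ₂, _, t₂, rfl, hI₂, by omega, hQ₂⟩
  | loop c f ihc ihf =>
    have key : ∀ (k k' : ℕ) (v : Val) (t : ℕ) (Q : Val → ℕ → Prop) (σ : Val) (s B : ℕ), k ≤ k' →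
        (Comp.whileLoop (c.eval n₀) (f.eval n₀) k v).WP t Q → Inv t σ → K * t + s ≤ B + 20 →
        ((eval n (.pair (lift h c) .snd) (.pair σ v)).bind
          (Comp.whileLoop (eval n (.seq .fst .snd)) (eval n (.seq (.pair (.seq .fst .fst) .snd)
            (.seq (lift h f) (.pair (lift h c) .snd)))) k')).WP B fun r b =>
          ∃ σ' x a t', r = .pair (.pair σ' x) a ∧ Inv t' σ' ∧ K * t' + s + 10 ≤ b ∧ Q a t' := by
      intro k
      induction k with
      | zero => exact fun k' v t Q σ s B _ hQ => hQ.elim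
      | succ k ih =>
        intro k' v t Q σ s B hk hQ hI hB
        obtain ⟨k', rfl⟩ : ∃ l, k' = l + 1 := ⟨k' - 1, by omega⟩
        have hk : k ≤ k' := by omega
        obtain ⟨h1, h2⟩ := hQ
        have h3 := hstep t h1
        simp only [Comp.wp_bind] at h2
        simp only [eval, Comp.whileLoop, Comp.wp_bind, Comp.WP] at ih ⊢
        repeat (refine And.intro (by omega) ?_)
        refine ihc.bind (s := s + 30) h2 (hanti _ _ _ (Nat.sub_le _ _) hI) (by omega) ?_
        intro σ₁ a t₁ b hI₁ hb hQ₁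
        simp only [Val.fst_pair, Val.snd_pair]
        repeat (refine And.intro (by omega) ?_)
        by_cases ha : a.toNat = 0
        · simp only [ha, if_true, Comp.WP] at hQ₁
          simp only [ha, if_true, Comp.WP]
          exact ⟨σ₁, a, v, t₁, rfl, hI₁, by omega, hQ₁⟩
        · simp only [ha, if_false, Comp.wp_bind] at hQ₁
          simp only [ha, if_false, Comp.wp_bind, Comp.WP, Val.fst_pair, Val.snd_pair]
          repeat (refine And.intro (by omega) ?_)
          refine ihf.bind (s := s + 5) hQ₁ hI₁ (by omega) ?_
          intro σ₂ a₂ t₂ b₂ hI₂ hb₂ hQ₂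
          exact ih k' a₂ t₂ Q σ₂ s _ hk hQ₂ hI₂ (by omega)
    intro v t Q σ s hQ hI
    have ht : 1 ≤ t := by
      cases n₀ with
      | zero => exact hQ.elim
      | succ n₀ => exact hQ.1
    have h3 := hstep t ht
    have h4 := key n₀ n v t Q σ s (K * t + s - 2) hn hQ hI (by omega)
    simp only [eval, Comp.wp_bind, Comp.WP] at h4
    simp only [lift, eval, Comp.wp_bind, Comp.WP]
    obtain ⟨h4, h5⟩ := h4
    refine ⟨by omega, by omega, h5.mono (by omega) ?_⟩
    rintro a t' t₁' - - h6 h7 ⟨h8, h9⟩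
    refine ⟨h8.trans (by omega), by omega, ?_⟩
    rw [show t₁' - 1 - 1 = t' - 1 by omega]
    refine h9.imp ?_
    rintro r b - ⟨σ', x, a, t₂, rfl, h10, h11, h12⟩
    simp only [Val.fst_pair, Val.snd_pair]
    repeat (refine And.intro (by omega) ?_)
    exact ⟨σ', a, t₂, rfl, h10, by omega, h12⟩
  | rand =>
    intro v t Q σ s hQ hI
    obtain ⟨h1, h2⟩ := hQ
    have h3 := hle _ _ s (by omega) h1
    simp only [lift, eval, Comp.wp_bind, Comp.WP, Comp.tick_bind, Val.fst_pair, Val.snd_pair]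
    repeat (refine And.intro (by omega) ?_)
    exact fun i => ⟨σ, _, _, rfl, hanti _ _ _ (Nat.sub_le _ _) hI,
      prim _ _ _ _ (by omega) h1 (by omega), h2 i⟩
  | _ =>
    intro v t Q σ s hQ hI
    obtain ⟨h1, h2⟩ := hQ
    have h3 := hle _ _ s (by omega) h1
    simp only [lift, eval, Comp.wp_bind, Comp.WP, Comp.tick_bind, Val.fst_pair, Val.snd_pair]
    repeat (refine And.intro (by omega) ?_)
    exact ⟨σ, _, _, rfl, hanti _ _ _ (Nat.sub_le _ _) hI, prim _ _ _ _ (by omega) h1 (by omega), h2⟩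
end Code

/-! ### The messages of the adversary -/

section Messages

/-- The kind of a query. -/
def tag (m : Val) : ℕ := m.fst.toNat

/-- The client in a corruption, registration or encryption query. -/
def client (m : Val) : ℕ := if tag m < 2 then m.snd.toNat else (m.snd.nth 0).toNat

/-- The number of the label in an encryption or decryption key query. Other messages are given
some label as well, so that all messages can be treated alike. -/
def labelCode (m : Val) : ℕ := if tag m = 2 then (m.snd.nth 1).toNat else (m.snd.nth 0).toNat

/-- The entry with index `j` of the plaintext `x^b` in an encryption query. -/
def plain (b : ℕ) (m : Val) (j : ℕ) : ℕ := ((m.snd.nth (2 + b)).nth j).toNat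

/-- The noise `ν^b` in a decryption key query. -/
def noise (b : ℕ) (m : Val) : ℕ := (m.snd.nth (2 + b)).toNat

/-- Whether the client `i` belongs to the set `S` of a decryption key query. -/
def inSupport (m : Val) (i : ℕ) : Bool := !decide ((((m.snd.nth 1).nth i).fst).toNat = 0)

/-- The entry with index `j` of the vector `y_i` in a decryption key query. -/
def coeff (m : Val) (i j : ℕ) : ℕ := (((m.snd.nth 1).nth i).snd.nth j).toNat

/-- Whether the client `i` has been corrupted. Here and below, `s` is a list of messages, the latest one
first; each of them carries a flag that tells whether the query was accepted. -/
def isCor (s : List (Val × Bool)) (i : ℕ) : Bool :=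
  s.any fun e => decide (tag e.1 = 0) && (e.2 && decide (client e.1 = i))

/-- The client `i` has a key. -/
def isReg (s : List (Val × Bool)) (i : ℕ) : Bool :=
  s.any fun e => decide (tag e.1 < 2) && (e.2 && decide (client e.1 = i))

/-- There was a query other than a corruption query. -/
def started (n : ℕ) (s : List (Val × Bool)) : Bool :=
  s.any fun e => decide (tag e.1 = 3) ||
    ((decide (tag e.1 = 1) || decide (tag e.1 = 2)) && decide (client e.1 < n))

/-- The message is an answered encryption query for the client `i` and the label `l`. -/
def isEnc (i l : ℕ) (e : Val × Bool) : Bool :=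
  decide (tag e.1 = 2) && (e.2 && (decide (client e.1 = i) && decide (labelCode e.1 = l)))

/-- An encryption query for the client `i` and the label `l` was answered. -/
def hasEnc (s : List (Val × Bool)) (i l : ℕ) : Bool := s.any (isEnc i l)

/-- Whether the query `m` after the queries `s` is accepted. -/
def accepted (n : ℕ) (s : List (Val × Bool)) (m : Val) : Bool :=
  if tag m = 0 then decide (client m < n) && !started n s
  else if tag m = 1 then decide (client m < n)
  else if tag m = 2 then isReg s (client m) && !hasEnc s (client m) (labelCode m)
  else if tag m = 3 then (List.range n).all fun i => !inSupport m i || isReg s i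
  else false

/-- The messages with their flags. -/
def annotate (n : ℕ) : List Val → List (Val × Bool)
  | [] => []
  | m :: ms => (m, accepted n (annotate n ms) m) :: annotate n ms

/-- The number in the answer to the decryption key query `m` with bit `b`, where `F i j` is the
entry with index `j` of the pad of the client `i`, and `len` the vector length. -/
def keyValue (q n len b : ℕ) (F : ℕ → ℕ → ℕ) (m : Val) : ℕ :=
  (((List.range n).map fun i => if inSupport m i = true then
    ((List.range len).map fun j => F i j * coeff m i j).sum else 0).sum +
      (q - noise b m % q)) % q

/-- The answer to the accepted query `m` with bit `b`, if `K i` is the key of the client `i` and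
`F i` is its pad for the label of the query. -/
def reply (q n len b : ℕ) (K : ℕ → ℕ) (F : ℕ → ℕ → ℕ) (m : Val) : Val :=
  if tag m = 0 then answer (.num (K (client m)))
  else if tag m = 1 then ignored
  else if tag m = 2 then answer (.ofList [.num (client m), .num (labelCode m),
    .ofList ((List.range len).map fun j => .num ((plain b m j + F (client m) j) % q))])
  else answer (.ofList [.num (labelCode m),
    .ofList ((List.range n).map fun i => if inSupport m i = true then
      .pair (.num 1) (.ofList ((List.range len).map fun j => .num (coeff m i j % q)))
      else .num 0),
    .num (keyValue q n len b F m)])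

/-- The answered encryption query for the client `i` and the label `l`, if there is one. -/
def encMsg (s : List (Val × Bool)) (i l : ℕ) : Val :=
  s.foldl (fun r e => if isEnc i l e = true then e.1 else r) (.num 0)

/-- The value of the left-hand (`b = 0`) or right-hand (`b = 1`) side of the balance condition for
the decryption key query `m`, up to the contribution of the corrupted clients. -/
def balance (n len b : ℕ) (s : List (Val × Bool)) (m : Val) : ℕ :=
  ((List.range n).map fun i => if (inSupport m i && !isCor s i) = true then
    ((List.range len).map fun j =>
      plain b (encMsg s i (labelCode m)) j * coeff m i j).sum else 0).sum + noise b m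

/-- The admissibility conditions for the answered query `e`. -/
def admissibleAt (q n len : ℕ) (s : List (Val × Bool)) (e : Val × Bool) : Bool :=
  if (decide (tag e.1 = 2) && e.2) = true then
    !isCor s (client e.1) ||
      (List.range len).all fun j => decide (plain 0 e.1 j % q = plain 1 e.1 j % q)
  else if (decide (tag e.1 = 3) && e.2) = true then
    (List.range n).all (fun i => !inSupport e.1 i || isCor s i || hasEnc s i (labelCode e.1)) &&
      decide (balance n len 0 s e.1 % q = balance n len 1 s e.1 % q)
  else true

variable {α : Type} [Rep α]

@[fun_prop] theorem poly_tag : Poly tag := by unfold tag; fun_prop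

@[fun_prop] theorem poly_client : Poly client := by unfold client; fun_prop

@[fun_prop] theorem poly_labelCode : Poly labelCode := by unfold labelCode; fun_prop

@[fun_prop] theorem poly_plain {b j : α → ℕ} {m : α → Val} (hb : Poly b) (hm : Poly m)
    (hj : Poly j) : Poly fun a => plain (b a) (m a) (j a) := by unfold plain; fun_prop

@[fun_prop] theorem poly_noise {b : α → ℕ} {m : α → Val} (hb : Poly b) (hm : Poly m) :
    Poly fun a => noise (b a) (m a) := by unfold noise; fun_prop

@[fun_prop] theorem poly_inSupport {i : α → ℕ} {m : α → Val} (hm : Poly m) (hi : Poly i) :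
    Poly fun a => inSupport (m a) (i a) := by unfold inSupport; fun_prop

@[fun_prop] theorem poly_coeff {i j : α → ℕ} {m : α → Val} (hm : Poly m) (hi : Poly i)
    (hj : Poly j) : Poly fun a => coeff (m a) (i a) (j a) := by unfold coeff; fun_prop

@[fun_prop] theorem poly_isCor {s : α → List (Val × Bool)} {i : α → ℕ} (hs : Poly s)
    (hi : Poly i) : Poly fun a => isCor (s a) (i a) := by unfold isCor; fun_prop

@[fun_prop] theorem poly_isReg {s : α → List (Val × Bool)} {i : α → ℕ} (hs : Poly s)
    (hi : Poly i) : Poly fun a => isReg (s a) (i a) := by unfold isReg; fun_prop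

@[fun_prop] theorem poly_started {s : α → List (Val × Bool)} {n : α → ℕ} (hn : Poly n)
    (hs : Poly s) : Poly fun a => started (n a) (s a) := by unfold started; fun_prop

@[fun_prop] theorem poly_isEnc {i l : α → ℕ} {e : α → Val × Bool} (hi : Poly i) (hl : Poly l)
    (he : Poly e) : Poly fun a => isEnc (i a) (l a) (e a) := by unfold isEnc; fun_prop

@[fun_prop] theorem poly_hasEnc {s : α → List (Val × Bool)} {i l : α → ℕ} (hs : Poly s)
    (hi : Poly i) (hl : Poly l) : Poly fun a => hasEnc (s a) (i a) (l a) := by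
  unfold hasEnc; fun_prop

theorem poly_of_range {n : α → ℕ} (hn : Poly fun a => List.range (n a)) : Poly n :=
  hn.length.of_eq fun a => by simp

@[fun_prop] theorem poly_accepted {n : α → ℕ} {s : α → List (Val × Bool)} {m : α → Val}
    (hn : Poly fun a => List.range (n a)) (hs : Poly s) (hm : Poly m) :
    Poly fun a => accepted (n a) (s a) (m a) := by
  have := poly_of_range hn
  unfold accepted
  fun_prop

theorem poly_keyValue {q n len b : α → ℕ} {F : α → ℕ → ℕ → ℕ} {m : α → Val} (hq : Poly q)
    (hn : Poly fun a => List.range (n a)) (hlen : Poly fun a => List.range (len a)) (hb : Poly b)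
    (hF : Poly fun x : α × ℕ × ℕ => F x.1 x.2.1 x.2.2) (hm : Poly m) :
    Poly fun a => keyValue (q a) (n a) (len a) (b a) (F a) (m a) := by
  obtain ⟨ns, hns⟩ : ∃ ns : α → List ℕ, ∀ a, List.range (n a) = ns a := ⟨_, fun _ => rfl⟩
  obtain ⟨ls, hls⟩ : ∃ ls : α → List ℕ, ∀ a, List.range (len a) = ls a := ⟨_, fun _ => rfl⟩
  obtain ⟨G, hG⟩ : ∃ G : α × ℕ × ℕ → ℕ, ∀ a i j, F a i j = G (a, i, j) :=
    ⟨fun x => F x.1 x.2.1 x.2.2, fun _ _ _ => rfl⟩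
  unfold keyValue
  simp only [hns, hls, hG] at hn hlen hF ⊢
  fun_prop

theorem poly_reply {q n len b : α → ℕ} {K : α → ℕ → ℕ} {F : α → ℕ → ℕ → ℕ} {m : α → Val}
    (hq : Poly q) (hn : Poly fun a => List.range (n a)) (hlen : Poly fun a => List.range (len a))
    (hb : Poly b) (hK : Poly fun x : α × ℕ => K x.1 x.2)
    (hF : Poly fun x : α × ℕ × ℕ => F x.1 x.2.1 x.2.2) (hm : Poly m) :
    Poly fun a => reply (q a) (n a) (len a) (b a) (K a) (F a) (m a) := by
  have hv := poly_keyValue hq hn hlen hb hF hm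
  obtain ⟨v, hv'⟩ : ∃ v : α → ℕ, ∀ a, keyValue (q a) (n a) (len a) (b a) (F a) (m a) = v a :=
    ⟨_, fun _ => rfl⟩
  obtain ⟨ns, hns⟩ : ∃ ns : α → List ℕ, ∀ a, List.range (n a) = ns a := ⟨_, fun _ => rfl⟩
  obtain ⟨ls, hls⟩ : ∃ ls : α → List ℕ, ∀ a, List.range (len a) = ls a := ⟨_, fun _ => rfl⟩
  obtain ⟨G, hG⟩ : ∃ G : α × ℕ × ℕ → ℕ, ∀ a i j, F a i j = G (a, i, j) :=
    ⟨fun x => F x.1 x.2.1 x.2.2, fun _ _ _ => rfl⟩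
  obtain ⟨L, hL⟩ : ∃ L : α × ℕ → ℕ, ∀ a i, K a i = L (a, i) :=
    ⟨fun x => K x.1 x.2, fun _ _ => rfl⟩
  unfold reply answer
  simp only [hv', hns, hls, hG, hL] at hv hn hlen hF hK ⊢
  fun_prop

@[fun_prop] theorem poly_encMsg {s : α → List (Val × Bool)} {i l : α → ℕ} (hs : Poly s)
    (hi : Poly i) (hl : Poly l) : Poly fun a => encMsg (s a) (i a) (l a) := by
  unfold encMsg
  refine Poly.foldl hs (.const _) (by fun_prop) ⟨fun a => 1 + sz (s a),
    (PolyIn.const 1).add hs.polyIn, fun a l' hl' => ?_⟩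
  have key : ∀ (l' : List (Val × Bool)) (r : Val), (∀ e ∈ l', sz e.1 ≤ 1 + sz (s a)) →
      sz r ≤ 1 + sz (s a) →
      sz (l'.foldl (fun r e => if isEnc (i a) (l a) e = true then e.1 else r) r) ≤
        1 + sz (s a) := by
    intro l'
    induction l' with
    | nil => exact fun r _ hr => hr
    | cons e l' ih =>
      intro r he hr
      refine ih _ (fun e he' => he e (List.mem_cons_of_mem _ he')) ?_
      beta_reduce
      split_ifs
      · exact he e List.mem_cons_self
      · exact hr
  refine key l' _ (fun e he => ?_) ?_
  · have := sz_le_of_mem (hl'.subset he)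
    simp only [sz_prod] at this
    omega
  · simp [sz, Val.size]

theorem poly_balance {n len b : α → ℕ} {s : α → List (Val × Bool)} {m : α → Val}
    (hn : Poly fun a => List.range (n a)) (hlen : Poly fun a => List.range (len a))
    (hb : Poly b) (hs : Poly s) (hm : Poly m) :
    Poly fun a => balance (n a) (len a) (b a) (s a) (m a) := by
  obtain ⟨ns, hns⟩ : ∃ ns : α → List ℕ, ∀ a, List.range (n a) = ns a := ⟨_, fun _ => rfl⟩
  obtain ⟨ls, hls⟩ : ∃ ls : α → List ℕ, ∀ a, List.range (len a) = ls a := ⟨_, fun _ => rfl⟩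
  unfold balance
  simp only [hns, hls] at hn hlen ⊢
  fun_prop

theorem poly_admissibleAt {q n len : α → ℕ} {s : α → List (Val × Bool)} {e : α → Val × Bool}
    (hq : Poly q) (hn : Poly fun a => List.range (n a))
    (hlen : Poly fun a => List.range (len a)) (hs : Poly s) (he : Poly e) :
    Poly fun a => admissibleAt (q a) (n a) (len a) (s a) (e a) := by
  have h0 := poly_balance hn hlen (.const 0) hs (.fst he)
  have h1 := poly_balance hn hlen (.const 1) hs (.fst he)
  unfold admissibleAt
  fun_prop

end Messages

/-! ### Simulators -/

theorem Code.Runs.wp_of {c : Code} {v a : Val} {t n B : ℕ} {Q : Val → ℕ → Prop}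
    (h : c.Runs v a t) (hn : t ≤ n) (hB : t ≤ B) (hQ : ∀ b, B ≤ b + t → Q a b) :
    (c.eval n v).WP B Q := by
  obtain ⟨d, rfl⟩ := Nat.exists_eq_add_of_le hB
  refine (h.wp hn).imp ?_
  rintro b t' - ⟨rfl, h⟩
  exact hQ _ (by omega)

theorem Poly.exists_code {α β : Type} [Rep α] [Rep β] {f : α → β} (hf : Poly f) :
    ∃ (c : Code) (p : Polynomial ℕ), ∀ a N, sz a ≤ N →
      sz (f a) ≤ p.eval N ∧ c.Runs (rep a) (rep (f a)) (p.eval N) := by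
  obtain ⟨c, T, ⟨p, hp⟩, h⟩ := hf
  refine ⟨c, p, fun a N hN => ?_⟩
  have h1 := (hp a).trans (polynomial_eval_mono p hN)
  exact ⟨(h a).1.trans h1, (h a).2.mono h1⟩

/-- What a simulator remembers of a query: the message with its flag, the answer of its own oracle,
and a number that was drawn. -/
abbrev Entry : Type := (Val × Bool) × List ℕ × ℕ

/-- The state of a simulator: the security parameter in unary, three numbers drawn in the
beginning, and the queries so far, the latest one first. -/
abbrev SimState : Type := (List ℕ × ℕ × ℕ × ℕ) × List Entry

/-- The functions that describe a simulator. It runs an adversary on the input `start`; whenever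
the adversary sends a message `m`, the simulator draws a number up to `bound`, sends `label m` to
its own oracle, and reads the reply as a list of numbers less than `modulus` that is as long as the
list `width`. -/
structure Simulator where
  bound₁ : List ℕ → ℕ
  bound₂ : List ℕ → ℕ
  bound₃ : List ℕ → ℕ
  start : List ℕ → Val
  bound : List ℕ → ℕ
  label : Val → ℕ
  modulus : List ℕ → ℕ
  width : List ℕ → List ℕ
  flag : SimState × Val → Bool
  ans : SimState × Val × Entry → Val
  out : SimState × Bool → Bool

namespace Simulator

variable (M : Simulator)

/-- All functions that describe the simulator are computable in polynomial time. -/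
structure Efficient : Prop where
  bound₁ : Poly M.bound₁
  bound₂ : Poly M.bound₂
  bound₃ : Poly M.bound₃
  start : Poly M.start
  bound : Poly M.bound
  label : Poly M.label
  modulus : Poly M.modulus
  width : Poly M.width
  flag : Poly M.flag
  ans : Poly M.ans
  out : Poly M.out

/-- The entry for the message `m`, given the drawn number and the answer of the oracle. -/
def entry (s : SimState) (m : Val) (d : ℕ) (z : List ℕ) : Entry := ((m, M.flag (s, m)), z, d)

/-- The treatment of the message `m`. -/
def handle (s : SimState) (m : Val) : Comp (Val × SimState) :=
  .rand (M.bound s.1.1) fun d => .query (.num (M.label m)) fun z =>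
    let e := M.entry s m d (sanitize (M.modulus s.1.1) (M.width s.1.1).length z)
    .ret (M.ans (s, m, e), (s.1, e :: s.2))

/-- The simulation of the adversary `A`. -/
def comp (A : PPT) (κ : ℕ) : Comp Val :=
  let u := List.range κ
  .rand (M.bound₁ u) fun b => .rand (M.bound₂ u) fun j => .rand (M.bound₃ u) fun D =>
    (Comp.interp M.handle (A.comp κ (M.start u)) ((u, b, j, D), [])).bind fun r =>
      .ret (rep (M.out (r.2, decide (r.1.toNat = 1))))

/-- The program that treats one message; `cB`, `cL`, `cQ` and `cU` compute the bound of the random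
number, the label, the shape of the oracle's answer, and the result. -/
def handlerCode (cB cL cQ cU : Code) : Code :=
  .seq (.pair .id (.seq .fst (.seq cB .rand)))
    (.seq (.pair .id (.seq (.seq .fst .snd) (.seq cL .query)))
      (.seq (.pair .fst (.seq (.pair (.seq (.seq .fst (.seq .fst .fst)) cQ) .snd) Code.sanitize)) cU))

/-- The program `handlerCode` does the same as `handle`, up to time and fuel. -/
theorem handlerCode_le {M : Simulator} {cB cL cQ cU : Code} {tB tQ : SimState → ℕ} {tL : Val → ℕ}
    {tU : ((SimState × Val) × ℕ) × List ℕ → ℕ}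
    (hB : ∀ s, cB.Runs (rep s) (rep (M.bound s.1.1)) (tB s))
    (hL : ∀ m, cL.Runs m (rep (M.label m)) (tL m))
    (hQ : ∀ s : SimState, cQ.Runs (rep s) (rep (M.modulus s.1.1, M.width s.1.1)) (tQ s))
    (hU : ∀ x : ((SimState × Val) × ℕ) × List ℕ, cU.Runs (rep x)
      (rep (((x.1.1.1.1, M.entry x.1.1.1 x.1.1.2 x.1.2 x.2.reverse :: x.1.1.1.2) : SimState),
        M.ans (x.1.1.1, x.1.1.2, M.entry x.1.1.1 x.1.1.2 x.1.2 x.2.reverse))) (tU x))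
    (n : ℕ) (s : SimState) (m : Val) :
    (((handlerCode cB cL cQ cU).eval n (.pair (rep s) m)).erase).Le
      ((M.handle s m).bind fun r => .ret (.pair (rep r.2) r.1)).erase := by
  simp only [handlerCode, handle, Code.eval, Comp.erase_tick, Comp.erase_bind, Comp.tick_bind,
    Comp.ret_bind, Comp.erase_ret, Comp.erase_rand, Comp.erase_query, Comp.bind_assoc,
    Val.fst_pair, Val.snd_pair, Comp.rand_bind, Comp.query_bind]
  refine ((hB s).le n).bind_of_ret ⟨_, rfl, fun d => ?_⟩
  simp only [Comp.erase_tick, Comp.erase_bind, Comp.tick_bind,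
    Comp.ret_bind, Comp.erase_ret, Comp.erase_rand, Comp.erase_query, Comp.bind_assoc,
    Val.fst_pair, Val.snd_pair, Comp.rand_bind, Comp.query_bind]
  refine ((hL m).le n).bind_of_ret ⟨_, rfl, fun z => ?_⟩
  simp only [Comp.erase_tick, Comp.erase_bind, Comp.tick_bind,
    Comp.ret_bind, Comp.erase_ret, Comp.erase_rand, Comp.erase_query, Comp.bind_assoc,
    Val.fst_pair, Val.snd_pair, Comp.rand_bind, Comp.query_bind]
  refine ((hQ s).le n).bind_of_ret ?_
  refine ((Code.runs_sanitize _ _ z).le n).bind_of_ret ?_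
  have := (hU (((s, m), (d : ℕ)), (sanitize (M.modulus s.1.1) (M.width s.1.1).length z).reverse)).le n
  simpa [rep_nat] using this

/-- A bound for the time that the treatment of one message takes, and for the size of the new entry.
The latter keeps the states of the simulation of polynomial size. -/
theorem handlerCode_wp {M : Simulator} {cB cL cQ cU : Code} {N₀ N B₁ L₁ Q₁ U₁ n : ℕ}
    {s : SimState} {m : Val}
    (hB : sz (M.bound s.1.1) ≤ B₁ ∧ cB.Runs (rep s) (rep (M.bound s.1.1)) B₁)
    (hL : sz (M.label m) ≤ L₁ ∧ cL.Runs m (rep (M.label m)) L₁)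
    (hQ : sz (M.modulus s.1.1, M.width s.1.1) ≤ Q₁ ∧
      cQ.Runs (rep s) (rep (M.modulus s.1.1, M.width s.1.1)) Q₁)
    (hU : ∀ x : ((SimState × Val) × ℕ) × List ℕ, sz x ≤ N → cU.Runs (rep x)
      (rep (((x.1.1.1.1, M.entry x.1.1.1 x.1.1.2 x.1.2 x.2.reverse :: x.1.1.1.2) : SimState),
        M.ans (x.1.1.1, x.1.1.2, M.entry x.1.1.1 x.1.1.2 x.1.2 x.2.reverse))) U₁)
    (hN₀ : sz s + m.size ≤ N₀) (hN : 3 + N₀ + B₁ + (1 + Q₁ * (1 + Q₁)) ≤ N)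
    (hn : 100 + 2 * B₁ + 2 * L₁ + Q₁ + (Q₁ + 1) * 201 + U₁ ≤ n) (r : ℕ) :
    ((handlerCode cB cL cQ cU).eval n (.pair (rep s) m)).WP
      (100 + 2 * B₁ + 2 * L₁ + Q₁ + (Q₁ + 1) * 201 + U₁ + r) fun a b =>
        ∃ (e : Entry) (v : Val), a = .pair (rep ((s.1, e :: s.2) : SimState)) v ∧
          sz e ≤ 10 + m.size + (1 + Q₁ * (1 + Q₁)) + B₁ ∧ r ≤ b := by
  have hw : (M.width s.1.1).length ≤ Q₁ := by
    have := length_le_sz (M.width s.1.1)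
    have := hQ.1
    simp only [sz_prod] at this
    omega
  have hw' : ((M.width s.1.1).length + 1) * 201 ≤ (Q₁ + 1) * 201 := by omega
  simp only [handlerCode, Code.eval, Comp.wp_bind, Comp.WP, Val.fst_pair, Val.snd_pair]
  repeat (refine And.intro (by omega) ?_)
  refine hB.2.wp_of (by omega) (by omega) fun b₁ hb₁ => ?_
  have hB' : 1 + Nat.size (rep (M.bound s.1.1)).toNat ≤ B₁ := hB.1
  refine And.intro (by omega) fun d => ?_
  repeat (refine And.intro (by omega) ?_)
  refine hL.2.wp_of (by omega) (by omega) fun b₂ hb₂ => ?_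
  have hL' : (rep (M.label m)).size ≤ L₁ := hL.1
  refine And.intro (by omega) fun z => ?_
  repeat (refine And.intro (by omega) ?_)
  refine hQ.2.wp_of (by omega) (by omega) fun b₃ hb₃ => ?_
  refine And.intro (by omega) ?_
  refine (Code.runs_sanitize _ _ z).wp_of (by omega) (by omega) fun b₄ hb₄ => ?_
  have hd : sz (d : ℕ) ≤ B₁ := by
    refine le_trans ?_ hB.1
    have h : (d : ℕ) ≤ M.bound s.1.1 := Nat.lt_succ_iff.1 d.2
    simpa only [sz_nat] using Nat.add_le_add_left (Nat.size_le_size h) 1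
  have hz : sz (sanitize (M.modulus s.1.1) (M.width s.1.1).length z) ≤ 1 + Q₁ * (1 + Q₁) := by
    have hq : sz (M.modulus s.1.1) ≤ Q₁ := by
      have := hQ.1
      simp only [sz_prod] at this
      omega
    refine (sz_le_of_forall (B := Q₁) fun a ha => ?_).trans ?_
    · obtain ⟨j, -, rfl⟩ := List.mem_map.1 ha
      refine le_trans ?_ hq
      simp only [sz_nat]
      refine Nat.add_le_add_left (Nat.size_le_size ?_) 1
      split_ifs <;> omega
    · simp only [sanitize, List.length_map, List.length_range]
      gcongr
  have hx := hU (((s, m), (d : ℕ)), (sanitize (M.modulus s.1.1) (M.width s.1.1).length z).reverse)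
    (by
      have hm : sz m = m.size := rfl
      simp only [sz_prod (β := List ℕ), sz_prod (β := ℕ), sz_prod (β := Val), sz_reverse, hm]
        at hN₀ ⊢
      omega)
  refine hx.wp_of (by omega) (by omega) fun b₅ hb₅ => ⟨_, _, rfl, ?_, by omega⟩
  have hf := sz_bool_le (M.flag (s, m))
  have hm : sz m = m.size := rfl
  simp only [entry, sz_prod (β := List ℕ × ℕ), sz_prod (β := ℕ), sz_prod (β := Bool),
    List.reverse_reverse, hm] at hd ⊢
  omega

/-- The program that draws the three numbers in the beginning. -/
def drawCode (c₁ c₂ c₃ : Code) : Code :=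
  .pair .id (.pair (.seq c₁ .rand) (.pair (.seq c₂ .rand) (.seq c₃ .rand)))

/-- The simulation of the program `cA` as a program; `h` treats the messages, `cS` computes the
initial state and the input of `cA`, and `cO` the result. -/
def mainCode (c₁ c₂ c₃ cS h cA cO : Code) : Code :=
  .seq .fst (.seq .range (.seq (drawCode c₁ c₂ c₃) (.seq cS (.seq (Code.lift h cA)
    (.seq (.pair .fst (.seq (.pair .snd (.const 1)) .eq)) cO)))))

/-- The program `mainCode` does the same as `comp`, up to time and fuel. -/
theorem mainCode_le {M : Simulator} {A : PPT} {κ n : ℕ} {c₁ c₂ c₃ cS h cO : Code}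
    {t₁ t₂ t₃ tS : ℕ} {tO : SimState × Bool → ℕ}
    (h₁ : c₁.Runs (rep (List.range κ)) (rep (M.bound₁ (List.range κ))) t₁)
    (h₂ : c₂.Runs (rep (List.range κ)) (rep (M.bound₂ (List.range κ))) t₂)
    (h₃ : c₃.Runs (rep (List.range κ)) (rep (M.bound₃ (List.range κ))) t₃)
    (hS : ∀ b j D : ℕ, b ≤ M.bound₁ (List.range κ) → j ≤ M.bound₂ (List.range κ) →
      D ≤ M.bound₃ (List.range κ) → cS.Runs (rep (List.range κ, b, j, D))
        (.pair (rep (((List.range κ, b, j, D), []) : SimState))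
          (.pair (.num κ) (M.start (List.range κ)))) tS)
    (hh : ∀ s m, ((h.eval n (.pair (rep s) m)).erase).Le
      ((M.handle s m).bind fun r => .ret (.pair (rep r.2) r.1)).erase)
    (hO : ∀ x, cO.Runs (rep x) (rep (M.out x)) (tO x)) (v : Val) :
    ((mainCode c₁ c₂ c₃ cS h A.code cO).eval n (.pair (.num κ) v)).erase.Le
      (M.comp A κ).erase := by
  have hA : A.comp κ (M.start (List.range κ)) = A.code.eval (max (n + 1) (A.time.eval κ))
      (.pair (.num κ) (M.start (List.range κ))) :=
    (Code.eval_eq_of_noFail (le_max_right _ _)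
      ((Comp.within_iff _ _).1 (A.within κ _)).noFail).symm
  have hlift := Code.lift_le (n' := max (n + 1) (A.time.eval κ))
    (lt_of_lt_of_le (Nat.lt_succ_self n) (le_max_left _ _)) hh A.code
    (.pair (.num κ) (M.start (List.range κ)))
  simp only [mainCode, drawCode, comp, hA, Code.eval, Comp.erase_tick, Comp.erase_bind,
    Comp.tick_bind, Comp.ret_bind, Comp.erase_ret, Comp.erase_rand, Comp.erase_query,
    Comp.bind_assoc, Val.fst_pair, Val.snd_pair, Comp.rand_bind, Comp.query_bind] at hlift ⊢
  refine ((Code.runs_range κ).le n).bind_of_ret ?_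
  refine (h₁.le n).bind_of_ret ⟨_, rfl, fun b => ?_⟩
  simp only [Comp.erase_tick, Comp.erase_bind, Comp.tick_bind, Comp.ret_bind, Comp.erase_ret,
    Comp.erase_rand, Comp.bind_assoc, Val.fst_pair, Val.snd_pair, Comp.rand_bind]
  refine (h₂.le n).bind_of_ret ⟨_, rfl, fun j => ?_⟩
  simp only [Comp.erase_tick, Comp.erase_bind, Comp.tick_bind, Comp.ret_bind, Comp.erase_ret,
    Comp.erase_rand, Comp.bind_assoc, Val.fst_pair, Val.snd_pair, Comp.rand_bind]
  refine (h₃.le n).bind_of_ret ⟨_, rfl, fun D => ?_⟩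
  simp only [Comp.erase_tick, Comp.erase_bind, Comp.tick_bind, Comp.ret_bind, Comp.erase_ret,
    Comp.erase_rand, Comp.bind_assoc, Val.fst_pair, Val.snd_pair, Comp.rand_bind]
  refine ((hS b j D (Nat.lt_succ_iff.1 b.2) (Nat.lt_succ_iff.1 j.2)
    (Nat.lt_succ_iff.1 D.2)).le n).bind_of_ret ?_
  refine (hlift _).bind_map fun r => ?_
  have := (hO (r.2, decide (r.1.toNat = 1))).le n
  rw [rep_prod, rep_decide] at this
  exact this

set_option maxHeartbeats 1000000 in
/-- A bound for the time that the simulation takes. -/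
theorem mainCode_wp {M : Simulator} {A : PPT} {κ n : ℕ} {c₁ c₂ c₃ cS h cO : Code}
    {U t₁ t₂ t₃ tS E C T tO : ℕ}
    (hU : sz (List.range κ) ≤ U)
    (h₁ : sz (M.bound₁ (List.range κ)) ≤ t₁ ∧
      c₁.Runs (rep (List.range κ)) (rep (M.bound₁ (List.range κ))) t₁)
    (h₂ : sz (M.bound₂ (List.range κ)) ≤ t₂ ∧
      c₂.Runs (rep (List.range κ)) (rep (M.bound₂ (List.range κ))) t₂)
    (h₃ : sz (M.bound₃ (List.range κ)) ≤ t₃ ∧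
      c₃.Runs (rep (List.range κ)) (rep (M.bound₃ (List.range κ))) t₃)
    (hS : ∀ b j D : ℕ, b ≤ M.bound₁ (List.range κ) → j ≤ M.bound₂ (List.range κ) →
      D ≤ M.bound₃ (List.range κ) → cS.Runs (rep (List.range κ, b, j, D))
        (.pair (rep (((List.range κ, b, j, D), []) : SimState))
          (.pair (.num κ) (M.start (List.range κ)))) tS)
    (hT : A.time.eval κ = T)
    (hh : ∀ (s : SimState) (m : Val) (r : ℕ), s.1.1 = List.range κ → m.size ≤ T →
      sz s ≤ 10 + U + t₁ + t₂ + t₃ + T * (E + 2) →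
      (h.eval n (.pair (rep s) m)).WP (C + r) fun a b =>
        ∃ (e : Entry) (v : Val), a = .pair (rep ((s.1, e :: s.2) : SimState)) v ∧
          sz e ≤ m.size + E ∧ r ≤ b)
    (hO : ∀ x : SimState × Bool, sz x ≤ 13 + U + t₁ + t₂ + t₃ + T * (E + 2) →
      cO.Runs (rep x) (rep (M.out x)) tO)
    (hn : 100 + (κ + 1) * 41 + 2 * (t₁ + t₂ + t₃) + tS + (C + 60) * T + tO ≤ n) (v : Val) :
    ((mainCode c₁ c₂ c₃ cS h A.code cO).eval n (.pair (.num κ) v)).Within n := by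
  have hle : ∀ {a b t : ℕ}, a ≤ b → sz b ≤ t → sz a ≤ t := fun h h' => by
    refine le_trans ?_ h'
    simpa only [sz_nat] using Nat.add_le_add_left (Nat.size_le_size h) 1
  have hTn : T ≤ n := by nlinarith
  rw [Comp.within_iff]
  have h₀ := Code.runs_range κ
  simp only [mainCode, drawCode]
  generalize Code.range = cR at h₀ ⊢
  simp only [Code.eval, Comp.wp_bind, Comp.WP, Val.fst_pair, Val.snd_pair]
  repeat (refine And.intro (by omega) ?_)
  refine h₀.wp_of (by omega) (by omega) fun b₁ hb₁ => ?_
  repeat (refine And.intro (by omega) ?_)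
  refine h₁.2.wp_of (by omega) (by omega) fun b₂ hb₂ => ?_
  have h₁' : 1 + Nat.size (rep (M.bound₁ (List.range κ))).toNat ≤ t₁ := h₁.1
  refine And.intro (by omega) fun b => ?_
  repeat (refine And.intro (by omega) ?_)
  refine h₂.2.wp_of (by omega) (by omega) fun b₃ hb₃ => ?_
  have h₂' : 1 + Nat.size (rep (M.bound₂ (List.range κ))).toNat ≤ t₂ := h₂.1
  refine And.intro (by omega) fun j => ?_
  repeat (refine And.intro (by omega) ?_)
  refine h₃.2.wp_of (by omega) (by omega) fun b₄ hb₄ => ?_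
  have h₃' : 1 + Nat.size (rep (M.bound₃ (List.range κ))).toNat ≤ t₃ := h₃.1
  refine And.intro (by omega) fun D => ?_
  have hb := Nat.lt_succ_iff.1 b.2
  have hj := Nat.lt_succ_iff.1 j.2
  have hD := Nat.lt_succ_iff.1 D.2
  refine And.intro (by omega) ?_
  refine (hS b j D hb hj hD).wp_of (by omega) (by omega) fun b₅ hb₅ => ?_
  refine And.intro (by omega) ?_
  have hsz : sz (((List.range κ, (b : ℕ), (j : ℕ), (D : ℕ)), []) : SimState) ≤
      10 + U + t₁ + t₂ + t₃ := by
    have := hle hb h₁.1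
    have := hle hj h₂.1
    have := hle hD h₃.1
    simp only [sz_prod (β := List Entry), sz_prod (β := ℕ × ℕ × ℕ), sz_prod (β := ℕ × ℕ),
      sz_prod (β := ℕ), sz_nil]
    omega
  let Inv : ℕ → Val → Prop := fun t σ => ∃ s : SimState, σ = rep s ∧ s.1.1 = List.range κ ∧ t ≤ T ∧
    sz s ≤ 10 + U + t₁ + t₂ + t₃ + (T - t) * (E + 2)
  have hInv : ∀ t (s : SimState), sz s ≤ 10 + U + t₁ + t₂ + t₃ + (T - t) * (E + 2) →
      sz s ≤ 10 + U + t₁ + t₂ + t₃ + T * (E + 2) := fun t s h =>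
    h.trans (Nat.add_le_add_left (Nat.mul_le_mul_right _ (Nat.sub_le _ _)) _)
  have hl := Code.lift_wp (h := h) (n := n) (K := C + 60) (by omega) (Inv := Inv)
    (by
      rintro t σ m r hm ⟨s, rfl, hs, ht, hsz⟩
      rw [show C + 60 + r = C + (60 + r) by omega]
      refine (hh s m _ hs (by omega) (hInv t s hsz)).imp ?_
      rintro a b - ⟨e, v, rfl, he, hb⟩
      refine ⟨_, v, rfl, ⟨(s.1, e :: s.2), rfl, hs, by omega, ?_⟩, by omega⟩
      have h1 : sz ((s.1, e :: s.2) : SimState) = sz s + 1 + sz e := by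
        simp only [sz_prod (β := List Entry), sz_cons]
        omega
      rw [h1, show T - (t - (1 + m.size)) = (T - t) + (1 + m.size) by omega, Nat.add_mul]
      nlinarith)
    (by
      rintro t t' σ h ⟨s, rfl, hs, ht, hsz⟩
      exact ⟨s, rfl, hs, h.trans ht, hsz.trans (Nat.add_le_add_left
        (Nat.mul_le_mul_right _ (by omega)) _)⟩)
    (n₀ := T) hTn A.code
  have hA := (Comp.within_iff _ _).1 (A.within κ (M.start (List.range κ)))
  rw [hT] at hA
  refine hl.bind (s := tO + 20) hA ⟨_, rfl, rfl, le_rfl, by simpa using hsz⟩ (by omega) ?_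
  rintro σ' a t' b' ⟨s, rfl, hs, ht, hsz'⟩ hb' -
  simp only [Val.fst_pair, Val.snd_pair]
  repeat (refine And.intro (by omega) ?_)
  have hO' := hO (s, decide (a.toNat = 1)) (by
    have := hInv t' s hsz'
    have := sz_bool_le (decide (a.toNat = 1))
    simp only [sz_prod (β := Bool)]
    omega)
  rw [rep_prod, rep_decide] at hO'
  exact hO'.wp_of (by omega) (by omega) fun _ _ => trivial

end Simulator

namespace Simulator

variable {M : Simulator}

/-- The step from the state, the message, the drawn number and the reversed answer of the oracle to
the next state and the reply. -/
theorem Efficient.poly_update (hM : M.Efficient) :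
    Poly fun x : ((SimState × Val) × ℕ) × List ℕ =>
      (((x.1.1.1.1, M.entry x.1.1.1 x.1.1.2 x.1.2 x.2.reverse :: x.1.1.1.2) : SimState),
        M.ans (x.1.1.1, x.1.1.2, M.entry x.1.1.1 x.1.1.2 x.1.2 x.2.reverse)) := by
  have h₁ := hM.flag
  have h₂ := hM.ans
  have he : Poly fun x : ((SimState × Val) × ℕ) × List ℕ =>
      M.entry x.1.1.1 x.1.1.2 x.1.2 x.2.reverse := by
    unfold entry
    exact ((Poly.fst (Poly.fst .id)).snd.mk (h₁.comp (Poly.fst (Poly.fst .id)))).mk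
      ((Poly.reverse (Poly.snd .id)).mk (Poly.fst .id).snd)
  have hs : Poly fun x : ((SimState × Val) × ℕ) × List ℕ => x.1.1.1 := by fun_prop
  have hm : Poly fun x : ((SimState × Val) × ℕ) × List ℕ => x.1.1.2 := by fun_prop
  exact (hs.fst.mk (he.cons hs.snd)).mk (h₂.comp (hs.mk (hm.mk he)))

/-- An efficient simulator is a probabilistic polynomial-time algorithm. -/
theorem Efficient.exists_ppt (hM : M.Efficient) (A : PPT) :
    ∃ B : PPT, ∀ κ v, (M.comp A κ).erase = (B.comp κ v).erase := by
  obtain ⟨c₁, p₁, h₁⟩ := hM.bound₁.exists_code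
  obtain ⟨c₂, p₂, h₂⟩ := hM.bound₂.exists_code
  obtain ⟨c₃, p₃, h₃⟩ := hM.bound₃.exists_code
  obtain ⟨cB, pB, hB⟩ := hM.bound.exists_code
  obtain ⟨cL, pL, hL⟩ := hM.label.exists_code
  obtain ⟨cQ, pQ, hQ⟩ := (hM.modulus.mk hM.width).exists_code
  obtain ⟨cU, pU, hU⟩ := hM.poly_update.exists_code
  obtain ⟨cO, pO, hO⟩ := hM.out.exists_code
  have hstart : Poly fun x : List ℕ × ℕ × ℕ × ℕ =>
      (((x, []) : SimState), (x.1.length, M.start x.1)) :=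
    (Poly.mk .id (.const [])).mk ((Poly.length (Poly.fst .id)).mk (hM.start.comp (Poly.fst .id)))
  obtain ⟨cS, pS, hS⟩ := hstart.exists_code
  -- Bounds for the sizes and times that occur, as functions of the security parameter.
  let T : ℕ → ℕ := fun κ => A.time.eval κ
  let U : ℕ → ℕ := fun κ => 1 + κ * (2 + κ)
  let t₁ : ℕ → ℕ := fun κ => p₁.eval (U κ)
  let t₂ : ℕ → ℕ := fun κ => p₂.eval (U κ)
  let t₃ : ℕ → ℕ := fun κ => p₃.eval (U κ)
  let B₁ : ℕ → ℕ := fun κ => 4 + pB.eval (U κ)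
  let Q₁ : ℕ → ℕ := fun κ => 4 + pQ.eval (U κ)
  let E : ℕ → ℕ := fun κ => 10 + (1 + Q₁ κ * (1 + Q₁ κ)) + B₁ κ
  let S : ℕ → ℕ := fun κ => 10 + U κ + t₁ κ + t₂ κ + t₃ κ + T κ * (E κ + 2)
  let L₁ : ℕ → ℕ := fun κ => pL.eval (T κ)
  let N : ℕ → ℕ := fun κ => 3 + (S κ + T κ) + B₁ κ + (1 + Q₁ κ * (1 + Q₁ κ))
  let U₁ : ℕ → ℕ := fun κ => pU.eval (N κ)
  let C : ℕ → ℕ := fun κ => 100 + 2 * B₁ κ + 2 * L₁ κ + Q₁ κ + (Q₁ κ + 1) * 201 + U₁ κ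
  let tS : ℕ → ℕ := fun κ => pS.eval (10 + U κ + t₁ κ + t₂ κ + t₃ κ)
  let tO : ℕ → ℕ := fun κ => pO.eval (3 + S κ)
  let F : ℕ → ℕ := fun κ => 100 + (κ + 1) * 41 + 2 * (t₁ κ + t₂ κ + t₃ κ) + tS κ +
    (C κ + 60) * T κ + tO κ
  obtain ⟨p, hp⟩ : PolyIn (fun κ : ℕ => κ) F := by
    have k : ∀ n, PolyIn (fun κ : ℕ => κ) fun _ => n := .const
    have hself : PolyIn (fun κ : ℕ => κ) fun κ => κ := .self
    have hT : PolyIn (fun κ : ℕ => κ) T := hself.eval _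
    have hU : PolyIn (fun κ : ℕ => κ) U := (k 1).add (hself.mul ((k 2).add hself))
    have h1 : PolyIn (fun κ : ℕ => κ) t₁ := hU.eval _
    have h2 : PolyIn (fun κ : ℕ => κ) t₂ := hU.eval _
    have h3 : PolyIn (fun κ : ℕ => κ) t₃ := hU.eval _
    have hB : PolyIn (fun κ : ℕ => κ) B₁ := (k 4).add (hU.eval _)
    have hQ : PolyIn (fun κ : ℕ => κ) Q₁ := (k 4).add (hU.eval _)
    have hQ' := (k 1).add (hQ.mul ((k 1).add hQ))
    have hE : PolyIn (fun κ : ℕ => κ) E := ((k 10).add hQ').add hB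
    have hD := ((((k 10).add hU).add h1).add h2).add h3
    have hS : PolyIn (fun κ : ℕ => κ) S := hD.add (hT.mul (hE.add (k 2)))
    have hL : PolyIn (fun κ : ℕ => κ) L₁ := hT.eval _
    have hN : PolyIn (fun κ : ℕ => κ) N := (((k 3).add (hS.add hT)).add hB).add hQ'
    have hU₁ : PolyIn (fun κ : ℕ => κ) U₁ := hN.eval _
    have hC : PolyIn (fun κ : ℕ => κ) C := (((((k 100).add ((k 2).mul hB)).add
      ((k 2).mul hL)).add hQ).add ((hQ.add (k 1)).mul (k 201))).add hU₁
    have htS : PolyIn (fun κ : ℕ => κ) tS := hD.eval _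
    have htO : PolyIn (fun κ : ℕ => κ) tO := ((k 3).add hS).eval _
    exact (((((k 100).add ((hself.add (k 1)).mul (k 41))).add
      ((k 2).mul ((h1.add h2).add h3))).add htS).add ((hC.add (k 60)).mul hT)).add htO
  have hu : ∀ κ, sz (List.range κ) ≤ U κ := sz_range_le
  have hBs : ∀ (s : SimState) (V : ℕ), sz s.1.1 ≤ V → sz (M.bound s.1.1) ≤ 4 + pB.eval V ∧
      (Code.seq .fst (.seq .fst cB)).Runs (rep s) (rep (M.bound s.1.1)) (4 + pB.eval V) := by
    intro s V hV
    refine ⟨(hB _ V hV).1.trans (Nat.le_add_left _ _), ?_⟩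
    exact ((Code.runs_fst _).seq ((Code.runs_fst _).seq (hB _ V hV).2)).mono (by omega)
  have hQs : ∀ (s : SimState) (V : ℕ), sz s.1.1 ≤ V →
      sz (M.modulus s.1.1, M.width s.1.1) ≤ 4 + pQ.eval V ∧
      (Code.seq .fst (.seq .fst cQ)).Runs (rep s) (rep (M.modulus s.1.1, M.width s.1.1))
        (4 + pQ.eval V) := by
    intro s V hV
    refine ⟨(hQ _ V hV).1.trans (Nat.le_add_left _ _), ?_⟩
    exact ((Code.runs_fst _).seq ((Code.runs_fst _).seq (hQ _ V hV).2)).mono (by omega)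
  have hle : ∀ {a b t : ℕ}, a ≤ b → sz b ≤ t → sz a ≤ t := fun h h' => by
    refine le_trans ?_ h'
    simpa only [sz_nat] using Nat.add_le_add_left (Nat.size_le_size h) 1
  have hSs : ∀ κ b j D : ℕ, b ≤ M.bound₁ (List.range κ) → j ≤ M.bound₂ (List.range κ) →
      D ≤ M.bound₃ (List.range κ) → cS.Runs (rep (List.range κ, b, j, D))
        (.pair (rep (((List.range κ, b, j, D), []) : SimState))
          (.pair (.num κ) (M.start (List.range κ)))) (tS κ) := by
    intro κ b j D hb hj hD
    have h := (hS (List.range κ, b, j, D) (10 + U κ + t₁ κ + t₂ κ + t₃ κ) (by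
      have := hle hb (h₁ _ _ (hu κ)).1
      have := hle hj (h₂ _ _ (hu κ)).1
      have := hle hD (h₃ _ _ (hu κ)).1
      have := hu κ
      simp only [sz_prod (β := ℕ × ℕ × ℕ), sz_prod (β := ℕ × ℕ), sz_prod (β := ℕ), t₁, t₂, t₃] at *
      omega)).2
    rw [List.length_range] at h
    exact h
  have hrun : ∀ κ v, ((mainCode c₁ c₂ c₃ cS (handlerCode (.seq .fst (.seq .fst cB)) cL
      (.seq .fst (.seq .fst cQ)) cU) A.code cO).eval (p.eval κ) (.pair (.num κ) v)).Within
        (p.eval κ) := by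
    intro κ v
    refine mainCode_wp (hu κ) (h₁ _ _ (hu κ)) (h₂ _ _ (hu κ)) (h₃ _ _ (hu κ)) (hSs κ)
      (E := E κ) (C := C κ) (T := T κ) (tO := tO κ) rfl ?_ ?_ (hp κ) v
    · intro s m r hs hm hsz
      have hV : sz s.1.1 ≤ U κ := by rw [hs]; exact hu κ
      have hn : C κ ≤ p.eval κ ∨ T κ = 0 := by
        rcases Nat.eq_zero_or_pos (T κ) with h | h
        · exact .inr h
        · refine .inl (le_trans ?_ (hp κ))
          have : C κ ≤ (C κ + 60) * T κ := by nlinarith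
          simp only [F]
          omega
      rcases hn with hn | h0
      · refine (handlerCode_wp (M := M) (N₀ := S κ + T κ) (N := N κ) (hBs s _ hV)
          (hL m (T κ) hm) (hQs s _ hV) (fun x hx => (hU x _ hx).2) (Nat.add_le_add hsz hm)
          le_rfl hn r).imp ?_
        rintro a b - ⟨e, v, rfl, he, hb⟩
        refine ⟨e, v, rfl, he.trans ?_, hb⟩
        simp only [E, B₁, Q₁]
        omega
      · cases m <;> simp only [Val.size] at hm <;> omega
    · intro x hx
      refine (hO x _ (hx.trans ?_)).2
      have : 13 + U κ + t₁ κ + t₂ κ + t₃ κ + T κ * (E κ + 2) = 3 + S κ := by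
        simp only [S]
        omega
      exact this.le
  refine ⟨⟨_, p, hrun⟩, fun κ v => ?_⟩
  refine Comp.Le.eq_of_noFail (mainCode_le (h₁ _ _ (hu κ)).2 (h₂ _ _ (hu κ)).2
    (h₃ _ _ (hu κ)).2 (hSs κ) ?_ (fun x => (hO x _ le_rfl).2) v) ?_
  · exact fun s m => handlerCode_le (fun s => (hBs s _ le_rfl).2)
      (fun m => (hL m _ le_rfl).2) (fun s => (hQs s _ le_rfl).2) (fun x => (hU x _ le_rfl).2) _ s m
  · exact ((Comp.within_iff _ _).1 (hrun κ v)).noFail.erase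

end Simulator

/-! ### The ingredients of the scheme in polynomial time -/

theorem Label.code_ofCode (n : ℕ) : (Label.ofCode n).code = n := by
  have h : ∀ w : List Bool, (w ++ [true]).foldr Nat.bit 0 = w.foldr Nat.bit 1 := by
    intro w
    simp [List.foldr_append]
  have hb : ∀ n : ℕ, n ≠ 0 → n.bits.dropLast ++ [true] = n.bits := by
    intro n
    induction n using Nat.binaryRec' with
    | zero => simp
    | bit b n hn ih =>
      intro _
      rw [Nat.bits_append_bit _ _ hn]
      rcases eq_or_ne n 0 with rfl | h0
      · simp [hn rfl]
      · have : n.bits ≠ [] := by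
          intro h'
          have := ih h0
          rw [h'] at this
          simp at this
        rw [List.dropLast_cons_of_ne_nil this, List.cons_append, ih h0]
  have hf : ∀ n : ℕ, n.bits.foldr Nat.bit 0 = n := by
    intro n
    induction n using Nat.binaryRec' with
    | zero => simp
    | bit b n hn ih => rw [Nat.bits_append_bit _ _ hn, List.foldr_cons, ih]
  unfold Label.ofCode
  split_ifs with h0
  · simp [Label.code, h0]
  · simp only [Label.code]
    rw [← h, hb n h0, hf]

/-- A function that is computable in time polynomial in a parameter `len` is computable in time
polynomial in the size of its input, if the parameter and the size of the value are polynomial in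
that size. -/
theorem PolyTimeFun.poly {D α β : Type} [Rep α] [Rep β] {len : D → ℕ} {inp out : D → Val}
    (h : PolyTimeFun len inp out) {d : α → D} {f : α → β} (hin : Poly fun a => inp (d a))
    (hlen : PolyIn sz fun a => len (d a)) (hout : ∀ a, rep (f a) = out (d a))
    (hf : PolyIn sz fun a => sz (f a)) : Poly f := by
  obtain ⟨c, p, h⟩ := h
  obtain ⟨c', T, hT, h'⟩ := hin
  refine ⟨.seq c' c, fun a => 1 + T a + p.eval (len (d a)) + sz (f a),
    (((PolyIn.const 1).add hT).add (hlen.eval p)).add hf, fun a => ⟨Nat.le_add_left _ _, ?_⟩⟩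
  rw [hout]
  exact ((h' a).2.seq (Code.runs_of_returnsIn (h (d a)))).mono (Nat.le_add_right _ _)

namespace Params

variable (P : Params)

/-- The value of the keyed function for the key with number `k` and the label with number `l`. -/
def prfList (κ k l : ℕ) : List ℕ :=
  List.ofFn fun t => (P.prf κ (BitVec.ofNat κ k) (Label.ofCode l) t).val

variable {P} {α : Type} [Rep α] {u : α → List ℕ}

theorem Efficient.poly_q (hP : P.Efficient) (hu : Poly u) : Poly fun a => P.q (u a).length := by
  obtain ⟨p, hp⟩ := hP.size_q_le
  have hlen : PolyIn sz fun a => (u a).length := hu.polyIn.of_le fun _ => length_le_sz _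
  exact hP.q_poly.poly (d := fun a => (u a).length) hu.length.valNum hlen (fun _ => rfl)
    (((PolyIn.const 1).add (hlen.eval p)).of_le fun _ => Nat.add_le_add_left (hp _) 1)

theorem Efficient.polyIn_nmax (hP : P.Efficient) (hu : Poly u) :
    PolyIn sz fun a => P.nmax (u a).length := by
  obtain ⟨p, hp⟩ := hP.nmax_le
  exact ((hu.polyIn.of_le fun _ => length_le_sz _).eval p).of_le fun _ => hp _

theorem Efficient.polyIn_mmax (hP : P.Efficient) (hu : Poly u) :
    PolyIn sz fun a => P.mmax (u a).length := by
  obtain ⟨p, hp⟩ := hP.mmax_le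
  exact ((hu.polyIn.of_le fun _ => length_le_sz _).eval p).of_le fun _ => hp _

theorem Efficient.poly_nmax (hP : P.Efficient) (hu : Poly u) :
    Poly fun a => P.nmax (u a).length :=
  hP.nmax_poly.poly (d := fun a => (u a).length) hu.length.valNum
    (hu.polyIn.of_le fun _ => length_le_sz _) (fun _ => rfl)
    (((PolyIn.const 1).add (hP.polyIn_nmax hu)).of_le fun _ =>
      Nat.add_le_add_left (size_le_self _) 1)

theorem Efficient.poly_mmax (hP : P.Efficient) (hu : Poly u) :
    Poly fun a => P.mmax (u a).length :=
  hP.mmax_poly.poly (d := fun a => (u a).length) hu.length.valNum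
    (hu.polyIn.of_le fun _ => length_le_sz _) (fun _ => rfl)
    (((PolyIn.const 1).add (hP.polyIn_mmax hu)).of_le fun _ =>
      Nat.add_le_add_left (size_le_self _) 1)

theorem Efficient.poly_range_nmax (hP : P.Efficient) (hu : Poly u) :
    Poly fun a => List.range (P.nmax (u a).length) :=
  (hP.poly_nmax hu).range (hP.polyIn_nmax hu)

theorem Efficient.poly_range_mmax (hP : P.Efficient) (hu : Poly u) :
    Poly fun a => List.range (P.mmax (u a).length) :=
  (hP.poly_mmax hu).range (hP.polyIn_mmax hu)

theorem Efficient.poly_range_len (hP : P.Efficient) (hu : Poly u) {l : α → ℕ} (hl : Poly l) :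
    Poly fun a => List.range (P.len (u a).length (Label.ofCode (l a))) := by
  have hB : PolyIn sz fun a => P.len (u a).length (Label.ofCode (l a)) :=
    (hP.polyIn_mmax hu).of_le fun _ => P.len_le _ _
  refine Poly.range (hP.len_poly.poly (d := fun a => ((u a).length, Label.ofCode (l a))) ?_ ?_
    (fun _ => rfl) (((PolyIn.const 1).add hB).of_le fun _ =>
      Nat.add_le_add_left (size_le_self _) 1)) hB
  · simp only [Label.code_ofCode]
    exact hu.length.valNum.valPair hl.valNum
  · simp only [Label.code_ofCode]
    exact (hu.polyIn.of_le fun _ => length_le_sz _).add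
      (hl.polyIn.of_le fun a => Nat.le_add_left _ 1)

theorem Efficient.poly_prfList (hP : P.Efficient) (hu : Poly u) {k l : α → ℕ} (hk : Poly k)
    (hl : Poly l) : Poly fun a => P.prfList (u a).length (k a) (l a) := by
  obtain ⟨p, hp⟩ := hP.size_q_le
  have hlen : PolyIn sz fun a => (u a).length := hu.polyIn.of_le fun _ => length_le_sz _
  refine hP.prf_poly.poly
    (d := fun a => ⟨(u a).length, BitVec.ofNat _ (k a), Label.ofCode (l a)⟩) ?_ ?_ ?_ ?_
  · simp only [Label.code_ofCode, BitVec.toNat_ofNat, Val.ofList]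
    exact hu.length.valNum.valPair
      ((hk.mod ((Poly.const 2).pow hu)).valNum.valPair (hl.valNum.valPair (.const _)))
  · simp only [Label.code_ofCode]
    exact hlen.add (hl.polyIn.of_le fun a => Nat.le_add_left _ 1)
  · intro a
    change Val.ofList _ = Val.ofList _
    rw [prfList, List.map_ofFn]
    rfl
  · refine ((PolyIn.const 1).add ((hP.polyIn_mmax hu).mul ((PolyIn.const 1).add
      ((PolyIn.const 1).add (hlen.eval p))))).of_le fun a => ?_
    refine (sz_le_of_forall (B := 1 + p.eval (u a).length) fun c hc => ?_).trans ?_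
    · obtain ⟨t, rfl⟩ := List.mem_ofFn.1 hc
      exact Nat.add_le_add_left ((Nat.size_le_size (ZMod.val_lt _).le).trans (hp _)) 1
    · simp [prfList]

end Params

/-! ### The reduction -/

/-- The oldest entry for the label with number `l`. -/
def oldest (es : List Entry) (l : ℕ) : Entry :=
  es.foldl (fun r e => if labelCode e.1.1 = l then e else r) ((.num 0, false), [], 0)

theorem poly_oldest {α : Type} [Rep α] {es : α → List Entry} {l : α → ℕ} (hes : Poly es)
    (hl : Poly l) : Poly fun a => oldest (es a) (l a) := by
  unfold oldest
  have he : Poly fun x : α × Entry × Entry => x.2.2 := by fun_prop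
  refine Poly.foldl hes (.const _) (.ite (.natEq (poly_labelCode.comp he.fst.fst)
    (hl.comp (.fst .id))) he (.fst (.snd .id))) ⟨fun a => 10 + sz (es a),
    (PolyIn.const 10).add hes.polyIn, fun a l' hl' => ?_⟩
  have key : ∀ (l' : List Entry) (r : Entry), (∀ e ∈ l', sz e ≤ 10 + sz (es a)) →
      sz r ≤ 10 + sz (es a) →
      sz (l'.foldl (fun r e => if labelCode e.1.1 = l a then e else r) r) ≤ 10 + sz (es a) := by
    intro l'
    induction l' with
    | nil => exact fun r _ hr => hr
    | cons e l' ih =>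
      intro r he hr
      refine ih _ (fun e he' => he e (List.mem_cons_of_mem _ he')) ?_
      beta_reduce
      split_ifs
      · exact he e List.mem_cons_self
      · exact hr
  refine key l' _ (fun e he => ?_) ?_
  · have := sz_le_of_mem (hl'.subset he)
    omega
  · have := one_le_sz (es a)
    simp only [sz_prod (β := List ℕ × ℕ), sz_prod (β := ℕ), sz_prod (β := Bool), sz_nil]
    have : sz (Val.num 0) = 1 := by simp [sz, Val.size]
    have := sz_bool_le false
    have : sz 0 = 1 := by simp [sz_nat]
    omega

namespace Params

variable (P : Params)

/-- The messages in a list of entries, with their flags. -/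
def messages (es : List Entry) : List (Val × Bool) := es.map fun e => e.1

/-- The number of the key of the client `i`. There are two candidates, which are both digits of
`D`; the one with `c = 0` is used if the client is corrupted, and the one with `c = 1` if it is
honest. -/
def keyNumber (κ D c i : ℕ) : ℕ := (digits (2 ^ κ) D (P.nmax κ * 2)).getD (c + 2 * i) 0

/-- The entry with index `t` of the pad of the client `i` for the label with number `l`, if `s` are
the messages, `j` is the position of the hybrid, `D` encodes the keys, `z` is the vector received
from the oracle for the label `l`, and `d` encodes the random vectors for this label. -/
def simPad (κ j D : ℕ) (s : List (Val × Bool)) (z : List ℕ) (d l i t : ℕ) : ℕ :=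
  if isCor s i = true then (P.prfList κ (P.keyNumber κ D 0 i) l).getD t 0
  else if i < j then (digits (P.q κ) d (P.nmax κ * P.mmax κ)).getD (t + P.mmax κ * i) 0
  else if i = j then z.getD t 0
  else (P.prfList κ (P.keyNumber κ D 1 i) l).getD t 0

/-- The reduction to the security of the keyed function. It draws the challenge bit `β`, the
position `j` of the hybrid, and keys for all clients. The honest clients before `j` get random
pads, the client `j` gets its pads from the oracle, and the other ones are treated as in the
scheme. A bound `k - 1` stands for the uniform distribution on `k` elements; if there are no clients,
the truncated subtraction has no effect, as then the adversary has advantage zero anyway. In the end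
the reduction outputs whether the adversary wins, or the negation of this if `β = 1`. -/
def reduction : Simulator where
  bound₁ _ := 1
  bound₂ u := P.nmax u.length - 1
  bound₃ u := (2 ^ u.length) ^ (P.nmax u.length * 2) - 1
  start u := .ofList [.num (P.q u.length), .num (P.mmax u.length), .num (P.nmax u.length)]
  bound u := P.q u.length ^ (P.nmax u.length * P.mmax u.length) - 1
  label := labelCode
  modulus u := P.q u.length
  width u := List.range (P.mmax u.length)
  flag x := accepted (P.nmax x.1.1.1.length) (messages x.1.2) x.2
  ans x := if x.2.2.1.2 = true then
      reply (P.q x.1.1.1.length) (P.nmax x.1.1.1.length)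
        (P.len x.1.1.1.length (Label.ofCode (labelCode x.2.1))) x.1.1.2.1
        (P.keyNumber x.1.1.1.length x.1.1.2.2.2 0)
        (P.simPad x.1.1.1.length x.1.1.2.2.1 x.1.1.2.2.2 (messages x.1.2)
          (oldest (x.2.2 :: x.1.2) (labelCode x.2.1)).2.1
          (oldest (x.2.2 :: x.1.2) (labelCode x.2.1)).2.2 (labelCode x.2.1)) x.2.1
    else ignored
  out x :=
    let r := x.2 && (messages x.1.2).all fun e => admissibleAt (P.q x.1.1.1.length)
      (P.nmax x.1.1.1.length) (P.len x.1.1.1.length (Label.ofCode (labelCode e.1)))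
      (messages x.1.2) e
    if x.1.1.2.1 = 0 then r else !r

variable {P} {α : Type} [Rep α] {u : α → List ℕ}

theorem Efficient.poly_keyNumber (hP : P.Efficient) (hu : Poly u) {D c i : α → ℕ} (hD : Poly D)
    (hc : Poly c) (hi : Poly i) :
    Poly fun a => P.keyNumber (u a).length (D a) (c a) (i a) := by
  have hr : Poly fun a => List.range (P.nmax (u a).length * 2) :=
    ((hP.poly_nmax hu).mul (.const 2)).range ((hP.polyIn_nmax hu).mul (.const 2))
  have := (Poly.digits ((Poly.const 2).pow hu) hD hr).getD (hc.add ((Poly.const 2).mul hi))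
    (.const 0)
  simp only [List.length_range] at this
  exact this

theorem Efficient.poly_simPad (hP : P.Efficient) (hu : Poly u) {j D d l i t : α → ℕ}
    {s : α → List (Val × Bool)} {z : α → List ℕ} (hj : Poly j) (hD : Poly D) (hs : Poly s)
    (hz : Poly z) (hd : Poly d) (hl : Poly l) (hi : Poly i) (ht : Poly t) :
    Poly fun a => P.simPad (u a).length (j a) (D a) (s a) (z a) (d a) (l a) (i a) (t a) := by
  have hr : Poly fun a => List.range (P.nmax (u a).length * P.mmax (u a).length) :=
    ((hP.poly_nmax hu).mul (hP.poly_mmax hu)).range ((hP.polyIn_nmax hu).mul (hP.polyIn_mmax hu))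
  have h₁ := (Poly.digits (hP.poly_q hu) hd hr).getD (ht.add ((hP.poly_mmax hu).mul hi)) (.const 0)
  simp only [List.length_range] at h₁
  have h₂ := fun c : ℕ => (hP.poly_prfList hu (hP.poly_keyNumber hu hD (.const c) hi) hl).getD ht
    (.const 0)
  exact Poly.ite (by simpa using poly_isCor hs hi) (h₂ 0) (.ite (.natLt hi hj) h₁
    (.ite (.natEq hi hj) (hz.getD ht (.const 0)) (h₂ 1)))

theorem Efficient.reduction (hP : P.Efficient) : P.reduction.Efficient where
  bound₁ := .const 1
  bound₂ := (hP.poly_nmax .id).sub (.const 1)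
  bound₃ := by
    have hr : Poly fun u : List ℕ => List.range (P.nmax u.length * 2) :=
      ((hP.poly_nmax .id).mul (.const 2)).range ((hP.polyIn_nmax .id).mul (.const 2))
    have := (((Poly.const 2).pow .id).pow hr).sub (.const 1)
    simp only [List.length_range] at this
    exact this
  start := (hP.poly_q .id).valNum.valPair ((hP.poly_mmax .id).valNum.valPair
    ((hP.poly_nmax .id).valNum.valPair (.const _)))
  bound := by
    have hr : Poly fun u : List ℕ => List.range (P.nmax u.length * P.mmax u.length) :=
      ((hP.poly_nmax .id).mul (hP.poly_mmax .id)).range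
        ((hP.polyIn_nmax .id).mul (hP.polyIn_mmax .id))
    have := ((hP.poly_q .id).pow hr).sub (.const 1)
    simp only [List.length_range] at this
    exact this
  label := poly_labelCode
  modulus := hP.poly_q .id
  width := hP.poly_range_mmax .id
  flag := poly_accepted (hP.poly_range_nmax (.fst (.fst (.fst .id))))
    ((Poly.snd (.fst .id)).map (.fst (.snd .id))) (.snd .id)
  ans := by
    have hx : Poly fun x : SimState × Val × Entry => x := .id
    have hm := hx.snd.fst
    have hs : Poly fun x : SimState × Val × Entry => messages x.1.2 :=
      hx.fst.snd.map (.fst (.snd .id))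
    have ho := poly_oldest (hx.snd.snd.cons hx.fst.snd) (poly_labelCode.comp hm)
    have hu := hx.fst.fst.fst
    refine .ite (by simpa using hx.snd.snd.fst.snd) (poly_reply (hP.poly_q hu)
      (hP.poly_range_nmax hu) (hP.poly_range_len hu (poly_labelCode.comp hm)) hx.fst.fst.snd.fst
      ?_ ?_ hm) (.const _)
    · exact hP.poly_keyNumber (hu.comp (.fst .id)) (hx.fst.fst.snd.snd.snd.comp (.fst .id))
        (.const 0) (.snd .id)
    · exact hP.poly_simPad (hu.comp (.fst .id)) (hx.fst.fst.snd.snd.fst.comp (.fst .id))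
        (hx.fst.fst.snd.snd.snd.comp (.fst .id)) (hs.comp (.fst .id))
        (ho.snd.fst.comp (.fst .id)) (ho.snd.snd.comp (.fst .id))
        ((poly_labelCode.comp hm).comp (.fst .id)) (.fst (.snd .id)) (.snd (.snd .id))
  out := by
    have hx : Poly fun x : SimState × Bool => x := .id
    have hs : Poly fun x : SimState × Bool => messages x.1.2 :=
      hx.fst.snd.map (.fst (.snd .id))
    have hu := hx.fst.fst.fst
    have he : Poly fun y : (SimState × Bool) × Val × Bool => y.2 := .snd .id
    have hr := hx.snd.and (hs.all (g := fun x e => admissibleAt (P.q x.1.1.1.length)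
      (P.nmax x.1.1.1.length) (P.len x.1.1.1.length (Label.ofCode (labelCode e.1)))
      (messages x.1.2) e) (poly_admissibleAt (hP.poly_q (hu.comp (.fst .id)))
        (hP.poly_range_nmax (hu.comp (.fst .id)))
        (hP.poly_range_len (hu.comp (.fst .id)) (poly_labelCode.comp he.fst))
        (hs.comp (.fst .id)) he))
    exact .ite (.natEq hx.fst.fst.snd.fst (.const 0)) hr hr.not

end Params

/-! ### Uniform distributions and lazy sampling -/

section Uniform

open PMF

variable {α β ι V : Type}

theorem uniform_map_equiv [Fintype α] [Nonempty α] [Fintype β] [Nonempty β] (e : α ≃ β) :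
    (uniformOfFintype α).map e = uniformOfFintype β := by
  ext b
  rw [PMF.map_apply, tsum_eq_single (e.symm b)]
  · simp [uniformOfFintype_apply, Fintype.card_congr e]
  · intro a ha
    rw [if_neg]
    rintro rfl
    simp at ha

theorem uniform_bind_equiv [Fintype α] [Nonempty α] [Fintype β] [Nonempty β] (e : α ≃ β)
    {γ : Type} (g : β → PMF γ) :
    (uniformOfFintype α).bind (fun a => g (e a)) = (uniformOfFintype β).bind g := by
  rw [← uniform_map_equiv e, PMF.bind_map]
  rfl

theorem uniform_prod [Fintype α] [Nonempty α] [Fintype β] [Nonempty β] {γ : Type}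
    (g : α × β → PMF γ) : (uniformOfFintype (α × β)).bind g =
      (uniformOfFintype α).bind fun a => (uniformOfFintype β).bind fun b => g (a, b) := by
  ext c
  simp only [PMF.bind_apply, tsum_fintype, uniformOfFintype_apply, Fintype.card_prod,
    Fintype.sum_prod_type, Finset.mul_sum, Nat.cast_mul]
  refine Finset.sum_congr rfl fun a _ => Finset.sum_congr rfl fun b _ => ?_
  rw [ENNReal.mul_inv (by simp) (by simp), mul_assoc]

/-- A uniform function stays uniform if one of its values is drawn again: exchanging the old value
and the new one is an involution. -/
theorem uniform_update [Fintype ι] [DecidableEq ι] [Fintype V] [Nonempty V] {γ : Type} (i : ι)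
    (g : (ι → V) → PMF γ) :
    (uniformOfFintype V).bind (fun v => (uniformOfFintype (ι → V)).bind fun R =>
      g (Function.update R i v)) = (uniformOfFintype (ι → V)).bind g := by
  let e : (ι → V) × V ≃ (ι → V) × V :=
    Function.Involutive.toPerm (fun x => (Function.update x.1 i x.2, x.1 i)) fun x => by simp
  have h := uniform_bind_equiv e fun x => g x.1
  rw [uniform_prod, uniform_prod] at h
  rw [PMF.bind_comm]
  refine h.trans ?_
  simp

theorem uniform_bind_apply [Fintype α] [Nonempty α] (g : α → PMF β) (b : β) :
    ((uniformOfFintype α).bind g b).toReal = (Fintype.card α : ℝ)⁻¹ * ∑ a, (g a b).toReal := by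
  simp only [PMF.bind_apply, tsum_fintype, uniformOfFintype_apply, ← Finset.mul_sum,
    ENNReal.toReal_mul, ENNReal.toReal_inv, ENNReal.toReal_natCast]
  rw [ENNReal.toReal_sum fun a _ => PMF.apply_ne_top _ _]

end Uniform

namespace Comp

variable {α σ τ ι V : Type}

/-- If the states of one oracle are images of the states of another one and the answers
correspond, then so do the executions. -/
theorem run_map {O₁ : σ → Val → PMF (Val × σ)} {O₂ : τ → Val → PMF (Val × τ)} {φ : σ → τ}
    {Inv : σ → Prop}
    (hO : ∀ s m, Inv s → O₂ (φ s) m = (O₁ s m).map fun r => (r.1, φ r.2))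
    (hI : ∀ s m, Inv s → ∀ r ∈ (O₁ s m).support, Inv r.2) (c : Comp α) (s : σ) (hs : Inv s) :
    c.run O₂ (φ s) = (c.run O₁ s).map fun r => (r.1, φ r.2) := by
  induction c generalizing s with
  | ret a => simp [run, PMF.pure_map]
  | fail => simp [run, PMF.pure_map]
  | tick n k ih => exact ih s hs
  | rand n k ih =>
    simp only [run, PMF.map_bind]
    congr 1
    funext i
    exact ih i s hs
  | query m k ih =>
    simp only [run, PMF.map_bind, hO s m hs, PMF.bind_map]
    ext x
    simp only [PMF.bind_apply]
    refine tsum_congr fun r => ?_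
    by_cases hr : r ∈ (O₁ s m).support
    · simp only [Function.comp_apply]
      rw [ih r.1 r.2 (hI s m hs r hr)]
    · rw [PMF.mem_support_iff, not_not] at hr
      simp [hr]

theorem run_invariant {O : σ → Val → PMF (Val × σ)} {Inv : σ → Prop}
    (hI : ∀ s m, Inv s → ∀ r ∈ (O s m).support, Inv r.2) (c : Comp α) (s : σ) (hs : Inv s) :
    ∀ r ∈ (c.run O s).support, Inv r.2 := by
  induction c generalizing s with
  | ret a => simp [run, hs]
  | fail => simp [run, hs]
  | tick n k ih => exact ih s hs
  | rand n k ih =>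
    intro r hr
    obtain ⟨i, -, hi⟩ := (PMF.mem_support_bind_iff _ _ _).1 hr
    exact ih i s hs r hi
  | query m k ih =>
    intro r hr
    obtain ⟨r', hr', h⟩ := (PMF.mem_support_bind_iff _ _ _).1 hr
    exact ih _ _ (hI s m hs r' hr') r h

/-- The probability of reaching the state `s'` does not change if the oracle is changed only in
steps after which `s'` cannot be reached any more. -/
theorem run_apply_congr {O₁ O₂ : σ → Val → PMF (Val × σ)} {P : σ → Prop}
    (hO : ∀ s m, (∃ r ∈ (O₁ s m).support ∪ (O₂ s m).support, P r.2) → O₁ s m = O₂ s m)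
    (hP : ∀ s m, ∀ r ∈ (O₁ s m).support ∪ (O₂ s m).support, P r.2 → P s)
    (c : Comp α) (s : σ) (a : Option α) (s' : σ) (hs' : P s') :
    c.run O₁ s (a, s') = c.run O₂ s (a, s') := by
  have back : ∀ O, (∀ s m, ∀ r ∈ (O s m).support, P r.2 → P s) → ∀ (c : Comp α) (s : σ),
      ¬ P s → c.run O s (a, s') = 0 := by
    intro O hO c s hs
    by_contra h
    exact (run_invariant (Inv := fun s => ¬ P s) (fun s m hs r hr hr' => hs (hO s m r hr hr'))
      c s hs _ ((PMF.mem_support_iff _ _).2 h)) hs'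
  induction c generalizing s with
  | ret a => rfl
  | fail => rfl
  | tick n k ih => exact ih s
  | rand n k ih => simp only [run, PMF.bind_apply, ih]
  | query m k ih =>
    simp only [run, PMF.bind_apply]
    by_cases h : ∃ r ∈ (O₁ s m).support ∪ (O₂ s m).support, P r.2
    · rw [hO s m h]
      exact tsum_congr fun r => by rw [ih]
    · push Not at h
      have h1 : ∀ r, O₁ s m r * (k r.1).run O₁ r.2 (a, s') = 0 := fun r => by
        by_cases hr : O₁ s m r = 0
        · rw [hr, zero_mul]
        · rw [back O₁ (fun s m r hr => hP s m r (.inl hr)) _ _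
            (h r (.inl ((PMF.mem_support_iff _ _).2 hr))), mul_zero]
      have h2 : ∀ r, O₂ s m r * (k r.1).run O₂ r.2 (a, s') = 0 := fun r => by
        by_cases hr : O₂ s m r = 0
        · rw [hr, zero_mul]
        · rw [back O₂ (fun s m r hr => hP s m r (.inr hr)) _ _
            (h r (.inr ((PMF.mem_support_iff _ _).2 hr))), mul_zero]
      simp only [h1, h2]

variable [Fintype V] [Inhabited V] [DecidableEq ι]

/-- The deterministic oracle that answers by `ans` and passes to the state `next`. -/
def detOracle (ans : σ → Val → Val) (next : σ → Val → σ) (s : σ) (m : Val) : PMF (Val × σ) :=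
  PMF.pure (ans s m, next s m)

/-- The oracle that answers by means of a random table, the entries of which are drawn when they
are needed; `need s m` is the place of the entry that is needed for the answer to `m`. -/
def lazyOracle (ans : (ι → V) → σ → Val → Val) (next : σ → Val → σ) (need : σ → Val → Option ι)
    (s : (ι → Option V) × σ) (m : Val) : PMF (Val × ((ι → Option V) × σ)) :=
  let reply (T : ι → Option V) := (ans (fun i => (T i).getD default) s.2 m, (T, next s.2 m))
  match need s.2 m with
  | none => PMF.pure (reply s.1)
  | some i =>
    match s.1 i with
    | some _ => PMF.pure (reply s.1)
    | none => (PMF.uniformOfFintype V).map fun v => reply (Function.update s.1 i (some v))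

/-- The table `T`, completed by `R` at the places in `J`. -/
def fill {J : Finset ι} (T : ι → Option V) (R : J → V) (i : ι) : V :=
  (T i).getD (if h : i ∈ J then R ⟨i, h⟩ else default)

/-- Lazy sampling amounts to drawing the table in advance, at all places that may be needed. Here
`dom s` contains the places that have been needed before the state `s` is reached. -/
theorem run_lazyOracle {ans : (ι → V) → σ → Val → Val} {next : σ → Val → σ}
    {need : σ → Val → Option ι} {dom : σ → Set ι}
    (hdom : ∀ s m i, i ∈ dom (next s m) → i ∈ dom s ∨ need s m = some i)
    (hans : ∀ R R' s m, (∀ i ∈ dom (next s m), R i = R' i) → ans R s m = ans R' s m)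
    (c : Comp α) (T : ι → Option V) (s : σ) (hT : ∀ i ∈ dom s, (T i).isSome) :
    ∃ J₀ : Finset ι, ∀ J, J₀ ⊆ J →
      (c.run (lazyOracle ans next need) (T, s)).map (fun r => (r.1, r.2.2)) =
        (PMF.uniformOfFintype (J → V)).bind fun R =>
          c.run (detOracle (ans (fill T R)) next) s := by
  induction c generalizing T s with
  | ret a => exact ⟨∅, fun J _ => by simp [run, PMF.pure_map]⟩
  | fail => exact ⟨∅, fun J _ => by simp [run, PMF.pure_map]⟩
  | tick n k ih => exact ih T s hT
  | rand n k ih =>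
    choose J₀ hJ₀ using fun i => ih i T s hT
    refine ⟨Finset.univ.biUnion J₀, fun J hJ => ?_⟩
    simp only [run, PMF.map_bind]
    rw [PMF.bind_comm]
    congr 1
    funext i
    exact hJ₀ i J ((Finset.subset_biUnion_of_mem J₀ (Finset.mem_univ i)).trans hJ)
  | query m k ih =>
    have hlook : ∀ (T : ι → Option V), (∀ i ∈ dom (next s m), (T i).isSome) →
        ∀ (J : Finset ι) (R : J → V),
        ans (fill T R) s m = ans (fun i => (T i).getD default) s m := by
      intro T hT' J R
      refine hans _ _ _ _ fun i hi => ?_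
      obtain ⟨v, hv⟩ := Option.isSome_iff_exists.1 (hT' i hi)
      simp [fill, hv]
    have hsimple : (∀ i ∈ dom (next s m), (T i).isSome) →
        lazyOracle ans next need (T, s) m =
          PMF.pure (ans (fun i => (T i).getD default) s m, (T, next s m)) →
        ∃ J₀ : Finset ι, ∀ J, J₀ ⊆ J →
          ((query m k).run (lazyOracle ans next need) (T, s)).map (fun r => (r.1, r.2.2)) =
            (PMF.uniformOfFintype (J → V)).bind fun R =>
              (query m k).run (detOracle (ans (fill T R)) next) s := by
      intro hT' h
      obtain ⟨J₀, hJ₀⟩ := ih (ans (fun i => (T i).getD default) s m) T (next s m) hT'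
      refine ⟨J₀, fun J hJ => ?_⟩
      simp only [run, h, PMF.pure_bind, detOracle, hlook T hT']
      exact hJ₀ J hJ
    cases hn : need s m with
    | none =>
      refine hsimple (fun i hi => ?_) (by simp [lazyOracle, hn])
      rcases hdom s m i hi with h | h
      · exact hT i h
      · simp [hn] at h
    | some i₀ =>
      cases hTi : T i₀ with
      | some v =>
        refine hsimple (fun i hi => ?_) (by simp [lazyOracle, hn, hTi])
        rcases hdom s m i hi with h | h
        · exact hT i h
        · rw [hn] at h
          cases h
          simp [hTi]
      | none =>
        let T' : V → ι → Option V := fun v => Function.update T i₀ (some v)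
        have hT' : ∀ v, ∀ i ∈ dom (next s m), (T' v i).isSome := by
          intro v i hi
          by_cases h : i = i₀
          · subst h
            simp [T']
          · rcases hdom s m i hi with h' | h'
            · simpa [T', h] using hT i h'
            · rw [hn] at h'
              cases h'
              exact absurd rfl h
        choose J₀ hJ₀ using fun v =>
          ih (ans (fun i => (T' v i).getD default) s m) (T' v) (next s m) (hT' v)
        refine ⟨insert i₀ (Finset.univ.biUnion J₀), fun J hJ => ?_⟩
        have hi₀ : i₀ ∈ J := hJ (Finset.mem_insert_self _ _)
        have hJv : ∀ v, J₀ v ⊆ J := fun v =>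
          ((Finset.subset_biUnion_of_mem J₀ (Finset.mem_univ v)).trans
            (Finset.subset_insert _ _)).trans hJ
        have hfill : ∀ (v : V) (R : J → V),
            fill T (Function.update R ⟨i₀, hi₀⟩ v) = fill (T' v) R := by
          intro v R
          funext i
          by_cases h : i = i₀
          · subst h
            simp [fill, T', hTi, hi₀]
          · simp [fill, T', h]
        have hlazy : lazyOracle ans next need (T, s) m = (PMF.uniformOfFintype V).map fun v =>
            (ans (fun i => (T' v i).getD default) s m, (T' v, next s m)) := by
          simp [lazyOracle, hn, hTi, T']
        rw [← uniform_update (⟨i₀, hi₀⟩ : J)]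
        simp only [run, hlazy, PMF.bind_map, PMF.map_bind]
        congr 1
        funext v
        simp only [detOracle, PMF.pure_bind, hfill, hlook _ (hT' v)]
        exact hJ₀ v J (hJv v)

end Comp

/-! ### The game as a function of the keys and pads -/

section Annotate

variable {n : ℕ} {s : List (Val × Bool)} {ms ms' : List Val} {m : Val} {i l : ℕ}

theorem annotate_suffix (h : ms <:+ ms') : annotate n ms <:+ annotate n ms' := by
  induction ms' with
  | nil => rw [List.suffix_nil.1 h]
  | cons m ms' ih =>
    rcases List.suffix_cons_iff.1 h with rfl | h
    · exact List.suffix_rfl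
    · exact (ih h).trans (List.suffix_cons _ _)

theorem isReg_of_isCor (h : isCor s i = true) : isReg s i = true := by
  simp only [isCor, isReg, List.any_eq_true, Bool.and_eq_true, decide_eq_true_eq] at h ⊢
  obtain ⟨e, he, h1, h2⟩ := h
  exact ⟨e, he, by omega, h2⟩

theorem accepted_zero (ht : tag m = 0) :
    accepted n s m = (decide (client m < n) && !started n s) := by
  simp [accepted, ht]

theorem accepted_one (ht : tag m = 1) : accepted n s m = decide (client m < n) := by
  simp [accepted, ht]

theorem accepted_two (ht : tag m = 2) :
    accepted n s m = (isReg s (client m) && !hasEnc s (client m) (labelCode m)) := by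
  simp [accepted, ht]

theorem accepted_three (ht : tag m = 3) :
    accepted n s m = (List.range n).all fun i => !inSupport m i || isReg s i := by
  simp [accepted, ht]

theorem tag_le_of_accepted (h : accepted n s m = true) : tag m ≤ 3 := by
  by_contra h'
  simp [accepted, show tag m ≠ 0 by omega, show tag m ≠ 1 by omega, show tag m ≠ 2 by omega,
    show tag m ≠ 3 by omega] at h

theorem isCor_cons (e : Val × Bool) : isCor (e :: s) i =
    ((decide (tag e.1 = 0) && (e.2 && decide (client e.1 = i))) || isCor s i) := by
  simp [isCor]

theorem isReg_cons (e : Val × Bool) : isReg (e :: s) i =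
    ((decide (tag e.1 < 2) && (e.2 && decide (client e.1 = i))) || isReg s i) := by
  simp [isReg]

theorem started_cons (e : Val × Bool) : started n (e :: s) =
    ((decide (tag e.1 = 3) || ((decide (tag e.1 = 1) || decide (tag e.1 = 2)) &&
      decide (client e.1 < n))) || started n s) := by
  simp [started]

theorem hasEnc_cons (e : Val × Bool) : hasEnc (e :: s) i l = (isEnc i l e || hasEnc s i l) := by
  simp [hasEnc]

theorem lt_of_isReg (h : isReg (annotate n ms) i = true) : i < n := by
  induction ms with
  | nil => simp [annotate, isReg] at h
  | cons m ms ih =>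
    rw [annotate, isReg_cons, Bool.or_eq_true] at h
    rcases h with h | h
    · simp only [Bool.and_eq_true, decide_eq_true_eq] at h
      obtain ⟨h1, h2, rfl⟩ := h
      have : tag m = 0 ∨ tag m = 1 := by omega
      rcases this with h | h
      · rw [accepted_zero h] at h2
        simp at h2
        exact h2.1
      · rw [accepted_one h] at h2
        simpa using h2
    · exact ih h

/-- Corruptions are static. -/
theorem isCor_eq_of_suffix (h : ms <:+ ms') (hs : started n (annotate n ms) = true) :
    isCor (annotate n ms') i = isCor (annotate n ms) i := by
  have mono : ∀ {ms'}, ms <:+ ms' → started n (annotate n ms') = true := by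
    intro ms' h
    obtain ⟨t, ht⟩ := annotate_suffix (n := n) h
    rw [← ht, started, List.any_append]
    rw [started] at hs
    simp [hs]
  induction ms' with
  | nil => rw [List.suffix_nil.1 h]
  | cons m ms' ih =>
    rcases List.suffix_cons_iff.1 h with rfl | h
    · rfl
    · rw [annotate, isCor_cons, ih h]
      by_cases ht : tag m = 0
      · simp [accepted_zero ht, mono h]
      · simp [ht]

theorem encMsg_cons (e : Val × Bool) : encMsg (e :: s) i l =
    if hasEnc s i l = true then encMsg s i l else if isEnc i l e = true then e.1 else .num 0 := by
  have key : ∀ (s : List (Val × Bool)) (r : Val),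
      s.foldl (fun r e => if isEnc i l e = true then e.1 else r) r =
        if hasEnc s i l = true then encMsg s i l else r := by
    intro s
    induction s with
    | nil => intro r; simp [hasEnc]
    | cons e s ih =>
      intro r
      rw [List.foldl_cons, ih, hasEnc_cons, show encMsg (e :: s) i l =
        s.foldl (fun r e => if isEnc i l e = true then e.1 else r)
          (if isEnc i l e = true then e.1 else .num 0) from rfl, ih]
      by_cases h1 : hasEnc s i l = true <;> by_cases h2 : isEnc i l e = true <;> simp [h1, h2]
  rw [encMsg, List.foldl_cons, key]

/-- There is only one answered encryption query for each client and label. -/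
theorem encMsg_eq (h : (m, true) ∈ annotate n ms) (ht : tag m = 2) :
    encMsg (annotate n ms) (client m) (labelCode m) = m := by
  induction ms with
  | nil => simp [annotate] at h
  | cons m' ms ih =>
    rw [annotate] at h ⊢
    rw [encMsg_cons]
    rcases List.mem_cons.1 h with h | h
    · obtain ⟨rfl, h⟩ := Prod.ext_iff.1 h
      dsimp only at h ht ⊢
      have h' := h
      rw [accepted_two ht] at h'
      simp only [Bool.true_eq, Bool.and_eq_true, Bool.not_eq_true'] at h'
      simp [h'.2, isEnc, ht, ← h]
    · rw [if_pos, ih h]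
      simp only [hasEnc, List.any_eq_true]
      exact ⟨_, h, by simp [isEnc, ht]⟩

theorem mem_of_hasEnc (h : hasEnc s i l = true) :
    ∃ m, (m, true) ∈ s ∧ tag m = 2 ∧ client m = i ∧ labelCode m = l := by
  simp only [hasEnc, List.any_eq_true, isEnc, Bool.and_eq_true, decide_eq_true_eq] at h
  obtain ⟨⟨m, b⟩, he, h1, rfl, h3, h4⟩ := h
  exact ⟨m, he, h1, h3, h4⟩

end Annotate

theorem sum_range_map {M : Type} [AddCommMonoid M] (f : ℕ → M) (n : ℕ) :
    ((List.range n).map f).sum = ∑ i ∈ Finset.range n, f i := by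
  simp [Finset.sum, Finset.range, Multiset.range]

theorem keyValue_lt {q : ℕ} [NeZero q] (n len b : ℕ) (F : ℕ → ℕ → ℕ) (m : Val) :
    keyValue q n len b F m < q :=
  Nat.mod_lt _ (Nat.pos_of_ne_zero (NeZero.ne q))

theorem cast_keyValue {q : ℕ} [NeZero q] (n len b : ℕ) (F : ℕ → ℕ → ℕ) (m : Val) :
    (keyValue q n len b F m : ZMod q) = (∑ i ∈ Finset.range n, if inSupport m i = true then
      ∑ j ∈ Finset.range len, (F i j : ZMod q) * (coeff m i j : ZMod q) else 0) - noise b m := by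
  have h : noise b m % q ≤ q := (Nat.mod_lt _ (Nat.pos_of_ne_zero (NeZero.ne q))).le
  rw [keyValue, ZMod.natCast_mod, Nat.cast_add, Nat.cast_sub h, ZMod.natCast_mod, ZMod.natCast_self,
    zero_sub, ← sub_eq_add_neg, sum_range_map, Nat.cast_sum]
  congr 1
  refine Finset.sum_congr rfl fun i _ => ?_
  split_ifs
  · rw [sum_range_map, Nat.cast_sum]
    simp
  · simp

theorem cast_balance {q : ℕ} (n len b : ℕ) (s : List (Val × Bool)) (m : Val) :
    (balance n len b s m : ZMod q) =
      (∑ i ∈ Finset.range n, if (inSupport m i && !isCor s i) = true then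
        ∑ j ∈ Finset.range len, (plain b (encMsg s i (labelCode m)) j : ZMod q) *
          (coeff m i j : ZMod q) else 0) + noise b m := by
  rw [balance, Nat.cast_add, sum_range_map, Nat.cast_sum]
  congr 1
  refine Finset.sum_congr rfl fun i _ => ?_
  split_ifs
  · rw [sum_range_map, Nat.cast_sum]
    simp
  · simp

theorem reply_congr {q n len b : ℕ} {K K' : ℕ → ℕ} {F F' : ℕ → ℕ → ℕ} {m : Val}
    (h0 : tag m = 0 → K (client m) = K' (client m))
    (h2 : tag m = 2 → ∀ j < len, F (client m) j = F' (client m) j)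
    (h3 : 3 ≤ tag m → ∀ i < n, inSupport m i = true → ∀ j < len, F i j = F' i j) :
    reply q n len b K F m = reply q n len b K' F' m := by
  unfold reply
  split_ifs with t0 t1 t2
  · rw [h0 t0]
  · rfl
  · congr 4
    simp only [List.cons.injEq, and_true]
    congr 1
    refine List.map_congr_left fun j hj => ?_
    rw [h2 t2 j (List.mem_range.1 hj)]
  · have : keyValue q n len b F m = keyValue q n len b F' m := by
      unfold keyValue
      congr 3
      refine List.map_congr_left fun i hi => ?_
      split_ifs with hs
      · congr 1
        refine List.map_congr_left fun j hj => ?_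
        rw [h3 (by omega) i (List.mem_range.1 hi) hs j (List.mem_range.1 hj)]
      · rfl
    rw [this]

namespace Params

variable (P : Params) (κ : ℕ)

/-- The keys of corrupted clients as numbers. -/
def keyFun (K : Fin (P.nmax κ) → BitVec κ) (i : ℕ) : ℕ :=
  if h : i < P.nmax κ then (K ⟨i, h⟩).toNat else 0

/-- The pads for the label with number `l`; the corrupted clients have the keys `K`, and the honest
ones the pads `F`. -/
def padFun (K : Fin (P.nmax κ) → BitVec κ) (F : Fin (P.nmax κ) → Vec (P.q κ) (P.mmax κ))
    (s : List (Val × Bool)) (l i t : ℕ) : ℕ :=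
  if h : i < P.nmax κ ∧ t < P.mmax κ then
    ((if isCor s i = true then P.prf κ (K ⟨i, h.1⟩) (Label.ofCode l) else F ⟨i, h.1⟩)
      ⟨t, h.2⟩).val
  else 0

/-- The answer of the game with bit `b` to the message `m` after the messages `ms`, where
`F l` are the pads of the honest clients for the label with number `l`. -/
def gameAns (b : ℕ) (K : Fin (P.nmax κ) → BitVec κ)
    (F : ℕ → Fin (P.nmax κ) → Vec (P.q κ) (P.mmax κ)) (ms : List Val) (m : Val) : Val :=
  if accepted (P.nmax κ) (annotate (P.nmax κ) ms) m = true then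
    reply (P.q κ) (P.nmax κ) (P.len κ (Label.ofCode (labelCode m))) b (P.keyFun κ K)
      (P.padFun κ K (F (labelCode m)) (annotate (P.nmax κ) ms) (labelCode m)) m
  else ignored

/-- Admissibility in terms of the messages. -/
def admissible (ms : List Val) : Bool :=
  (annotate (P.nmax κ) ms).all fun e => admissibleAt (P.q κ) (P.nmax κ)
    (P.len κ (Label.ofCode (labelCode e.1))) (annotate (P.nmax κ) ms) e

/-- The differences of the plaintexts of honest clients. -/
def shift (ms : List Val) (l : ℕ) (i : Fin (P.nmax κ)) : Vec (P.q κ) (P.mmax κ) := fun t =>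
  (plain 0 (encMsg (annotate (P.nmax κ) ms) i l) t : ZMod (P.q κ)) -
    plain 1 (encMsg (annotate (P.nmax κ) ms) i l) t

variable {P κ}

theorem cast_padFun {K : Fin (P.nmax κ) → BitVec κ}
    {F : Fin (P.nmax κ) → Vec (P.q κ) (P.mmax κ)} {s : List (Val × Bool)} {l i t : ℕ}
    (hi : i < P.nmax κ) (ht : t < P.mmax κ) : (P.padFun κ K F s l i t : ZMod (P.q κ)) =
      (if isCor s i = true then P.prf κ (K ⟨i, hi⟩) (Label.ofCode l) else F ⟨i, hi⟩) ⟨t, ht⟩ := by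
  simp [padFun, hi, ht]

/-- The one-time pad: if the adversary is admissible, its view in the game with bit `0` is its view
in the game with bit `1` in which the pads are shifted by the differences of the plaintexts. -/
theorem gameAns_shift {ms ms' : List Val} {m : Val} (h : (m :: ms) <:+ ms')
    (hadm : P.admissible κ ms' = true) (K : Fin (P.nmax κ) → BitVec κ)
    (F F' : ℕ → Fin (P.nmax κ) → Vec (P.q κ) (P.mmax κ))
    (hF : F' (labelCode m) = F (labelCode m) + P.shift κ ms' (labelCode m)) :
    P.gameAns κ 0 K F ms m = P.gameAns κ 1 K F' ms m := by
  unfold gameAns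
  split_ifs with hacc
  swap
  · rfl
  have hlen := P.len_le κ (Label.ofCode (labelCode m))
  have hmem : (m, true) ∈ annotate (P.nmax κ) ms' := by
    refine (annotate_suffix (n := P.nmax κ) h).subset ?_
    rw [annotate, hacc]
    exact List.mem_cons_self
  have hadm' := List.all_eq_true.1 hadm _ hmem
  have hstat : (tag m = 3 ∨ tag m = 2 ∧ client m < P.nmax κ) →
      ∀ i, isCor (annotate (P.nmax κ) ms') i = isCor (annotate (P.nmax κ) ms) i := by
    intro ht i
    rw [isCor_eq_of_suffix h, annotate, isCor_cons]
    · rcases ht with ht | ht <;> simp [ht]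
    · rw [annotate, started_cons]
      rcases ht with ht | ht <;> simp [ht]
  have h0 : tag m = 0 ∨ tag m = 1 ∨ tag m = 2 ∨ tag m = 3 := by
    have := tag_le_of_accepted hacc
    omega
  rcases h0 with ht | ht | ht | ht
  · simp [reply, ht]
  · simp [reply, ht]
  · have hreg := hacc
    rw [accepted_two ht, Bool.and_eq_true] at hreg
    have hc := lt_of_isReg hreg.1
    have hst := hstat (.inr ⟨ht, hc⟩) (client m)
    simp only [reply, ht, OfNat.ofNat_ne_zero, OfNat.ofNat_ne_one, if_false, if_true]
    congr 4
    simp only [List.cons.injEq, and_true]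
    congr 1
    refine List.map_congr_left fun j hj => ?_
    have hj' := List.mem_range.1 hj
    congr 1
    rw [← ZMod.natCast_eq_natCast_iff', Nat.cast_add, Nat.cast_add,
      cast_padFun hc (hj'.trans_le hlen), cast_padFun hc (hj'.trans_le hlen)]
    by_cases hcor : isCor (annotate (P.nmax κ) ms) (client m) = true
    · have hp := hadm'
      simp only [admissibleAt, ht, decide_true, Bool.true_and, if_true, hst, hcor, Bool.not_true,
        Bool.false_or, if_true, List.all_eq_true, decide_eq_true_eq] at hp
      rw [if_pos hcor, if_pos hcor, (ZMod.natCast_eq_natCast_iff' _ _ _).2 (hp j hj)]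
    · rw [if_neg hcor, if_neg hcor, hF]
      simp only [Pi.add_apply, shift, encMsg_eq hmem ht]
      ring
  · have hst := hstat (.inl ht)
    have hv : keyValue (P.q κ) (P.nmax κ) (P.len κ (Label.ofCode (labelCode m))) 0
        (P.padFun κ K (F (labelCode m)) (annotate (P.nmax κ) ms) (labelCode m)) m =
        keyValue (P.q κ) (P.nmax κ) (P.len κ (Label.ofCode (labelCode m))) 1
        (P.padFun κ K (F' (labelCode m)) (annotate (P.nmax κ) ms) (labelCode m)) m := by
      have hp := hadm'
      simp only [admissibleAt, ht, decide_true, Bool.true_and, if_true,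
        Nat.reduceEqDiff, decide_false, Bool.false_and, Bool.false_eq_true, if_false,
        Bool.and_eq_true, decide_eq_true_eq] at hp
      have hbal := (ZMod.natCast_eq_natCast_iff' _ _ _).2 hp.2
      rw [cast_balance, cast_balance] at hbal
      rw [← Nat.mod_eq_of_lt (keyValue_lt (q := P.q κ) (P.nmax κ) _ 0 _ m),
        ← Nat.mod_eq_of_lt (keyValue_lt (q := P.q κ) (P.nmax κ) _ 1 _ m), ← ZMod.natCast_eq_natCast_iff',
        cast_keyValue, cast_keyValue, sub_eq_sub_iff_add_eq_add]
      -- The contributions of the pads differ by those of the plaintexts.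
      have hdiff : (∑ i ∈ Finset.range (P.nmax κ), if inSupport m i = true then
          ∑ j ∈ Finset.range (P.len κ (Label.ofCode (labelCode m))),
            (P.padFun κ K (F' (labelCode m)) (annotate (P.nmax κ) ms) (labelCode m) i j : ZMod (P.q κ)) *
              (coeff m i j : ZMod (P.q κ)) else 0) +
          (∑ i ∈ Finset.range (P.nmax κ), if (inSupport m i && !isCor (annotate (P.nmax κ) ms') i) = true then
            ∑ j ∈ Finset.range (P.len κ (Label.ofCode (labelCode m))),
              (plain 1 (encMsg (annotate (P.nmax κ) ms') i (labelCode m)) j : ZMod (P.q κ)) *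
              (coeff m i j : ZMod (P.q κ)) else 0) =
          (∑ i ∈ Finset.range (P.nmax κ), if inSupport m i = true then
          ∑ j ∈ Finset.range (P.len κ (Label.ofCode (labelCode m))),
            (P.padFun κ K (F (labelCode m)) (annotate (P.nmax κ) ms) (labelCode m) i j : ZMod (P.q κ)) *
              (coeff m i j : ZMod (P.q κ)) else 0) +
          (∑ i ∈ Finset.range (P.nmax κ), if (inSupport m i && !isCor (annotate (P.nmax κ) ms') i) = true then
            ∑ j ∈ Finset.range (P.len κ (Label.ofCode (labelCode m))),
              (plain 0 (encMsg (annotate (P.nmax κ) ms') i (labelCode m)) j : ZMod (P.q κ)) *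
              (coeff m i j : ZMod (P.q κ)) else 0) := by
        rw [← Finset.sum_add_distrib, ← Finset.sum_add_distrib]
        refine Finset.sum_congr rfl fun i hi => ?_
        have hi' := Finset.mem_range.1 hi
        by_cases hs : inSupport m i = true
        · by_cases hcor : isCor (annotate (P.nmax κ) ms) i = true
          · simp only [hs, hst, hcor, if_true, Bool.not_true, Bool.and_false, Bool.false_eq_true,
              if_false, add_zero]
            refine Finset.sum_congr rfl fun j hj => ?_
            have hj' := Finset.mem_range.1 hj
            rw [cast_padFun hi' (hj'.trans_le hlen), cast_padFun hi' (hj'.trans_le hlen),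
              if_pos hcor, if_pos hcor]
          · simp only [hs, hst, hcor, if_true, Bool.not_false, Bool.and_true]
            rw [← Finset.sum_add_distrib, ← Finset.sum_add_distrib]
            refine Finset.sum_congr rfl fun j hj => ?_
            have hj' := Finset.mem_range.1 hj
            rw [cast_padFun hi' (hj'.trans_le hlen), cast_padFun hi' (hj'.trans_le hlen),
              if_neg hcor, if_neg hcor, hF]
            simp only [Pi.add_apply, shift]
            ring
        · simp [hs]
      linear_combination -hdiff - hbal
    simp [reply, ht, hv]

end Params

namespace Params

variable (P : Params) (κ : ℕ)

/-! ### Hybrid games -/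

/-- The answers depend on the keys of corrupted clients and on the pads of honest registered clients
only. This is what allows keys and pads to be drawn when they are first needed. -/
theorem gameAns_congr {b : ℕ} {K K' : Fin (P.nmax κ) → BitVec κ}
    {F F' : ℕ → Fin (P.nmax κ) → Vec (P.q κ) (P.mmax κ)} {ms : List Val} {m : Val}
    (hK : ∀ i : Fin (P.nmax κ), isCor (annotate (P.nmax κ) (m :: ms)) i = true → K i = K' i)
    (hF : ∀ i : Fin (P.nmax κ), isReg (annotate (P.nmax κ) (m :: ms)) i = true →
      isCor (annotate (P.nmax κ) (m :: ms)) i = false → F (labelCode m) i = F' (labelCode m) i) :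
    P.gameAns κ b K F ms m = P.gameAns κ b K' F' ms m := by
  unfold gameAns
  split_ifs with hacc
  swap
  · rfl
  have hlen := P.len_le κ (Label.ofCode (labelCode m))
  have hpad : tag m ≠ 0 → ∀ i < P.nmax κ, isReg (annotate (P.nmax κ) ms) i = true →
      ∀ j < P.len κ (Label.ofCode (labelCode m)),
      P.padFun κ K (F (labelCode m)) (annotate (P.nmax κ) ms) (labelCode m) i j =
      P.padFun κ K' (F' (labelCode m)) (annotate (P.nmax κ) ms) (labelCode m) i j := by
    intro ht i hi hreg j hj
    have h1 : isCor (annotate (P.nmax κ) (m :: ms)) i = isCor (annotate (P.nmax κ) ms) i := by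
      simp [annotate, isCor_cons, ht]
    have h2 : isReg (annotate (P.nmax κ) (m :: ms)) i = true := by
      simp [annotate, isReg_cons, hreg]
    unfold padFun
    rw [dif_pos ⟨hi, hj.trans_le hlen⟩, dif_pos ⟨hi, hj.trans_le hlen⟩]
    split_ifs with hc
    · rw [hK ⟨i, hi⟩ (h1.trans hc)]
    · rw [hF ⟨i, hi⟩ h2 (h1.trans (by simpa using hc))]
  refine reply_congr ?_ ?_ ?_
  · intro ht
    have hc : client m < P.nmax κ := by
      rw [accepted_zero ht, Bool.and_eq_true, decide_eq_true_eq] at hacc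
      exact hacc.1
    unfold keyFun
    rw [dif_pos hc, dif_pos hc, hK ⟨client m, hc⟩]
    simp [annotate, isCor_cons, ht, hacc]
  · intro ht j hj
    rw [accepted_two ht, Bool.and_eq_true] at hacc
    exact hpad (by omega) _ (lt_of_isReg hacc.1) hacc.1 j hj
  · intro ht i hi hs j hj
    have ht : tag m = 3 := le_antisymm (tag_le_of_accepted hacc) ht
    rw [accepted_three ht, List.all_eq_true] at hacc
    have := hacc i (List.mem_range.2 hi)
    rw [hs, Bool.not_true, Bool.false_or] at this
    exact hpad (by omega) i hi this j hj

/-- Pads of the honest clients: the clients before `j` have the random pads `R`, the other ones the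
pads that belong to the keys `K`. -/
def hybridPad (j : ℕ) (K : Fin (P.nmax κ) → BitVec κ)
    (R : ℕ → Fin (P.nmax κ) → Vec (P.q κ) (P.mmax κ)) (l : ℕ) (i : Fin (P.nmax κ)) :
    Vec (P.q κ) (P.mmax κ) :=
  if (i : ℕ) < j then R l i else P.prf κ (K i) (Label.ofCode l)

/-- The oracle of the hybrid game, which draws the random pads when their label occurs for the
first time. -/
def hybridOracle (j b : ℕ) (K K' : Fin (P.nmax κ) → BitVec κ) :
    (ℕ → Option (Fin (P.nmax κ) → Vec (P.q κ) (P.mmax κ))) × List Val → Val →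
      PMF (Val × (ℕ → Option (Fin (P.nmax κ) → Vec (P.q κ) (P.mmax κ))) × List Val) :=
  Comp.lazyOracle (fun R => P.gameAns κ b K (P.hybridPad κ j K' R)) (fun ms m => m :: ms)
    fun _ m => some (labelCode m)

/-- The output of the adversary and its messages in the hybrid game with bit `b`, given the keys
`K` of the corrupted clients and the keys `K'` of the honest ones. -/
def hybridRun (j b : ℕ) (K K' : Fin (P.nmax κ) → BitVec κ) (c : Comp Val) :
    PMF (Option Val × List Val) :=
  (c.run (P.hybridOracle κ j b K K') (fun _ => none, [])).map fun r => (r.1, r.2.2)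

open Classical in
/-- Whether the adversary wins. -/
def wins (r : Option Val × List Val) : Bool :=
  decide (OutputsOne r.1) && P.admissible κ r.2

/-- The outcome of the hybrid game. -/
def hybrid (j b : ℕ) (c : Comp Val) : PMF Bool :=
  (PMF.uniformOfFintype (Fin (P.nmax κ) → BitVec κ)).bind fun K =>
    (PMF.uniformOfFintype (Fin (P.nmax κ) → BitVec κ)).bind fun K' =>
      (P.hybridRun κ j b K K' c).map (P.wins κ)

variable {P κ}

/-- The hybrid game with the pads drawn in advance, for any finite set of labels that is large
enough. -/
theorem hybridRun_eq (j b : ℕ) (K K' : Fin (P.nmax κ) → BitVec κ) (c : Comp Val) :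
    ∃ J₀ : Finset ℕ, ∀ J, J₀ ⊆ J → P.hybridRun κ j b K K' c =
      (PMF.uniformOfFintype (J → Fin (P.nmax κ) → Vec (P.q κ) (P.mmax κ))).bind fun R =>
        c.run (Comp.detOracle (P.gameAns κ b K (P.hybridPad κ j K'
          (Comp.fill (fun _ => none) R))) fun ms m => m :: ms) [] := by
  unfold hybridRun hybridOracle
  exact Comp.run_lazyOracle (ans := fun R => P.gameAns κ b K (P.hybridPad κ j K' R)) (dom := fun ms => {l | ∃ m ∈ ms, labelCode m = l})
    (by
      rintro ms m l ⟨m', hm', rfl⟩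
      rcases List.mem_cons.1 hm' with rfl | h
      · exact .inr rfl
      · exact .inl ⟨m', h, rfl⟩)
    (fun R R' ms m h => gameAns_congr P κ (fun _ _ => rfl) fun i _ _ => by
      simp only [hybridPad, h (labelCode m) ⟨m, List.mem_cons_self, rfl⟩])
    c _ [] (by simp)

/-- Without random pads, the hybrid game is deterministic. -/
theorem hybridRun_zero (b : ℕ) (K K' : Fin (P.nmax κ) → BitVec κ) (c : Comp Val) :
    P.hybridRun κ 0 b K K' c = c.run (Comp.detOracle
      (P.gameAns κ b K fun l i => P.prf κ (K' i) (Label.ofCode l)) fun ms m => m :: ms) [] := by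
  obtain ⟨J₀, h⟩ := hybridRun_eq 0 b K K' c
  rw [h J₀ subset_rfl]
  have hpad : ∀ R, P.hybridPad κ 0 K' R = fun l i => P.prf κ (K' i) (Label.ofCode l) := fun R => by
    funext l i
    simp [hybridPad]
  simp only [hpad]
  exact PMF.bind_const _ _

/-- If all pads of honest clients are random, then the executions in which the adversary is
admissible do not depend on the bit. -/
theorem hybridRun_last (K K' : Fin (P.nmax κ) → BitVec κ) (c : Comp Val) (a : Option Val)
    {ms : List Val} (hms : P.admissible κ ms = true) :
    P.hybridRun κ (P.nmax κ) 0 K K' c (a, ms) = P.hybridRun κ (P.nmax κ) 1 K K' c (a, ms) := by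
  obtain ⟨J₀, h₀⟩ := hybridRun_eq (P.nmax κ) 0 K K' c
  obtain ⟨J₁, h₁⟩ := hybridRun_eq (P.nmax κ) 1 K K' c
  let J : Finset ℕ := J₀ ∪ J₁ ∪ (ms.map labelCode).toFinset
  have hJ : ∀ m ∈ ms, labelCode m ∈ J := fun m hm =>
    Finset.mem_union_right _ (List.mem_toFinset.2 (List.mem_map_of_mem hm))
  rw [h₀ J (Finset.subset_union_left.trans Finset.subset_union_left),
    h₁ J (Finset.subset_union_right.trans Finset.subset_union_left),
    ← uniform_bind_equiv (Equiv.subRight fun l : J => P.shift κ ms l)]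
  simp only [PMF.bind_apply]
  refine tsum_congr fun R => ?_
  congr 1
  refine Comp.run_apply_congr (P := fun ms' => ms' <:+ ms) ?_ ?_ c [] a ms List.suffix_rfl
  · intro ms' m hr
    have hsuf : (m :: ms') <:+ ms := by
      obtain ⟨r, hr, h⟩ := hr
      simp only [Comp.detOracle, PMF.support_pure, Set.mem_union, Set.mem_singleton_iff] at hr
      rcases hr with rfl | rfl <;> exact h
    unfold Comp.detOracle
    rw [gameAns_shift hsuf hms]
    funext i
    have := hJ m (hsuf.subset List.mem_cons_self)
    simp [hybridPad, Comp.fill, this]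
  · intro ms' m r hr h
    simp only [Comp.detOracle, PMF.support_pure, Set.mem_union, Set.mem_singleton_iff] at hr
    rcases hr with rfl | rfl <;> exact (List.suffix_cons _ _).trans h

/-- In the last hybrid game, the probability of winning does not depend on the bit. -/
theorem hybrid_last (c : Comp Val) :
    P.hybrid κ (P.nmax κ) 0 c true = P.hybrid κ (P.nmax κ) 1 c true := by
  simp only [hybrid, PMF.bind_apply]
  refine tsum_congr fun K => congrArg _ (tsum_congr fun K' => congrArg _ ?_)
  rw [PMF.map_apply, PMF.map_apply]
  refine tsum_congr fun r => ?_
  split_ifs with h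
  · rw [wins, Bool.true_eq, Bool.and_eq_true] at h
    exact hybridRun_last K K' c r.1 h.2
  · rfl

end Params

namespace Params

variable (P : Params) (κ : ℕ)

/-! ### The states of the challenger -/

/-- The encryption query that the message `m` stands for. -/
def encQuery (m : Val) (h : (m.snd.nth 0).toNat < P.nmax κ) : EncQuery (P.family κ) where
  i := (⟨(m.snd.nth 0).toNat, h⟩ : Fin (P.nmax κ))
  ℓ := Label.ofCode (m.snd.nth 1).toNat
  x β := if β then Vec.ofVal _ _ (m.snd.nth 3) else Vec.ofVal _ _ (m.snd.nth 2)

/-- The decryption key query that the message `m` stands for. -/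
def keyQuery (m : Val) : KeyQuery (P.family κ) where
  S := (famSupport (P.nmax κ) (m.snd.nth 1) : Finset (Fin (P.nmax κ)))
  ℓ := Label.ofCode (m.snd.nth 0).toNat
  f := fun i => Vec.ofVal _ _ ((m.snd.nth 1).nth i.1.1).snd
  ν β := if β then (((m.snd.nth 3).toNat : ℕ) : ZMod (P.q κ)) else ((m.snd.nth 2).toNat : ZMod (P.q κ))

theorem read_zero {m : Val} (ht : tag m = 0) : Query.read (P.family κ) m =
    if h : m.snd.toNat < P.nmax κ then some (.cor (⟨m.snd.toNat, h⟩ : Fin (P.nmax κ))) else none := by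
  unfold tag at ht
  unfold Query.read
  rw [ht]
  by_cases h : m.snd.toNat < P.nmax κ
  · have h' : (Readable.ofVal m.snd : Option (Fin (P.family κ).n)) =
      some (⟨m.snd.toNat, h⟩ : Fin (P.nmax κ)) := dif_pos h
    simp only [h', dif_pos h]
    rfl
  · have h' : (Readable.ofVal m.snd : Option (Fin (P.family κ).n)) = none := dif_neg h
    simp only [h', dif_neg h]
    rfl

theorem read_one {m : Val} (ht : tag m = 1) : Query.read (P.family κ) m =
    if h : m.snd.toNat < P.nmax κ then some (.ekeygen (⟨m.snd.toNat, h⟩ : Fin (P.nmax κ)))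
    else none := by
  unfold tag at ht
  unfold Query.read
  rw [ht]
  by_cases h : m.snd.toNat < P.nmax κ
  · have h' : (Readable.ofVal m.snd : Option (Fin (P.family κ).n)) =
      some (⟨m.snd.toNat, h⟩ : Fin (P.nmax κ)) := dif_pos h
    simp only [h', dif_pos h]
    rfl
  · have h' : (Readable.ofVal m.snd : Option (Fin (P.family κ).n)) = none := dif_neg h
    simp only [h', dif_neg h]
    rfl

theorem read_two {m : Val} (ht : tag m = 2) : Query.read (P.family κ) m =
    if h : (m.snd.nth 0).toNat < P.nmax κ then some (.enc (P.encQuery κ m h)) else none := by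
  unfold tag at ht
  unfold Query.read
  rw [ht]
  by_cases h : (m.snd.nth 0).toNat < P.nmax κ
  · have h' : (Readable.ofVal (m.snd.nth 0) : Option (Fin (P.family κ).n)) =
      some (⟨(m.snd.nth 0).toNat, h⟩ : Fin (P.nmax κ)) := dif_pos h
    simp only [h', dif_pos h]
    rfl
  · have h' : (Readable.ofVal (m.snd.nth 0) : Option (Fin (P.family κ).n)) = none := dif_neg h
    simp only [h', dif_neg h]
    rfl

theorem read_three {m : Val} (ht : tag m = 3) :
    Query.read (P.family κ) m = some (.keygen (P.keyQuery κ m)) := by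
  unfold tag at ht
  unfold Query.read
  rw [ht]
  rfl

theorem read_other {m : Val} (ht : 3 < tag m) : Query.read (P.family κ) m = none := by
  unfold tag at ht
  unfold Query.read
  split <;> first | omega | rfl

/-- The answered encryption queries. -/
def encQueries (s : List (Val × Bool)) : List (EncQuery (P.family κ)) :=
  s.filterMap fun e => if h : (tag e.1 = 2 ∧ e.2 = true) ∧ (e.1.snd.nth 0).toNat < P.nmax κ then
    some (P.encQuery κ e.1 h.2) else none

/-- The answered decryption key queries. -/
def keyQueries (s : List (Val × Bool)) : List (KeyQuery (P.family κ)) :=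
  s.filterMap fun e => if tag e.1 = 3 ∧ e.2 = true then some (P.keyQuery κ e.1) else none

/-- The labels that occurred. -/
def labelSet (n : ℕ) (s : List (Val × Bool)) : Finset Label :=
  ((s.filter fun e => decide (tag e.1 = 3) ||
    (decide (tag e.1 = 2) && decide (client e.1 < n))).map fun e =>
      Label.ofCode (labelCode e.1)).toFinset

/-- The keys of the registered clients. The table `T` has two places for each client, so that
keys of corrupted clients and keys of honest clients are different random variables. -/
def keysOf (T : Fin (P.nmax κ) × Fin 2 → Option (BitVec κ)) (s : List (Val × Bool))
    (i : Fin (P.nmax κ)) : Option (BitVec κ) :=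
  if isCor s i = true then T (i, 0) else if isReg s i = true then T (i, 1) else none

/-- The state of the challenger, in terms of the keys drawn so far and the messages. -/
def toState (x : (Fin (P.nmax κ) × Fin 2 → Option (BitVec κ)) × List Val) :
    DyNMCFE.State (P.dyNo κ) where
  msk := P.keysOf κ x.1 (annotate (P.nmax κ) x.2)
  ek := P.keysOf κ x.1 (annotate (P.nmax κ) x.2)
  CS := (Finset.univ.filter fun i : Fin (P.nmax κ) => isCor (annotate (P.nmax κ) x.2) i = true)
  started := started (P.nmax κ) (annotate (P.nmax κ) x.2)
  encLog := P.encQueries κ (annotate (P.nmax κ) x.2)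
  keyLog := P.keyQueries κ (annotate (P.nmax κ) x.2)
  labels := labelSet (P.nmax κ) (annotate (P.nmax κ) x.2)

/-- The place of the key that is needed for the answer to `m`. -/
def keyNeed (ms : List Val) (m : Val) : Option (Fin (P.nmax κ) × Fin 2) :=
  if h : client m < P.nmax κ then
    if tag m = 0 ∧ started (P.nmax κ) (annotate (P.nmax κ) ms) = false then some (⟨client m, h⟩, 0)
    else if tag m = 1 ∧ isReg (annotate (P.nmax κ) ms) (client m) = false then
      some (⟨client m, h⟩, 1)
    else none
  else none

/-- The answers of the real game, as a function of the keys. -/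
def realAns (b : ℕ) (K : Fin (P.nmax κ) × Fin 2 → BitVec κ) : List Val → Val → Val :=
  P.gameAns κ b (fun i => K (i, 0)) fun l i => P.prf κ (K (i, 1)) (Label.ofCode l)

/-- The real game with keys drawn lazily. -/
def realOracle (b : ℕ) : (Fin (P.nmax κ) × Fin 2 → Option (BitVec κ)) × List Val → Val →
    PMF (Val × (Fin (P.nmax κ) × Fin 2 → Option (BitVec κ)) × List Val) :=
  Comp.lazyOracle (P.realAns κ b) (fun ms m => m :: ms) (P.keyNeed κ)

/-- The keys drawn so far are those of the registered clients. -/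
def KeysDrawn (x : (Fin (P.nmax κ) × Fin 2 → Option (BitVec κ)) × List Val) : Prop :=
  ∀ i : Fin (P.nmax κ),
    ((x.1 (i, 0)).isSome ↔ isCor (annotate (P.nmax κ) x.2) i = true) ∧
    ((x.1 (i, 1)).isSome ↔ isReg (annotate (P.nmax κ) x.2) i = true ∧
      isCor (annotate (P.nmax κ) x.2) i = false)

end Params

/-- Before the first query that is not a corruption, all registered clients are corrupted. -/
theorem isCor_of_isReg {n : ℕ} {ms : List Val} {i : ℕ} (hs : started n (annotate n ms) = false)
    (h : isReg (annotate n ms) i = true) : isCor (annotate n ms) i = true := by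
  induction ms with
  | nil => simp [annotate, isReg] at h
  | cons m ms ih =>
    simp only [annotate, isReg_cons, isCor_cons, started_cons, Bool.or_eq_true, Bool.or_eq_false_iff,
      Bool.and_eq_true, decide_eq_true_eq] at h hs ⊢
    rcases h with ⟨h1, h2, h3⟩ | h
    · rcases (show tag m = 0 ∨ tag m = 1 by omega) with ht | ht
      · exact .inl ⟨ht, h2, h3⟩
      · rw [accepted_one ht] at h2
        have := hs.1.2
        rw [h2] at this
        simp [ht] at this
    · exact .inr (ih hs.2 h)

namespace Params

variable {P : Params} {κ : ℕ}

theorem mem_encQueries {s : List (Val × Bool)} {Q : EncQuery (P.family κ)} :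
    Q ∈ P.encQueries κ s ↔ ∃ (m : Val) (h : (m.snd.nth 0).toNat < P.nmax κ),
      (m, true) ∈ s ∧ tag m = 2 ∧ P.encQuery κ m h = Q := by
  simp only [encQueries, List.mem_filterMap, Option.dite_none_right_eq_some, Option.some.injEq]
  constructor
  · rintro ⟨⟨m, b⟩, he, ⟨⟨h1, h2⟩, h3⟩, h4⟩
    dsimp only at h1 h2 h3 h4
    subst h2
    exact ⟨m, h3, he, h1, h4⟩
  · rintro ⟨m, h, he, h1, h2⟩
    exact ⟨(m, true), he, ⟨⟨h1, rfl⟩, h⟩, h2⟩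

theorem mem_keyQueries {s : List (Val × Bool)} {Q : KeyQuery (P.family κ)} :
    Q ∈ P.keyQueries κ s ↔ ∃ m, (m, true) ∈ s ∧ tag m = 3 ∧ P.keyQuery κ m = Q := by
  simp only [keyQueries, List.mem_filterMap, Option.ite_none_right_eq_some, Option.some.injEq]
  constructor
  · rintro ⟨⟨m, b⟩, he, ⟨h1, h2⟩, h4⟩
    dsimp only at h1 h2 h4
    subst h2
    exact ⟨m, he, h1, h4⟩
  · rintro ⟨m, he, h1, h2⟩
    exact ⟨(m, true), he, ⟨h1, rfl⟩, h2⟩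

theorem client_of_two {m : Val} (ht : tag m = 2) : client m = (m.snd.nth 0).toNat := by
  simp [client, ht]

theorem client_of_lt {m : Val} (ht : tag m < 2) : client m = m.snd.toNat := by
  simp [client, ht]

theorem exists_encQueries_iff {s : List (Val × Bool)} {i : Fin (P.nmax κ)} {l : ℕ} :
    (∃ Q ∈ P.encQueries κ s, Q.i = i ∧ Q.ℓ = Label.ofCode l) ↔ hasEnc s i l = true := by
  constructor
  · rintro ⟨Q, hQ, rfl, hl⟩
    obtain ⟨m, h, hm, ht, rfl⟩ := mem_encQueries.1 hQ
    simp only [hasEnc, List.any_eq_true]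
    refine ⟨_, hm, ?_⟩
    have := congrArg Label.code hl
    simp only [encQuery, Label.code_ofCode] at this
    simp [isEnc, ht, client_of_two ht, encQuery, labelCode, this]
  · intro h
    obtain ⟨m, hm, ht, hc, rfl⟩ := mem_of_hasEnc h
    rw [client_of_two ht] at hc
    exact ⟨_, mem_encQueries.2 ⟨m, hc ▸ i.2, hm, ht, rfl⟩, Fin.ext hc,
      by simp [encQuery, labelCode, ht]⟩

theorem isSome_keysOf {x : (Fin (P.nmax κ) × Fin 2 → Option (BitVec κ)) × List Val}
    (hx : P.KeysDrawn κ x) (i : Fin (P.nmax κ)) :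
    (P.keysOf κ x.1 (annotate (P.nmax κ) x.2) i).isSome = isReg (annotate (P.nmax κ) x.2) i := by
  unfold keysOf
  have h := hx i
  by_cases hc : isCor (annotate (P.nmax κ) x.2) i = true
  · rw [if_pos hc, isReg_of_isCor hc]
    exact h.1.2 hc
  · rw [if_neg hc]
    by_cases hr : isReg (annotate (P.nmax κ) x.2) i = true
    · rw [if_pos hr, hr]
      exact h.2.2 ⟨hr, by simpa using hc⟩
    · rw [if_neg hr]
      simpa using hr

theorem padFun_eq_of_keysOf {T : Fin (P.nmax κ) × Fin 2 → Option (BitVec κ)}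
    {s : List (Val × Bool)} {i : Fin (P.nmax κ)} {k : BitVec κ} (hk : P.keysOf κ T s i = some k)
    {l t : ℕ} (ht : t < P.mmax κ) :
    P.padFun κ (fun i => (T (i, 0)).getD default)
      (fun i => P.prf κ ((T (i, 1)).getD default) (Label.ofCode l)) s l i t =
        (P.prf κ k (Label.ofCode l) ⟨t, ht⟩).val := by
  unfold padFun
  rw [dif_pos ⟨i.2, ht⟩]
  unfold keysOf at hk
  split_ifs at hk ⊢ with hc
  · simp [hk]
  · simp [hk]

theorem ofFn_eq_map_range {α : Type} {n : ℕ} {f : Fin n → α} {g : ℕ → α} (h : ∀ i, f i = g i) :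
    List.ofFn f = (List.range n).map g :=
  List.ext_getElem (by simp) fun i _ _ => by simp [h]

theorem vec_toVal {q m : ℕ} [NeZero q] {x : Vec q m} {g : ℕ → ℕ}
    (h : ∀ j, x j = (g j : ZMod q)) :
    x.toVal = .ofList ((List.range m).map fun j => .num (g j % q)) := by
  unfold Vec.toVal Val.ofFn
  rw [ofFn_eq_map_range (g := fun j => .num (g j % q)) fun j => by rw [h, ZMod.val_natCast]]

/-- The answers to encryption queries. -/
theorem encQuery_answer (b : Bool) {T : Fin (P.nmax κ) × Fin 2 → Option (BitVec κ)} {ms : List Val}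
    {m : Val} (ht : tag m = 2) (h : (m.snd.nth 0).toNat < P.nmax κ) {k : BitVec κ}
    (hk : P.keysOf κ T (annotate (P.nmax κ) ms) ⟨(m.snd.nth 0).toNat, h⟩ = some k)
    (hacc : accepted (P.nmax κ) (annotate (P.nmax κ) ms) m = true) :
    answer (Writable.toVal (⟨⟨(m.snd.nth 0).toNat, h⟩, mask ((P.encQuery κ m h).x b)
      (P.pad κ k (P.encQuery κ m h).ℓ)⟩ : P.Ciphertext κ (P.encQuery κ m h).ℓ)) =
      P.realAns κ b.toNat (fun i => (T i).getD default) ms m := by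
  have hl : labelCode m = (m.snd.nth 1).toNat := by simp [labelCode, ht]
  unfold realAns gameAns
  rw [if_pos hacc]
  simp only [reply, ht, client_of_two ht, OfNat.ofNat_ne_zero, OfNat.ofNat_ne_one, if_false, if_true,
    Writable.toVal, hl, encQuery, Label.code_ofCode]
  congr 4
  simp only [List.cons.injEq, and_true]
  refine vec_toVal fun j => ?_
  have hj := j.2.trans_le (P.len_le κ _)
  rw [padFun_eq_of_keysOf hk hj, Nat.cast_add, ZMod.natCast_zmod_val]
  cases b <;> rfl

/-- The answers to decryption key queries. -/
theorem keyQuery_answer (b : Bool) {T : Fin (P.nmax κ) × Fin 2 → Option (BitVec κ)} {ms : List Val}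
    {m : Val} (ht : tag m = 3)
    (hk : ∀ i : famSupport (P.nmax κ) (m.snd.nth 1),
      (P.keysOf κ T (annotate (P.nmax κ) ms) i.1).isSome)
    (hacc : accepted (P.nmax κ) (annotate (P.nmax κ) ms) m = true) :
    answer ((P.writableDecKey κ (Label.ofCode (m.snd.nth 0).toNat)
      (famSupport (P.nmax κ) (m.snd.nth 1))).toVal
        ⟨fun i => Vec.ofVal _ _ ((m.snd.nth 1).nth i.1.1).snd,
          (∑ i : famSupport (P.nmax κ) (m.snd.nth 1),
            P.pad κ ((P.keysOf κ T (annotate (P.nmax κ) ms) i.1).get (hk i))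
              (Label.ofCode (m.snd.nth 0).toNat) ⬝ᵥ Vec.ofVal _ _ ((m.snd.nth 1).nth i.1.1).snd) -
            if b = true then (((m.snd.nth 3).toNat : ℕ) : ZMod (P.q κ)) else
              ((m.snd.nth 2).toNat : ZMod (P.q κ))⟩) =
      P.realAns κ b.toNat (fun i => (T i).getD default) ms m := by
  have hl : labelCode m = (m.snd.nth 0).toNat := by simp [labelCode, ht]
  have hsupp : ∀ i : Fin (P.nmax κ), i ∈ famSupport (P.nmax κ) (m.snd.nth 1) ↔
      inSupport m i = true := by
    intro i
    simp [famSupport, inSupport]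
  unfold realAns gameAns
  rw [if_pos hacc]
  change answer (.ofList [.num (Label.ofCode (m.snd.nth 0).toNat).code, famToVal _,
    .num (ZMod.val _)]) = _
  simp only [reply, ht, OfNat.ofNat_ne_zero, OfNat.ofNat_ne_one, if_false,
    hl, Label.code_ofCode, Nat.reduceEqDiff]
  congr 3
  simp only [List.cons.injEq, and_true]
  refine ⟨?_, ?_⟩
  · unfold famToVal Val.ofFn
    congr 1
    refine ofFn_eq_map_range fun i => ?_
    by_cases hi : inSupport m i = true
    · rw [dif_pos ((hsupp i).2 hi), if_pos hi]
      congr 1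
      exact vec_toVal fun j => rfl
    · rw [dif_neg (mt (hsupp i).1 hi), if_neg hi]
  · congr 1
    rw [← Nat.mod_eq_of_lt (keyValue_lt (q := P.q κ) (P.nmax κ) _ _ _ m), ← ZMod.val_natCast,
      cast_keyValue]
    congr 1
    congr 1
    · rw [Finset.sum_range, ← Finset.sum_filter]
      have hfilter : (Finset.univ.filter fun i : Fin (P.nmax κ) => inSupport m i = true) =
          famSupport (P.nmax κ) (m.snd.nth 1) := by
        ext i
        simp [hsupp]
      rw [hfilter, ← Finset.sum_coe_sort (famSupport (P.nmax κ) (m.snd.nth 1)) fun a => ∑ j ∈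
        Finset.range (P.len κ (Label.ofCode (m.snd.nth 0).toNat)), _ * _]
      refine Finset.sum_congr rfl fun i _ => ?_
      rw [Finset.sum_range, dotProduct]
      refine Finset.sum_congr rfl fun j _ => ?_
      rw [padFun_eq_of_keysOf (Option.some_get (hk i)).symm (j.2.trans_le (P.len_le κ _)),
        ZMod.natCast_zmod_val]
      rfl
    · cases b <;> rfl

end Params

/-! ### The real game -/

theorem state_ext {𝓕 : FunctionFamily} {E : DyNMCFE 𝓕} {s s' : DyNMCFE.State E}
    (hmsk : s.msk = s'.msk) (hek : s.ek = s'.ek) (hCS : s.CS = s'.CS)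
    (hst : s.started = s'.started) (henc : s.encLog = s'.encLog) (hkey : s.keyLog = s'.keyLog)
    (hlab : s.labels = s'.labels) : s = s' := by
  cases s
  cases s'
  simp only at hmsk hek hCS hst henc hkey hlab
  subst hmsk hek hCS hst henc hkey hlab
  rfl

namespace Params

variable {P : Params} {κ : ℕ}

section Cons

variable {T : Fin (P.nmax κ) × Fin 2 → Option (BitVec κ)} {s : List (Val × Bool)} {ms : List Val}
  {m : Val} {a : Bool}

theorem keysOf_cons (ht : 2 ≤ tag m) : P.keysOf κ T ((m, a) :: s) = P.keysOf κ T s := by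
  funext i
  have h0 : tag m ≠ 0 := by omega
  have h1 : ¬ tag m < 2 := by omega
  simp [keysOf, isCor_cons, isReg_cons, h0, h1]

theorem encQueries_cons (ht : tag m ≠ 2 ∨ a = false) :
    P.encQueries κ ((m, a) :: s) = P.encQueries κ s := by
  unfold encQueries
  rw [List.filterMap_cons_none]
  rw [dif_neg]
  rintro ⟨⟨h1, h2⟩, -⟩
  rcases ht with ht | rfl
  · exact ht h1
  · exact Bool.noConfusion h2

theorem keyQueries_cons (ht : tag m ≠ 3 ∨ a = false) :
    P.keyQueries κ ((m, a) :: s) = P.keyQueries κ s := by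
  unfold keyQueries
  rw [List.filterMap_cons_none]
  rw [if_neg]
  rintro ⟨h1, h2⟩
  rcases ht with ht | rfl
  · exact ht h1
  · exact Bool.noConfusion h2

/-- Messages that are no queries do not change the state. -/
theorem toState_cons_other
    (ht : 3 < tag m ∨ tag m < 3 ∧ ¬ client m < P.nmax κ ∨
      tag m = 0 ∧ started (P.nmax κ) (annotate (P.nmax κ) ms) = true) :
    P.toState κ (T, m :: ms) = P.toState κ (T, ms) := by
  have hacc : accepted (P.nmax κ) (annotate (P.nmax κ) ms) m = false := by
    rw [Bool.eq_false_iff]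
    intro h
    rcases ht with h' | ⟨h', h''⟩ | ⟨h', h''⟩
    · exact absurd (tag_le_of_accepted h) (by omega)
    · rcases (show tag m = 0 ∨ tag m = 1 ∨ tag m = 2 by omega) with h0 | h0 | h0
      · rw [accepted_zero h0, Bool.and_eq_true, decide_eq_true_eq] at h
        exact h'' h.1
      · rw [accepted_one h0, decide_eq_true_eq] at h
        exact h'' h
      · rw [accepted_two h0, Bool.and_eq_true] at h
        exact h'' (lt_of_isReg h.1)
    · rw [accepted_zero h', h''] at h
      simp at h
  have h1 : (decide (tag m = 3) || ((decide (tag m = 1) || decide (tag m = 2)) &&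
      decide (client m < P.nmax κ))) = false := by
    rcases ht with h' | ⟨h', h''⟩ | ⟨h', h''⟩
    · simp [show tag m ≠ 3 by omega, show tag m ≠ 1 by omega, show tag m ≠ 2 by omega]
    · simp [show tag m ≠ 3 by omega, h'']
    · simp [h']
  have h2 : (decide (tag m = 3) || (decide (tag m = 2) && decide (client m < P.nmax κ))) =
      false := by
    rcases ht with h' | ⟨h', h''⟩ | ⟨h', h''⟩
    · simp [show tag m ≠ 3 by omega, show tag m ≠ 2 by omega]
    · simp [show tag m ≠ 3 by omega, h'']
    · simp [h']
  have hk : P.keysOf κ T (annotate (P.nmax κ) (m :: ms)) =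
      P.keysOf κ T (annotate (P.nmax κ) ms) := by
    funext i
    simp [keysOf, annotate, isCor_cons, isReg_cons, hacc]
  unfold toState
  dsimp only
  rw [hk]
  simp only [annotate, hacc, encQueries_cons (.inr rfl), keyQueries_cons (.inr rfl)]
  simp [isCor_cons, started_cons, h1, labelSet, h2]

end Cons

theorem labelSet_cons {n : ℕ} {s : List (Val × Bool)} {m : Val} {a : Bool}
    (h : tag m = 3 ∨ tag m = 2 ∧ client m < n) :
    labelSet n ((m, a) :: s) = insert (Label.ofCode (labelCode m)) (labelSet n s) := by
  unfold labelSet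
  rw [List.filter_cons_of_pos (by rcases h with h | h <;> simp [h]), List.map_cons,
    List.toFinset_cons]

theorem labelSet_cons_of_lt {n : ℕ} {s : List (Val × Bool)} {m : Val} {a : Bool}
    (h : tag m < 2) : labelSet n ((m, a) :: s) = labelSet n s := by
  unfold labelSet
  rw [List.filter_cons_of_neg (by simp; omega)]

theorem oracle_zero (b : Bool) (pp : PublicParams)
    (x : (Fin (P.nmax κ) × Fin 2 → Option (BitVec κ)) × List Val) (m : Val)
    (hx : P.KeysDrawn κ x) (ht : tag m = 0) :
    DyNMCFE.oracle (P.dyNo κ) pp b (P.toState κ x) m =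
      (P.realOracle κ b.toNat x m).map fun r => (r.1, P.toState κ r.2) := by
  obtain ⟨T, ms⟩ := x
  have hcl := client_of_lt (m := m) (by omega)
  unfold DyNMCFE.oracle
  rw [read_zero P κ ht]
  by_cases hc : m.snd.toNat < P.nmax κ
  swap
  · have hacc : accepted (P.nmax κ) (annotate (P.nmax κ) ms) m = false := by
      simp [accepted_zero ht, hcl, hc]
    simp only [dif_neg hc, realOracle, Comp.lazyOracle, keyNeed, hcl, PMF.pure_map, realAns,
      gameAns, hacc, Bool.false_eq_true, if_false]
    rw [toState_cons_other (.inr (.inl ⟨by omega, by rwa [hcl]⟩))]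
  rw [dif_pos hc]
  dsimp only
  unfold DyNMCFE.onCor
  by_cases hs : started (P.nmax κ) (annotate (P.nmax κ) ms) = true
  · have hacc : accepted (P.nmax κ) (annotate (P.nmax κ) ms) m = false := by
      simp [accepted_zero ht, hs]
    rw [if_pos (by exact hs)]
    simp only [realOracle, Comp.lazyOracle, keyNeed, hcl, PMF.pure_map, realAns, hs,
      gameAns, hacc, Bool.false_eq_true, if_false, dif_pos hc, ht, and_false, Bool.true_eq_false,
      false_and, zero_ne_one]
    rw [toState_cons_other (.inr (.inr ⟨ht, hs⟩))]
  rw [if_neg (by exact hs)]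
  have hs' : started (P.nmax κ) (annotate (P.nmax κ) ms) = false := by simpa using hs
  have hacc : accepted (P.nmax κ) (annotate (P.nmax κ) ms) m = true := by
    simp [accepted_zero ht, hcl, hc, hs']
  have hneed : P.keyNeed κ ms m = some (⟨m.snd.toNat, hc⟩, 0) := by
    simp [keyNeed, hcl, hc, ht, hs']
  have hcor : ∀ i, isCor (annotate (P.nmax κ) (m :: ms)) i =
      (decide (m.snd.toNat = i) || isCor (annotate (P.nmax κ) ms) i) := by
    simp [annotate, isCor_cons, hacc, ht, hcl]
  have hreg : ∀ i, isReg (annotate (P.nmax κ) (m :: ms)) i =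
      (decide (m.snd.toNat = i) || isReg (annotate (P.nmax κ) ms) i) := by
    simp [annotate, isReg_cons, hacc, ht, hcl]
  have hstart : started (P.nmax κ) (annotate (P.nmax κ) (m :: ms)) =
      started (P.nmax κ) (annotate (P.nmax κ) ms) := by
    simp [annotate, started_cons, ht]
  have henc : P.encQueries κ (annotate (P.nmax κ) (m :: ms)) =
      P.encQueries κ (annotate (P.nmax κ) ms) := encQueries_cons (.inl (by omega))
  have hkey : P.keyQueries κ (annotate (P.nmax κ) (m :: ms)) =
      P.keyQueries κ (annotate (P.nmax κ) ms) := keyQueries_cons (.inl (by omega))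
  have hlab : labelSet (P.nmax κ) (annotate (P.nmax κ) (m :: ms)) =
      labelSet (P.nmax κ) (annotate (P.nmax κ) ms) := labelSet_cons_of_lt (by omega)
  have hans : ∀ K : Fin (P.nmax κ) × Fin 2 → BitVec κ, P.realAns κ b.toNat K ms m =
      answer (.num (K (⟨m.snd.toNat, hc⟩, 0)).toNat) := by
    intro K
    simp [realAns, gameAns, hacc, reply, ht, keyFun, hcl, hc]
  have hek : (P.toState κ (T, ms)).ek (⟨m.snd.toNat, hc⟩ : Fin (P.nmax κ)) =
      T (⟨m.snd.toNat, hc⟩, 0) := by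
    change P.keysOf κ T (annotate (P.nmax κ) ms) ⟨m.snd.toNat, hc⟩ = _
    unfold keysOf
    by_cases h : isCor (annotate (P.nmax κ) ms) m.snd.toNat = true
    · rw [if_pos h]
    · rw [if_neg h, if_neg fun h' => h (isCor_of_isReg hs' h')]
      exact (Option.not_isSome_iff_eq_none.1 (mt (hx ⟨m.snd.toNat, hc⟩).1.1 h)).symm
  rw [hek]
  cases hT : T (⟨m.snd.toNat, hc⟩, 0) with
  | some k =>
    have h : isCor (annotate (P.nmax κ) ms) m.snd.toNat = true :=
      (hx ⟨m.snd.toNat, hc⟩).1.1 (by simp [hT])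
    have hst : P.toState κ (T, m :: ms) = P.toState κ (T, ms) := by
      have hcor' : ∀ i, isCor (annotate (P.nmax κ) (m :: ms)) i =
          isCor (annotate (P.nmax κ) ms) i := by
        intro i
        rw [hcor]
        by_cases hi : m.snd.toNat = i
        · subst hi
          simp [h]
        · simp [hi]
      have hreg' : ∀ i, isReg (annotate (P.nmax κ) (m :: ms)) i =
          isReg (annotate (P.nmax κ) ms) i := by
        intro i
        rw [hreg]
        by_cases hi : m.snd.toNat = i
        · subst hi
          simp [isReg_of_isCor h]
        · simp [hi]
      have hk : P.keysOf κ T (annotate (P.nmax κ) (m :: ms)) =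
          P.keysOf κ T (annotate (P.nmax κ) ms) := by
        funext i
        simp [keysOf, hcor', hreg']
      exact state_ext hk hk (Finset.filter_congr fun i _ => by rw [hcor']) hstart henc hkey hlab
    simp only [realOracle, Comp.lazyOracle, hneed, hT, PMF.pure_map, hans, hst, Option.getD_some]
    rfl
  | none =>
    have hst : ∀ k : BitVec κ,
        P.toState κ (Function.update T (⟨m.snd.toNat, hc⟩, 0) (some k), m :: ms) =
        { P.toState κ (T, ms) with
          msk := Function.update (P.keysOf κ T (annotate (P.nmax κ) ms)) ⟨m.snd.toNat, hc⟩ (some k)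
          ek := Function.update (P.keysOf κ T (annotate (P.nmax κ) ms)) ⟨m.snd.toNat, hc⟩ (some k)
          CS := insert (⟨m.snd.toNat, hc⟩ : Fin (P.nmax κ)) (P.toState κ (T, ms)).CS } := by
      intro k
      have hk : P.keysOf κ (Function.update T (⟨m.snd.toNat, hc⟩, 0) (some k))
          (annotate (P.nmax κ) (m :: ms)) = Function.update
            (P.keysOf κ T (annotate (P.nmax κ) ms)) ⟨m.snd.toNat, hc⟩ (some k) := by
        funext i
        by_cases hi : i = ⟨m.snd.toNat, hc⟩
        · subst hi
          simp [keysOf, hcor]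
        · have hi' : m.snd.toNat ≠ i := fun h => hi (Fin.ext h.symm)
          simp [keysOf, hcor, hreg, hi, hi']
      have hCS : (Finset.univ.filter fun i : Fin (P.nmax κ) =>
          isCor (annotate (P.nmax κ) (m :: ms)) i = true) = insert ⟨m.snd.toNat, hc⟩
            (Finset.univ.filter fun i : Fin (P.nmax κ) =>
              isCor (annotate (P.nmax κ) ms) i = true) := by
        ext i
        simp only [Finset.mem_filter, Finset.mem_univ, true_and, Finset.mem_insert, hcor,
          Bool.or_eq_true, decide_eq_true_eq, Fin.ext_iff, eq_comm (a := m.snd.toNat)]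
      exact state_ext hk hk hCS hstart henc hkey hlab
    simp only [realOracle, Comp.lazyOracle, hneed, hT, PMF.map_comp, dyNo]
    congr 1
    funext k
    simp only [Function.comp_apply, hans, hst, Function.update_self, Option.getD_some]
    rfl

theorem oracle_one (b : Bool) (pp : PublicParams)
    (x : (Fin (P.nmax κ) × Fin 2 → Option (BitVec κ)) × List Val) (m : Val)
    (hx : P.KeysDrawn κ x) (ht : tag m = 1) :
    DyNMCFE.oracle (P.dyNo κ) pp b (P.toState κ x) m =
      (P.realOracle κ b.toNat x m).map fun r => (r.1, P.toState κ r.2) := by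
  obtain ⟨T, ms⟩ := x
  have hcl := client_of_lt (m := m) (by omega)
  unfold DyNMCFE.oracle
  rw [read_one P κ ht]
  by_cases hc : m.snd.toNat < P.nmax κ
  swap
  · have hacc : accepted (P.nmax κ) (annotate (P.nmax κ) ms) m = false := by
      simp [accepted_one ht, hcl, hc]
    simp only [dif_neg hc, realOracle, Comp.lazyOracle, keyNeed, hcl, PMF.pure_map, realAns,
      gameAns, hacc, Bool.false_eq_true, if_false]
    rw [toState_cons_other (.inr (.inl ⟨by omega, by rwa [hcl]⟩))]
  rw [dif_pos hc]
  dsimp only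
  unfold DyNMCFE.onEKeyGen
  have hacc : accepted (P.nmax κ) (annotate (P.nmax κ) ms) m = true := by
    simp [accepted_one ht, hcl, hc]
  have hcor : ∀ i, isCor (annotate (P.nmax κ) (m :: ms)) i =
      isCor (annotate (P.nmax κ) ms) i := by
    simp [annotate, isCor_cons, ht]
  have hreg : ∀ i, isReg (annotate (P.nmax κ) (m :: ms)) i =
      (decide (m.snd.toNat = i) || isReg (annotate (P.nmax κ) ms) i) := by
    simp [annotate, isReg_cons, hacc, ht, hcl]
  have hstart : started (P.nmax κ) (annotate (P.nmax κ) (m :: ms)) = true := by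
    simp [annotate, started_cons, ht, hcl, hc]
  have henc : P.encQueries κ (annotate (P.nmax κ) (m :: ms)) =
      P.encQueries κ (annotate (P.nmax κ) ms) := encQueries_cons (.inl (by omega))
  have hkey : P.keyQueries κ (annotate (P.nmax κ) (m :: ms)) =
      P.keyQueries κ (annotate (P.nmax κ) ms) := keyQueries_cons (.inl (by omega))
  have hlab : labelSet (P.nmax κ) (annotate (P.nmax κ) (m :: ms)) =
      labelSet (P.nmax κ) (annotate (P.nmax κ) ms) := labelSet_cons_of_lt (by omega)
  have hans : ∀ K : Fin (P.nmax κ) × Fin 2 → BitVec κ, P.realAns κ b.toNat K ms m = ignored := by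
    intro K
    simp [realAns, gameAns, hacc, reply, ht]
  have hek : (P.toState κ (T, ms)).ek (⟨m.snd.toNat, hc⟩ : Fin (P.nmax κ)) =
      P.keysOf κ T (annotate (P.nmax κ) ms) ⟨m.snd.toNat, hc⟩ := rfl
  have hsome := isSome_keysOf hx ⟨m.snd.toNat, hc⟩
  dsimp only at hsome
  rw [hek]
  cases hT : P.keysOf κ T (annotate (P.nmax κ) ms) ⟨m.snd.toNat, hc⟩ with
  | some k =>
    have hr : isReg (annotate (P.nmax κ) ms) m.snd.toNat = true := by
      rw [← hsome, hT]
      rfl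
    have hneed : P.keyNeed κ ms m = none := by
      simp [keyNeed, hcl, ht, hr]
    have hst : P.toState κ (T, m :: ms) = { P.toState κ (T, ms) with started := true } := by
      have hreg' : ∀ i, isReg (annotate (P.nmax κ) (m :: ms)) i =
          isReg (annotate (P.nmax κ) ms) i := by
        intro i
        rw [hreg]
        by_cases hi : m.snd.toNat = i
        · subst hi
          simp [hr]
        · simp [hi]
      have hk : P.keysOf κ T (annotate (P.nmax κ) (m :: ms)) =
          P.keysOf κ T (annotate (P.nmax κ) ms) := by
        funext i
        simp [keysOf, hcor, hreg']
      exact state_ext hk hk (Finset.filter_congr fun i _ => by rw [hcor]) hstart henc hkey hlab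
    simp only [realOracle, Comp.lazyOracle, hneed, PMF.pure_map, hans, hst]
  | none =>
    have hr : isReg (annotate (P.nmax κ) ms) m.snd.toNat = false := by
      rw [← hsome, hT]
      rfl
    have hc' : isCor (annotate (P.nmax κ) ms) m.snd.toNat = false := by
      rw [Bool.eq_false_iff]
      intro h
      rw [isReg_of_isCor h] at hr
      exact Bool.noConfusion hr
    have hneed : P.keyNeed κ ms m = some (⟨m.snd.toNat, hc⟩, 1) := by
      simp [keyNeed, hcl, hc, ht, hr]
    have hT1 : T (⟨m.snd.toNat, hc⟩, 1) = none := by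
      refine Option.not_isSome_iff_eq_none.1 (mt (hx ⟨m.snd.toNat, hc⟩).2.1 ?_)
      simp [hr]
    have hst : ∀ k : BitVec κ,
        P.toState κ (Function.update T (⟨m.snd.toNat, hc⟩, 1) (some k), m :: ms) =
        { P.toState κ (T, ms) with
          started := true
          msk := Function.update (P.keysOf κ T (annotate (P.nmax κ) ms)) ⟨m.snd.toNat, hc⟩ (some k)
          ek := Function.update (P.keysOf κ T (annotate (P.nmax κ) ms)) ⟨m.snd.toNat, hc⟩
            (some k) } := by
      intro k
      have hk : P.keysOf κ (Function.update T (⟨m.snd.toNat, hc⟩, 1) (some k))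
          (annotate (P.nmax κ) (m :: ms)) = Function.update
            (P.keysOf κ T (annotate (P.nmax κ) ms)) ⟨m.snd.toNat, hc⟩ (some k) := by
        funext i
        by_cases hi : i = ⟨m.snd.toNat, hc⟩
        · subst hi
          simp [keysOf, hcor, hreg, hc']
        · have hi' : m.snd.toNat ≠ i := fun h => hi (Fin.ext h.symm)
          simp [keysOf, hcor, hreg, hi, hi']
      exact state_ext hk hk (Finset.filter_congr fun i _ => by rw [hcor]) hstart henc hkey hlab
    simp only [realOracle, Comp.lazyOracle, hneed, hT1, PMF.map_comp, dyNo]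
    congr 1
    funext k
    simp only [Function.comp_apply, hans, hst]
    rfl

theorem oracle_two (b : Bool) (pp : PublicParams)
    (x : (Fin (P.nmax κ) × Fin 2 → Option (BitVec κ)) × List Val) (m : Val)
    (hx : P.KeysDrawn κ x) (ht : tag m = 2) :
    DyNMCFE.oracle (P.dyNo κ) pp b (P.toState κ x) m =
      (P.realOracle κ b.toNat x m).map fun r => (r.1, P.toState κ r.2) := by
  obtain ⟨T, ms⟩ := x
  have hcl := client_of_two ht
  have hll : labelCode m = (m.snd.nth 1).toNat := by simp [labelCode, ht]
  have hneed : P.keyNeed κ ms m = none := by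
    simp [keyNeed, ht]
  unfold DyNMCFE.oracle
  rw [read_two P κ ht]
  by_cases hc : (m.snd.nth 0).toNat < P.nmax κ
  swap
  · have hacc : accepted (P.nmax κ) (annotate (P.nmax κ) ms) m = false := by
      rw [accepted_two ht, Bool.eq_false_iff]
      intro h
      rw [Bool.and_eq_true, hcl] at h
      exact hc (lt_of_isReg h.1)
    simp only [dif_neg hc, realOracle, Comp.lazyOracle, hneed, PMF.pure_map, realAns,
      gameAns, hacc, Bool.false_eq_true, if_false]
    rw [toState_cons_other (.inr (.inl ⟨by omega, by rwa [hcl]⟩))]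
  rw [dif_pos hc]
  dsimp only
  unfold DyNMCFE.onEnc
  have hcor : ∀ i, isCor (annotate (P.nmax κ) (m :: ms)) i =
      isCor (annotate (P.nmax κ) ms) i := by
    simp [annotate, isCor_cons, ht]
  have hstart : started (P.nmax κ) (annotate (P.nmax κ) (m :: ms)) = true := by
    simp [annotate, started_cons, ht, hcl, hc]
  have hkey : P.keyQueries κ (annotate (P.nmax κ) (m :: ms)) =
      P.keyQueries κ (annotate (P.nmax κ) ms) := keyQueries_cons (.inl (by omega))
  have hlab : labelSet (P.nmax κ) (annotate (P.nmax κ) (m :: ms)) =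
      insert (P.encQuery κ m hc).ℓ (labelSet (P.nmax κ) (annotate (P.nmax κ) ms)) := by
    rw [annotate, labelSet_cons (.inr ⟨ht, by rwa [hcl]⟩), hll]
    rfl
  have hk : P.keysOf κ T (annotate (P.nmax κ) (m :: ms)) =
      P.keysOf κ T (annotate (P.nmax κ) ms) := keysOf_cons (by omega)
  have hek : (P.toState κ (T, ms)).ek (P.encQuery κ m hc).i =
      P.keysOf κ T (annotate (P.nmax κ) ms) ⟨(m.snd.nth 0).toNat, hc⟩ := rfl
  have hsome := isSome_keysOf hx ⟨(m.snd.nth 0).toNat, hc⟩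
  dsimp only at hsome
  have hrej : accepted (P.nmax κ) (annotate (P.nmax κ) ms) m = false →
      (P.realOracle κ b.toNat (T, ms) m).map (fun r => (r.1, P.toState κ r.2)) =
        PMF.pure (ignored, { P.toState κ (T, ms) with
          started := true
          labels := insert (P.encQuery κ m hc).ℓ (P.toState κ (T, ms)).labels }) := by
    intro hacc
    have hst : P.toState κ (T, m :: ms) = { P.toState κ (T, ms) with
          started := true
          labels := insert (P.encQuery κ m hc).ℓ (P.toState κ (T, ms)).labels } :=
      state_ext hk hk (Finset.filter_congr fun i _ => by rw [hcor]) hstart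
        (encQueries_cons (.inr hacc)) hkey hlab
    simp only [realOracle, Comp.lazyOracle, hneed, PMF.pure_map, hst, realAns, gameAns, hacc,
      Bool.false_eq_true, if_false]
  rw [hek]
  cases hT : P.keysOf κ T (annotate (P.nmax κ) ms) ⟨(m.snd.nth 0).toNat, hc⟩ with
  | none =>
    have hr : isReg (annotate (P.nmax κ) ms) (m.snd.nth 0).toNat = false := by
      rw [← hsome, hT]
      rfl
    rw [hrej (by simp [accepted_two ht, hcl, hr])]
  | some k =>
    have hr : isReg (annotate (P.nmax κ) ms) (m.snd.nth 0).toNat = true := by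
      rw [← hsome, hT]
      rfl
    have hex : (∃ Q' ∈ (P.toState κ (T, ms)).encLog, Q'.i = (P.encQuery κ m hc).i ∧
        Q'.ℓ = (P.encQuery κ m hc).ℓ) ↔ hasEnc (annotate (P.nmax κ) ms) (m.snd.nth 0).toNat
          (m.snd.nth 1).toNat = true :=
      exists_encQueries_iff (i := ⟨(m.snd.nth 0).toNat, hc⟩)
    dsimp only
    by_cases he : hasEnc (annotate (P.nmax κ) ms) (m.snd.nth 0).toNat (m.snd.nth 1).toNat = true
    · rw [if_pos (hex.2 he), hrej (by simp [accepted_two ht, hcl, hll, he])]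
    · rw [if_neg (mt hex.1 he)]
      have hacc : accepted (P.nmax κ) (annotate (P.nmax κ) ms) m = true := by
        simp [accepted_two ht, hcl, hr, hll, he]
      have henc : P.encQueries κ (annotate (P.nmax κ) (m :: ms)) =
          P.encQuery κ m hc :: P.encQueries κ (annotate (P.nmax κ) ms) := by
        unfold encQueries
        rw [annotate, List.filterMap_cons_some (dif_pos ⟨⟨ht, hacc⟩, hc⟩)]
      have hst : P.toState κ (T, m :: ms) = { P.toState κ (T, ms) with
          started := true
          labels := insert (P.encQuery κ m hc).ℓ (P.toState κ (T, ms)).labels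
          encLog := P.encQuery κ m hc :: (P.toState κ (T, ms)).encLog } :=
        state_ext hk hk (Finset.filter_congr fun i _ => by rw [hcor]) hstart henc hkey hlab
      simp only [realOracle, Comp.lazyOracle, hneed, PMF.pure_map, hst, dyNo]
      rw [← encQuery_answer b ht hc hT hacc]
      congr

theorem oracle_three (b : Bool) (pp : PublicParams)
    (x : (Fin (P.nmax κ) × Fin 2 → Option (BitVec κ)) × List Val) (m : Val)
    (hx : P.KeysDrawn κ x) (ht : tag m = 3) :
    DyNMCFE.oracle (P.dyNo κ) pp b (P.toState κ x) m =
      (P.realOracle κ b.toNat x m).map fun r => (r.1, P.toState κ r.2) := by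
  obtain ⟨T, ms⟩ := x
  have hll : labelCode m = (m.snd.nth 0).toNat := by simp [labelCode, ht]
  have hneed : P.keyNeed κ ms m = none := by
    simp [keyNeed, ht]
  unfold DyNMCFE.oracle
  rw [read_three P κ ht]
  dsimp only
  unfold DyNMCFE.onKeyGen
  have hcor : ∀ i, isCor (annotate (P.nmax κ) (m :: ms)) i =
      isCor (annotate (P.nmax κ) ms) i := by
    simp [annotate, isCor_cons, ht]
  have hstart : started (P.nmax κ) (annotate (P.nmax κ) (m :: ms)) = true := by
    simp [annotate, started_cons, ht]
  have henc : P.encQueries κ (annotate (P.nmax κ) (m :: ms)) =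
      P.encQueries κ (annotate (P.nmax κ) ms) := encQueries_cons (.inl (by omega))
  have hlab : labelSet (P.nmax κ) (annotate (P.nmax κ) (m :: ms)) =
      insert (P.keyQuery κ m).ℓ (labelSet (P.nmax κ) (annotate (P.nmax κ) ms)) := by
    rw [annotate, labelSet_cons (.inl ht), hll]
    rfl
  have hk : P.keysOf κ T (annotate (P.nmax κ) (m :: ms)) =
      P.keysOf κ T (annotate (P.nmax κ) ms) := keysOf_cons (by omega)
  have hiff : (∀ i ∈ famSupport (P.nmax κ) (m.snd.nth 1),
      (P.keysOf κ T (annotate (P.nmax κ) ms) i).isSome) ↔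
        accepted (P.nmax κ) (annotate (P.nmax κ) ms) m = true := by
    rw [accepted_three ht, List.all_eq_true]
    constructor
    · intro h i hi
      have hi' := List.mem_range.1 hi
      by_cases hs : inSupport m i = true
      · rw [← isSome_keysOf hx ⟨i, hi'⟩, h ⟨i, hi'⟩ (by simpa [famSupport, inSupport] using hs)]
        simp
      · simp [hs]
    · intro h i hi
      have hs : inSupport m i = true := by simpa [famSupport, inSupport] using hi
      have := h i (List.mem_range.2 i.2)
      rw [hs, Bool.not_true, Bool.false_or] at this
      rw [isSome_keysOf hx i, this]
  by_cases hacc : accepted (P.nmax κ) (annotate (P.nmax κ) ms) m = true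
  · have hall := hiff.2 hacc
    have hkey : P.keyQueries κ (annotate (P.nmax κ) (m :: ms)) =
        P.keyQuery κ m :: P.keyQueries κ (annotate (P.nmax κ) ms) := by
      unfold keyQueries
      rw [annotate]
      exact List.filterMap_cons_some (if_pos (And.intro ht hacc))
    have hst : P.toState κ (T, m :: ms) = { P.toState κ (T, ms) with
        started := true
        labels := insert (P.keyQuery κ m).ℓ (P.toState κ (T, ms)).labels
        keyLog := P.keyQuery κ m :: (P.toState κ (T, ms)).keyLog } :=
      state_ext hk hk (Finset.filter_congr fun i _ => by rw [hcor]) hstart henc hkey hlab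
    rw [if_pos (by exact hall)]
    have hkg : (P.dyNo κ).keygen pp (P.toState κ (T, ms)).msk (P.keyQuery κ m).S
        (P.keyQuery κ m).ℓ (P.keyQuery κ m).f (PMF.pure ((P.keyQuery κ m).ν b)) = PMF.pure
        (some (⟨fun i => Vec.ofVal _ _ ((m.snd.nth 1).nth i.1.1).snd,
          (∑ i : famSupport (P.nmax κ) (m.snd.nth 1),
            P.pad κ ((P.keysOf κ T (annotate (P.nmax κ) ms) i.1).get (hall i.1 i.2))
              (Label.ofCode (m.snd.nth 0).toNat) ⬝ᵥ Vec.ofVal _ _ ((m.snd.nth 1).nth i.1.1).snd) -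
            if b = true then (((m.snd.nth 3).toNat : ℕ) : ZMod (P.q κ)) else
              ((m.snd.nth 2).toNat : ZMod (P.q κ))⟩ : P.DecKey κ
                (Label.ofCode (m.snd.nth 0).toNat) (famSupport (P.nmax κ) (m.snd.nth 1)))) :=
      (dif_pos (c := ∀ i : famSupport (P.nmax κ) (m.snd.nth 1),
        (P.keysOf κ T (annotate (P.nmax κ) ms) i.1).isSome = true)
        fun i => hall i.1 i.2).trans (PMF.pure_map _ _)
    rw [hkg]
    refine (PMF.pure_map _ _).trans ?_
    simp only [realOracle, Comp.lazyOracle, hneed, PMF.pure_map, hst]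
    rw [← keyQuery_answer b ht (fun i => hall i.1 i.2) hacc]
    congr
  · have hacc' : accepted (P.nmax κ) (annotate (P.nmax κ) ms) m = false := by simpa using hacc
    have hst : P.toState κ (T, m :: ms) = { P.toState κ (T, ms) with
        started := true
        labels := insert (P.keyQuery κ m).ℓ (P.toState κ (T, ms)).labels } :=
      state_ext hk hk (Finset.filter_congr fun i _ => by rw [hcor]) hstart henc
        (keyQueries_cons (.inr hacc')) hlab
    rw [if_neg (by exact mt hiff.1 hacc)]
    simp only [realOracle, Comp.lazyOracle, hneed, PMF.pure_map, hst, realAns, gameAns, hacc',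
      Bool.false_eq_true, if_false]

/-- The challenger answers like `realOracle`, and its state is a function of the state of
`realOracle`. -/
theorem oracle_toState (b : Bool) (pp : PublicParams)
    (x : (Fin (P.nmax κ) × Fin 2 → Option (BitVec κ)) × List Val) (m : Val)
    (hx : P.KeysDrawn κ x) :
    DyNMCFE.oracle (P.dyNo κ) pp b (P.toState κ x) m =
      (P.realOracle κ b.toNat x m).map fun r => (r.1, P.toState κ r.2) := by
  rcases (show tag m = 0 ∨ tag m = 1 ∨ tag m = 2 ∨ tag m = 3 ∨ 3 < tag m by omega) with
    ht | ht | ht | ht | ht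
  · exact oracle_zero b pp x m hx ht
  · exact oracle_one b pp x m hx ht
  · exact oracle_two b pp x m hx ht
  · exact oracle_three b pp x m hx ht
  · obtain ⟨T, ms⟩ := x
    have hneed : P.keyNeed κ ms m = none := by
      simp [keyNeed, show tag m ≠ 0 by omega, show tag m ≠ 1 by omega]
    have hacc : accepted (P.nmax κ) (annotate (P.nmax κ) ms) m = false := by
      rw [Bool.eq_false_iff]
      exact fun h => absurd (tag_le_of_accepted h) (by omega)
    unfold DyNMCFE.oracle
    rw [read_other P κ ht]
    simp only [realOracle, Comp.lazyOracle, hneed, PMF.pure_map, realAns, gameAns, hacc,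
      Bool.false_eq_true, if_false]
    rw [toState_cons_other (.inl ht)]

/-- The places of the keys that have been drawn after the messages `ms`. -/
def HasKey (P : Params) (κ : ℕ) (ms : List Val) (x : Fin (P.nmax κ) × Fin 2) : Prop :=
  if x.2 = 0 then isCor (annotate (P.nmax κ) ms) x.1 = true
  else isReg (annotate (P.nmax κ) ms) x.1 = true ∧ isCor (annotate (P.nmax κ) ms) x.1 = false

theorem keysDrawn_iff {x : (Fin (P.nmax κ) × Fin 2 → Option (BitVec κ)) × List Val} :
    P.KeysDrawn κ x ↔ ∀ y, (x.1 y).isSome ↔ P.HasKey κ x.2 y := by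
  constructor
  · rintro h ⟨i, c⟩
    unfold HasKey
    fin_cases c
    · exact (h i).1
    · exact (h i).2
  · intro h i
    exact ⟨by simpa [HasKey] using h (i, 0), by simpa [HasKey] using h (i, 1)⟩

/-- Each message adds at most the key that `keyNeed` asks for. -/
theorem hasKey_cons (ms : List Val) (m : Val) (x : Fin (P.nmax κ) × Fin 2) :
    P.HasKey κ (m :: ms) x ↔ P.HasKey κ ms x ∨ P.keyNeed κ ms m = some x := by
  obtain ⟨i, c⟩ := x
  have hneed0 : P.keyNeed κ ms m = some (i, 0) ↔ tag m = 0 ∧ client m = i ∧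
      started (P.nmax κ) (annotate (P.nmax κ) ms) = false := by
    unfold keyNeed
    by_cases hc : client m < P.nmax κ
    · rw [dif_pos hc]
      split_ifs with h1 h2
      · simp [h1, Fin.ext_iff]
      · simp [h2]
      · simp only [reduceCtorEq, false_iff]
        exact fun h => h1 ⟨h.1, h.2.2⟩
    · rw [dif_neg hc]
      refine iff_of_false (by simp) ?_
      exact fun h => hc (h.2.1 ▸ i.2)
  have hneed1 : P.keyNeed κ ms m = some (i, 1) ↔ tag m = 1 ∧ client m = i ∧
      isReg (annotate (P.nmax κ) ms) i = false := by
    unfold keyNeed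
    by_cases hc : client m < P.nmax κ
    · rw [dif_pos hc]
      split_ifs with h1 h2
      · simp [h1]
      · simp only [Option.some.injEq, Prod.mk.injEq, Fin.ext_iff, and_true, h2.1, true_and]
        exact ⟨fun h => ⟨h, h ▸ h2.2⟩, fun h => h.1⟩
      · simp only [reduceCtorEq, false_iff]
        rintro ⟨h3, h4, h5⟩
        exact h2 ⟨h3, h4 ▸ h5⟩
    · rw [dif_neg hc]
      refine iff_of_false (by simp) ?_
      exact fun h => hc (h.2.1 ▸ i.2)
  have hcor : isCor (annotate (P.nmax κ) (m :: ms)) i = true ↔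
      (tag m = 0 ∧ client m = i ∧ started (P.nmax κ) (annotate (P.nmax κ) ms) = false) ∨
        isCor (annotate (P.nmax κ) ms) i = true := by
    rw [annotate, isCor_cons, Bool.or_eq_true]
    refine or_congr ?_ Iff.rfl
    simp only [Bool.and_eq_true, decide_eq_true_eq]
    constructor
    · rintro ⟨h1, h2, h3⟩
      rw [accepted_zero h1] at h2
      simp only [Bool.and_eq_true, decide_eq_true_eq, Bool.not_eq_true'] at h2
      exact ⟨h1, h3, h2.2⟩
    · rintro ⟨h1, h2, h3⟩
      rw [accepted_zero h1, h3, h2]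
      simp [h1]
  have hreg : isReg (annotate (P.nmax κ) (m :: ms)) i = true ↔
      (tag m = 0 ∧ client m = i ∧ started (P.nmax κ) (annotate (P.nmax κ) ms) = false) ∨
      (tag m = 1 ∧ client m = i) ∨ isReg (annotate (P.nmax κ) ms) i = true := by
    rw [annotate, isReg_cons, Bool.or_eq_true, ← or_assoc]
    refine or_congr ?_ Iff.rfl
    simp only [Bool.and_eq_true, decide_eq_true_eq]
    constructor
    · rintro ⟨h1, h2, h3⟩
      rcases (show tag m = 0 ∨ tag m = 1 by omega) with ht | ht
      · rw [accepted_zero ht] at h2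
        simp only [Bool.and_eq_true, decide_eq_true_eq, Bool.not_eq_true'] at h2
        exact .inl ⟨ht, h3, h2.2⟩
      · exact .inr ⟨ht, h3⟩
    · rintro (⟨h1, h2, h3⟩ | ⟨h1, h2⟩)
      · rw [accepted_zero h1, h3, h2]
        simp [h1]
      · rw [accepted_one h1, h2]
        simp [h1]
  have hreg' : isCor (annotate (P.nmax κ) ms) i = true →
      isReg (annotate (P.nmax κ) ms) i = true := isReg_of_isCor
  have hstat : started (P.nmax κ) (annotate (P.nmax κ) ms) = false →
      isReg (annotate (P.nmax κ) ms) i = true → isCor (annotate (P.nmax κ) ms) i = true :=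
    isCor_of_isReg
  unfold HasKey
  fin_cases c
  · simp only [Fin.zero_eta, if_true]
    rw [hcor, hneed0, or_comm]
  · simp only [Fin.mk_one, Fin.isValue, one_ne_zero, if_false]
    rw [hneed1, ← Bool.not_eq_true, hcor, hreg, ← Bool.not_eq_true, ← Bool.not_eq_true]
    have h01 : tag m = 0 → ¬ tag m = 1 := by omega
    clear hneed0 hneed1 hcor hreg
    rw [← Bool.not_eq_true] at hstat ⊢
    generalize (isCor (annotate (P.nmax κ) ms) i = true) = C at *
    generalize (isReg (annotate (P.nmax κ) ms) i = true) = R at *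
    generalize (started (P.nmax κ) (annotate (P.nmax κ) ms) = true) = S at *
    generalize (tag m = 0) = t0 at *
    generalize (tag m = 1) = t1 at *
    generalize (client m = i) = c at *
    by_cases C <;> by_cases R <;> by_cases S <;> by_cases t0 <;> by_cases t1 <;> by_cases c <;>
      simp_all

theorem keysDrawn_oracle (b : ℕ) (x : (Fin (P.nmax κ) × Fin 2 → Option (BitVec κ)) × List Val)
    (m : Val) (hx : P.KeysDrawn κ x) :
    ∀ r ∈ (P.realOracle κ b x m).support, P.KeysDrawn κ r.2 := by
  obtain ⟨T, ms⟩ := x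
  rw [keysDrawn_iff] at hx
  intro r hr
  rw [keysDrawn_iff]
  unfold realOracle Comp.lazyOracle at hr
  dsimp only at hr hx
  cases hn : P.keyNeed κ ms m with
  | none =>
    rw [hn] at hr
    rw [PMF.support_pure, Set.mem_singleton_iff] at hr
    subst hr
    intro y
    rw [hx y, hasKey_cons, hn]
    simp
  | some i =>
    rw [hn] at hr
    dsimp only at hr
    cases hT : T i with
    | some v =>
      rw [hT] at hr
      rw [PMF.support_pure, Set.mem_singleton_iff] at hr
      subst hr
      intro y
      rw [hx y, hasKey_cons, hn, iff_self_or, Option.some.injEq]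
      rintro rfl
      exact (hx i).1 (by simp [hT])
    | none =>
      rw [hT] at hr
      rw [PMF.support_map] at hr
      obtain ⟨v, -, rfl⟩ := hr
      intro y
      dsimp only
      rw [hasKey_cons, hn, ← hx y, Option.some.injEq]
      by_cases hy : y = i
      · subst hy
        simp
      · simp [hy, Ne.symm hy]

/-- The input of the adversary. -/
def startVal (P : Params) (κ : ℕ) : Val :=
  .ofList [.num (P.q κ), .num (P.mmax κ), .num (P.nmax κ)]

/-- The real game in terms of lazily drawn keys. -/
theorem exec_eq (A : PPT) (b : Bool) : (P.dyNo κ).exec A κ b =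
    ((A.comp κ (P.startVal κ)).run (P.realOracle κ b.toNat) (fun _ => none, [])).map
      fun r => (r.1, P.toState κ r.2) := by
  unfold DyNMCFE.exec
  refine (PMF.pure_bind _ _).trans ?_
  have h0 : P.KeysDrawn κ (fun _ => none, []) := by
    intro i
    simp [annotate, isCor, isReg]
  rw [← Comp.run_map (φ := P.toState κ) (fun s m hs => oracle_toState b ⟨_, _, _⟩ s m hs)
    (fun s m hs => keysDrawn_oracle _ s m hs) _ _ h0]
  congr 1
  refine state_ext ?_ ?_ ?_ rfl rfl rfl rfl
  · funext i
    exact (by simp [keysOf, annotate, isCor, isReg] :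
      none = P.keysOf κ (fun _ => none) (annotate (P.nmax κ) []) i)
  · funext i
    exact (by simp [keysOf, annotate, isCor, isReg] :
      none = P.keysOf κ (fun _ => none) (annotate (P.nmax κ) []) i)
  · exact (Finset.filter_eq_empty_iff.2 fun i _ => by simp [annotate, isCor]).symm

/-- The entry with index `j` of the plaintext `x^β`. -/
def coord (Q : EncQuery (P.family κ)) (β : Bool) (j : ℕ) : ZMod (P.q κ) :=
  if h : j < P.len κ Q.ℓ then (show Vec (P.q κ) (P.len κ Q.ℓ) from Q.x β) ⟨j, h⟩ else 0

theorem ofCode_injective {l l' : ℕ} (h : Label.ofCode l = Label.ofCode l') : l = l' := by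
  rw [← Label.code_ofCode l, h, Label.code_ofCode]

theorem encQuery_x (m : Val) (h : (m.snd.nth 0).toNat < P.nmax κ) (β : Bool) :
    (P.encQuery κ m h).x β = show Vec (P.q κ) (P.len κ (Label.ofCode (m.snd.nth 1).toNat)) from
      fun j => (plain β.toNat m j : ZMod (P.q κ)) := by
  cases β <;> rfl

/-- `encMsg` finds the answered encryption query of a client under a label. -/
theorem mem_encQueries_of_hasEnc {ms : List Val} {i : Fin (P.nmax κ)} {l : ℕ}
    (h : hasEnc (annotate (P.nmax κ) ms) i l = true) :
    (⟨i, Label.ofCode l, fun β => show Vec (P.q κ) (P.len κ (Label.ofCode l)) from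
      fun j => (plain β.toNat (encMsg (annotate (P.nmax κ) ms) i l) j : ZMod (P.q κ))⟩ :
        EncQuery (P.family κ)) ∈ P.encQueries κ (annotate (P.nmax κ) ms) := by
  obtain ⟨m, hm, ht, hc, hl⟩ := mem_of_hasEnc h
  have hm' := encMsg_eq hm ht
  rw [hc, hl] at hm'
  rw [hm']
  rw [client_of_two ht] at hc
  have hl' : labelCode m = (m.snd.nth 1).toNat := by simp [labelCode, ht]
  rw [hl'] at hl
  obtain ⟨i, hi⟩ := i
  dsimp only at hc
  subst hc hl
  refine mem_encQueries.2 ⟨m, hi, hm, ht, ?_⟩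
  unfold encQuery
  congr 1
  funext β
  cases β <;> rfl

/-- An answered encryption query is unique, given the client and the label. -/
theorem eq_plain_of_mem {ms : List Val} {i : Fin (P.nmax κ)} {l : ℕ}
    {x : Bool → Vec (P.q κ) (P.len κ (Label.ofCode l))}
    (h : (⟨i, Label.ofCode l, x⟩ : EncQuery (P.family κ)) ∈
      P.encQueries κ (annotate (P.nmax κ) ms)) (β : Bool) (j) :
    x β j = (plain β.toNat (encMsg (annotate (P.nmax κ) ms) i l) j : ZMod (P.q κ)) := by
  obtain ⟨m, hi, hm, ht, heq⟩ := mem_encQueries.1 h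
  have h1 : (⟨(m.snd.nth 0).toNat, hi⟩ : Fin (P.nmax κ)) = i := congrArg EncQuery.i heq
  have h2 : (m.snd.nth 1).toNat = l := ofCode_injective (congrArg EncQuery.ℓ heq)
  have h3 := congrArg (fun Q => coord Q β j) heq
  have hl' : labelCode m = (m.snd.nth 1).toNat := by simp [labelCode, ht]
  have hm' := encMsg_eq hm ht
  rw [client_of_two ht, hl'] at hm'
  subst h1 h2
  rw [hm']
  have h4 : coord (⟨⟨(m.snd.nth 0).toNat, hi⟩, Label.ofCode (m.snd.nth 1).toNat, x⟩ :
    EncQuery (P.family κ)) β j = x β j := dif_pos j.2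
  have h5 : coord (P.encQuery κ m hi) β j = (plain β.toNat m j : ZMod (P.q κ)) := by
    refine (dif_pos j.2).trans ?_
    cases β <;> rfl
  exact h4.symm.trans (h3.symm.trans h5)

theorem mem_support_iff {m : Val} {i : Fin (P.nmax κ)} :
    i ∈ famSupport (P.nmax κ) (m.snd.nth 1) ↔ inSupport m i = true := by
  simp [famSupport, inSupport]

/-- The two sides of the balance condition of the game, in terms of `balance`. -/
theorem apply_add_eq {ms : List Val} {m : Val}
    {x : Bool → famSupport (P.nmax κ) (m.snd.nth 1) →
      Vec (P.q κ) (P.len κ (Label.ofCode (labelCode m)))}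
    (hx : ∀ β i, isCor (annotate (P.nmax κ) ms) i.1 = false → ∀ j, x β i j =
      (plain β.toNat (encMsg (annotate (P.nmax κ) ms) i.1 (labelCode m)) j : ZMod (P.q κ)))
    (hx' : ∀ i, isCor (annotate (P.nmax κ) ms) i.1 = true → x false i = x true i) :
    ∃ c : ZMod (P.q κ), ∀ β, (∑ i, x β i ⬝ᵥ Vec.ofVal (P.q κ)
        (P.len κ (Label.ofCode (labelCode m))) ((m.snd.nth 1).nth i.1.1).snd) +
      (noise β.toNat m : ZMod (P.q κ)) =
      (balance (P.nmax κ) (P.len κ (Label.ofCode (labelCode m))) β.toNat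
        (annotate (P.nmax κ) ms) m : ZMod (P.q κ)) + c := by
  classical
  let g (β : Bool) (i : Fin (P.nmax κ)) : ZMod (P.q κ) :=
    if h : i ∈ famSupport (P.nmax κ) (m.snd.nth 1) then x β ⟨i, h⟩ ⬝ᵥ Vec.ofVal (P.q κ)
        (P.len κ (Label.ofCode (labelCode m))) ((m.snd.nth 1).nth i).snd else 0
  refine ⟨∑ i : Fin (P.nmax κ),
    if isCor (annotate (P.nmax κ) ms) i = true then g false i else 0, fun β => ?_⟩
  have hg : (∑ i, x β i ⬝ᵥ Vec.ofVal (P.q κ)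
      (P.len κ (Label.ofCode (labelCode m))) ((m.snd.nth 1).nth i.1.1).snd) =
      ∑ i : Fin (P.nmax κ), g β i := by
    rw [← Finset.sum_subset (Finset.subset_univ (famSupport (P.nmax κ) (m.snd.nth 1)))
      (fun i _ hi => dif_neg hi), ← Finset.sum_coe_sort (famSupport (P.nmax κ) (m.snd.nth 1))]
    exact Finset.sum_congr rfl fun i _ => by simp only [dif_pos i.2]
  rw [hg, cast_balance, Finset.sum_range, add_right_comm, ← Finset.sum_add_distrib]
  congr 1
  refine Finset.sum_congr rfl fun i _ => ?_
  by_cases hs : i ∈ famSupport (P.nmax κ) (m.snd.nth 1)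
  · have hs' := mem_support_iff.1 hs
    by_cases hc : isCor (annotate (P.nmax κ) ms) i = true
    · simp only [g, dif_pos hs, hs', hc, Bool.not_true, Bool.and_false, if_true, zero_add,
        Bool.false_eq_true, if_false]
      cases β
      · rfl
      · rw [hx' ⟨i, hs⟩ hc]
    · have hc' : isCor (annotate (P.nmax κ) ms) i = false := by simpa using hc
      simp only [g, dif_pos hs, hs', hc', Bool.not_false, Bool.and_true, if_true, add_zero,
        Bool.false_eq_true, if_false]
      rw [dotProduct, Finset.sum_range]
      refine Finset.sum_congr rfl fun j _ => ?_
      rw [hx β ⟨i, hs⟩ hc' j]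
      rfl
  · have hs' : inSupport m i = false := by simpa [mem_support_iff] using hs
    simp [g, dif_neg hs, hs']

/-- The balance condition of the game, which quantifies over the plaintexts of corrupted clients, in
terms of the executable test `balance`. -/
theorem balanced_iff {ms : List Val} {m : Val} {l : ℕ}
    (hl : labelCode m = l)
    (hcomp : ∀ i : Fin (P.nmax κ), inSupport m i = true →
      isCor (annotate (P.nmax κ) ms) i = false →
      hasEnc (annotate (P.nmax κ) ms) i l = true) :
    (∀ x : Bool → famSupport (P.nmax κ) (m.snd.nth 1) →
        Vec (P.q κ) (P.len κ (Label.ofCode l)),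
      (∀ i : famSupport (P.nmax κ) (m.snd.nth 1), isCor (annotate (P.nmax κ) ms) i.1 = false →
        (⟨i.1, Label.ofCode l, fun β => x β i⟩ : EncQuery (P.family κ)) ∈
          P.encQueries κ (annotate (P.nmax κ) ms)) →
      (∀ i : famSupport (P.nmax κ) (m.snd.nth 1), isCor (annotate (P.nmax κ) ms) i.1 = true →
        x false i = x true i) →
      (∑ i, x false i ⬝ᵥ Vec.ofVal (P.q κ) (P.len κ (Label.ofCode l))
          ((m.snd.nth 1).nth i.1.1).snd) + (noise 0 m : ZMod (P.q κ)) =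
        (∑ i, x true i ⬝ᵥ Vec.ofVal (P.q κ) (P.len κ (Label.ofCode l))
          ((m.snd.nth 1).nth i.1.1).snd) + (noise 1 m : ZMod (P.q κ))) ↔
    balance (P.nmax κ) (P.len κ (Label.ofCode l)) 0 (annotate (P.nmax κ) ms) m % P.q κ =
      balance (P.nmax κ) (P.len κ (Label.ofCode l)) 1 (annotate (P.nmax κ) ms) m %
        P.q κ := by
  subst hl
  rw [← ZMod.natCast_eq_natCast_iff']
  constructor
  · intro h
    have h1 := h (fun β i => if isCor (annotate (P.nmax κ) ms) i.1 = true then 0 else fun j =>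
        (plain β.toNat (encMsg (annotate (P.nmax κ) ms) i.1 (labelCode m)) j : ZMod (P.q κ)))
      (fun i hi => by
        simp only [hi, Bool.false_eq_true, if_false]
        exact mem_encQueries_of_hasEnc (hcomp i.1 (mem_support_iff.1 i.2) hi))
      (fun i hi => by simp [hi])
    obtain ⟨c, hc⟩ := apply_add_eq (ms := ms) (m := m) (x := fun β i =>
        if isCor (annotate (P.nmax κ) ms) i.1 = true then 0 else fun j =>
        (plain β.toNat (encMsg (annotate (P.nmax κ) ms) i.1 (labelCode m)) j : ZMod (P.q κ)))
      (fun β i hi j => by simp [hi]) (fun i hi => by simp [hi])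
    exact add_right_cancel ((hc false).symm.trans (h1.trans (hc true)))
  · intro h x hx hx'
    obtain ⟨c, hc⟩ := apply_add_eq (ms := ms) (m := m) (x := x)
      (fun β i hi j => eq_plain_of_mem (hx i hi) β j) hx'
    exact (hc false).trans ((congrArg (· + c) h).trans (hc true).symm)

/-- Admissibility of the adversary can be read off its messages. -/
theorem admissible_toState {T : Fin (P.nmax κ) × Fin 2 → Option (BitVec κ)} {ms : List Val} :
    DyNMCFE.Admissible (P.toState κ (T, ms)) ↔ P.admissible κ ms = true := by
  have hCS : ∀ i : Fin (P.nmax κ), i ∈ (P.toState κ (T, ms)).CS ↔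
      isCor (annotate (P.nmax κ) ms) i = true := fun i => by
    exact (Finset.mem_filter.trans (and_iff_right (Finset.mem_univ i)))
  have hCS' : ∀ i : Fin (P.nmax κ), i ∉ (P.toState κ (T, ms)).CS ↔
      isCor (annotate (P.nmax κ) ms) i = false := fun i => by rw [hCS, Bool.not_eq_true]
  have hlab : ∀ m, tag m = 3 → labelCode m = (m.snd.nth 0).toNat := fun m ht => by
    simp [labelCode, ht]
  have hencl : ∀ m, tag m = 2 → labelCode m = (m.snd.nth 1).toNat := fun m ht => by
    simp [labelCode, ht]
  unfold admissible
  rw [List.all_eq_true]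
  constructor
  · rintro ⟨h1, h2, h3⟩ ⟨m, b⟩ he
    unfold admissibleAt
    dsimp only
    cases b
    · simp
    split_ifs with t2 t3
    · rw [Bool.and_true, decide_eq_true_eq] at t2
      rw [Bool.or_eq_true, Bool.not_eq_true', List.all_eq_true]
      refine (Bool.eq_false_or_eq_true _).symm.imp_right fun hc j hj => ?_
      have hi : (m.snd.nth 0).toNat < P.nmax κ := by
        rw [← client_of_two t2]
        exact lt_of_isReg (isReg_of_isCor hc)
      have hx := h1 _ (mem_encQueries.2 ⟨m, hi, he, t2, rfl⟩)
        ((hCS ⟨_, hi⟩).2 (by rwa [client_of_two t2] at hc))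
      rw [hencl m t2, List.mem_range] at hj
      rw [decide_eq_true_eq, ← ZMod.natCast_eq_natCast_iff']
      exact congrFun (show (P.encQuery κ m hi).x false = (P.encQuery κ m hi).x true from hx) ⟨j, hj⟩
    · rw [Bool.and_true, decide_eq_true_eq] at t3
      have hK := mem_keyQueries.2 ⟨m, he, t3, (rfl : P.keyQuery κ m = _)⟩
      have hcomp : ∀ i : Fin (P.nmax κ), inSupport m i = true →
          isCor (annotate (P.nmax κ) ms) i = false →
          hasEnc (annotate (P.nmax κ) ms) i (m.snd.nth 0).toNat = true := fun i hi hc =>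
        exists_encQueries_iff.1 (h2 _ hK i (mem_support_iff.2 hi) ((hCS' i).2 hc))
      rw [Bool.and_eq_true, List.all_eq_true, decide_eq_true_eq, hlab m t3]
      refine ⟨fun i hi => ?_, (balanced_iff (hlab m t3) hcomp).1 fun x hx hx' => ?_⟩
      · rw [Bool.or_eq_true, Bool.or_eq_true, Bool.not_eq_true']
        by_cases hs : inSupport m i = true
        · by_cases hc : isCor (annotate (P.nmax κ) ms) i = true
          · exact .inl (.inr hc)
          · exact .inr (hcomp ⟨i, List.mem_range.1 hi⟩ hs (by simpa using hc))
        · exact .inl (.inl (by simpa using hs))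
      · exact h3 _ hK x (fun i hi => hx i ((hCS' i.1).1 hi)) (fun i hi => hx' i ((hCS i.1).1 hi))
    · rfl
  · intro h
    have h2 : ∀ m, (m, true) ∈ annotate (P.nmax κ) ms → tag m = 2 →
        isCor (annotate (P.nmax κ) ms) (client m) = true →
        ∀ j < P.len κ (Label.ofCode (labelCode m)), plain 0 m j % P.q κ = plain 1 m j % P.q κ := by
      intro m hm ht hc j hj
      have := h _ hm
      simp only [admissibleAt, ht, decide_true, Bool.and_true, if_true, hc, Bool.not_true,
        Bool.false_or, List.all_eq_true, decide_eq_true_eq, List.mem_range] at this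
      exact this j hj
    have h3 : ∀ m, (m, true) ∈ annotate (P.nmax κ) ms → tag m = 3 →
        (∀ i : Fin (P.nmax κ), inSupport m i = true → isCor (annotate (P.nmax κ) ms) i = false →
          hasEnc (annotate (P.nmax κ) ms) i (m.snd.nth 0).toNat = true) ∧
        balance (P.nmax κ) (P.len κ (Label.ofCode (m.snd.nth 0).toNat)) 0
          (annotate (P.nmax κ) ms) m % P.q κ =
        balance (P.nmax κ) (P.len κ (Label.ofCode (m.snd.nth 0).toNat)) 1
          (annotate (P.nmax κ) ms) m % P.q κ := by
      intro m hm ht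
      have := h _ hm
      simp only [admissibleAt, ht, decide_true, Bool.and_true, if_true, Nat.reduceEqDiff,
        decide_false, Bool.false_eq_true, if_false, Bool.and_eq_true, List.all_eq_true,
        decide_eq_true_eq, hlab m ht] at this
      refine ⟨fun i hi hc => ?_, this.2⟩
      have := this.1 i (List.mem_range.2 i.2)
      simpa [hi, hc] using this
    refine ⟨?_, ?_, ?_⟩
    · intro Q hQ hc
      obtain ⟨m, hi, hm, ht, rfl⟩ := mem_encQueries.1 hQ
      rw [encQuery_x, encQuery_x]
      funext j
      refine (ZMod.natCast_eq_natCast_iff' _ _ _).2 (h2 m hm ht ?_ j ?_)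
      · rw [client_of_two ht]
        exact (hCS ⟨_, hi⟩).1 hc
      · rw [hencl m ht]
        exact j.2
    · intro K hK i hi hc
      obtain ⟨m, hm, ht, rfl⟩ := mem_keyQueries.1 hK
      exact exists_encQueries_iff.2 ((h3 m hm ht).1 i (mem_support_iff.1 hi) ((hCS' i).1 hc))
    · intro K hK
      obtain ⟨m, hm, ht, rfl⟩ := mem_keyQueries.1 hK
      intro x hx hx'
      exact (balanced_iff (hlab m ht) (h3 m hm ht).1).2 (h3 m hm ht).2 x
        (fun i hi => hx i ((hCS' i.1).2 hi)) (fun i hi => hx' i ((hCS i.1).2 hi))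

/-! ### The real game is a hybrid game -/

/-- The game is the hybrid game without random pads. -/
theorem game_eq_hybrid (A : PPT) (b : Bool) : (P.dyNo κ).game A κ b =
    P.hybrid κ 0 b.toNat (A.comp κ (P.startVal κ)) := by
  classical
  let n := P.nmax κ
  obtain ⟨J₀, h⟩ := Comp.run_lazyOracle (ans := P.realAns κ b.toNat) (next := fun ms m => m :: ms)
    (need := P.keyNeed κ) (dom := fun ms => {x | P.HasKey κ ms x})
    (fun ms m x hx => (hasKey_cons ms m x).1 hx)
    (fun R R' ms m hR => gameAns_congr P κ
      (fun i hi => hR (i, 0) (by simpa [HasKey] using hi))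
      (fun i hi hi' => by rw [hR (i, 1) (by simpa [HasKey] using ⟨hi, hi'⟩)]))
    (A.comp κ (P.startVal κ)) (fun _ => none) []
    (fun x hx => by simp [HasKey, annotate, isCor, isReg] at hx)
  have h := h Finset.univ (Finset.subset_univ _)
  have hgame : (P.dyNo κ).game A κ b =
      (((A.comp κ (P.startVal κ)).run (P.realOracle κ b.toNat) (fun _ => none, [])).map
        fun r => (r.1, r.2.2)).map (P.wins κ) := by
    unfold DyNMCFE.game
    rw [exec_eq, PMF.map_comp, PMF.map_comp]
    congr 1
    funext r
    obtain ⟨a, T, ms⟩ := r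
    simp [wins, admissible_toState, Bool.decide_and]
  rw [hgame]
  unfold realOracle
  rw [h]
  unfold hybrid
  simp only [hybridRun_zero]
  rw [PMF.map_bind]
  let e : (↥(Finset.univ : Finset (Fin n × Fin 2)) → BitVec κ) ≃
      (Fin n → BitVec κ) × (Fin n → BitVec κ) :=
    { toFun R := (fun i => R ⟨(i, 0), Finset.mem_univ _⟩, fun i => R ⟨(i, 1), Finset.mem_univ _⟩)
      invFun K x := if x.1.2 = 0 then K.1 x.1.1 else K.2 x.1.1
      left_inv R := by
        funext ⟨⟨i, c⟩, hx⟩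
        fin_cases c <;> rfl
      right_inv K := rfl }
  rw [← uniform_prod fun K : (Fin n → BitVec κ) × (Fin n → BitVec κ) => PMF.map (P.wins κ) (Comp.run (Comp.detOracle
    (P.gameAns κ b.toNat K.1 fun l i => P.prf κ (K.2 i) (Label.ofCode l)) fun ms m => m :: ms)
      (A.comp κ (P.startVal κ)) []), ← uniform_bind_equiv e]
  congr 1
  funext R
  congr 2
  unfold realAns
  congr 1
  simp only [Comp.fill, Finset.mem_univ, dif_pos, Option.getD_none]
  rfl

end Params

/-! ### Execution of a simulator -/

namespace Simulator

variable {τ : Type} (M : Simulator)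

/-- The oracle that the adversary faces in a simulation, if the simulator has the oracle `O`. -/
def oracle (O : τ → Val → PMF (Val × τ)) (x : SimState × τ) (m : Val) :
    PMF (Val × (SimState × τ)) :=
  (PMF.uniformOfFintype (Fin (M.bound x.1.1.1 + 1))).bind fun d =>
    (O x.2 (.num (M.label m))).map fun r =>
      let e := M.entry x.1 m d (sanitize (M.modulus x.1.1.1) (M.width x.1.1.1).length r.1)
      (M.ans (x.1, m, e), ((x.1.1, e :: x.1.2), r.2))

/-- A simulator with oracle `O` is an execution of the adversary with the oracle of `M.oracle O`,
preceded by three random choices. -/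
theorem run_comp (O : τ → Val → PMF (Val × τ)) (A : PPT) (κ : ℕ) (t : τ) :
    (M.comp A κ).run O t =
      (PMF.uniformOfFintype (Fin (M.bound₁ (List.range κ) + 1))).bind fun b =>
      (PMF.uniformOfFintype (Fin (M.bound₂ (List.range κ) + 1))).bind fun j =>
      (PMF.uniformOfFintype (Fin (M.bound₃ (List.range κ) + 1))).bind fun D =>
        ((A.comp κ (M.start (List.range κ))).run (M.oracle O)
          (((List.range κ, (b : ℕ), (j : ℕ), (D : ℕ)), []), t)).map fun r =>
            (r.1.map fun a => rep (M.out (r.2.1, decide (a.toNat = 1))), r.2.2) := by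
  simp only [comp, Comp.run]
  congr 1; funext b
  congr 1; funext j
  congr 1; funext D
  rw [Comp.run_bind, Comp.run_interp O M.handle (M.oracle O)]
  · rw [PMF.bind_map, ← PMF.bind_pure_comp]
    congr 1
    funext r
    obtain ⟨a, s, t⟩ := r
    cases a <;> rfl
  · intro s t m
    simp only [handle, Comp.run, oracle, PMF.map_bind, PMF.map_comp]
    rfl

end Simulator

/-! ### Random numbers as random tables -/

theorem digits_getD {q d k t : ℕ} (ht : t < k) : (digits q d k).getD t 0 = d / q ^ t % q := by
  simp [digits, ht]

/-- The digits of a uniform number are independent and uniform. -/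
theorem exists_equiv_digits {q a b : ℕ} (hq : 0 < q) {V : Type} (e : Fin q ≃ V) (f : ℕ → V)
    (he : ∀ x : Fin q, e x = f x) : ∃ E : Fin (q ^ (a * b) - 1 + 1) ≃ (Fin a → Fin b → V),
      ∀ d i t, E d i t = f ((digits q d (a * b)).getD (t + b * i) 0) := by
  have hN : q ^ (a * b) - 1 + 1 = q ^ (a * b) := Nat.sub_add_cancel (Nat.pow_pos hq)
  refine ⟨(finCongr hN).trans (finFunctionFinEquiv.symm.trans
    ((Equiv.arrowCongr finProdFinEquiv.symm e).trans (Equiv.curry _ _ _))), fun d i t => ?_⟩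
  have hlt : (t : ℕ) + b * i < a * b := (finProdFinEquiv (i, t)).2
  rw [digits_getD hlt]
  simp [he, finFunctionFinEquiv]

/-! ### The reduction plays a hybrid game -/

theorem oldest_cons (e : Entry) (es : List Entry) (l : ℕ) : oldest (e :: es) l =
    if ∃ e' ∈ es, labelCode e'.1.1 = l then oldest es l
    else if labelCode e.1.1 = l then e else ((.num 0, false), [], 0) := by
  have key : ∀ (es : List Entry) (r : Entry),
      es.foldl (fun r e => if labelCode e.1.1 = l then e else r) r =
        if ∃ e' ∈ es, labelCode e'.1.1 = l then oldest es l else r := by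
    intro es
    induction es with
    | nil => simp
    | cons e es ih =>
      intro r
      rw [oldest, List.foldl_cons, List.foldl_cons, ih, ih]
      by_cases h : ∃ e' ∈ es, labelCode e'.1.1 = l
      · have h' : ∃ e' ∈ e :: es, labelCode e'.1.1 = l := by
          obtain ⟨e', h1, h2⟩ := h
          exact ⟨e', List.mem_cons_of_mem _ h1, h2⟩
        simp only [if_pos h, if_pos h']
      · by_cases he : labelCode e.1.1 = l
        · have h' : ∃ e' ∈ e :: es, labelCode e'.1.1 = l := ⟨e, List.mem_cons_self, he⟩
          simp only [if_neg h, if_pos h', if_pos he]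
        · have h' : ¬ ∃ e' ∈ e :: es, labelCode e'.1.1 = l := by
            rintro ⟨e', h1, h2⟩
            rcases List.mem_cons.1 h1 with rfl | h1
            · exact he h2
            · exact h ⟨e', h1, h2⟩
          simp only [if_neg h, if_neg h', if_neg he]
  rw [oldest, List.foldl_cons, key]

namespace Params

variable (P : Params) (κ : ℕ)

/-- The entries of a vector, as numbers. -/
def vals (y : Vec (P.q κ) (P.mmax κ)) : List ℕ := List.ofFn fun t => (y t).val

/-- The key of the client `i` that is encoded in `D`. -/
def keyAt (D c : ℕ) (i : Fin (P.nmax κ)) : BitVec κ := BitVec.ofNat κ (P.keyNumber κ D c i)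

/-- The random pads that are encoded in `d`. -/
def padsAt (d : ℕ) (i : Fin (P.nmax κ)) : Vec (P.q κ) (P.mmax κ) := fun t =>
  ((digits (P.q κ) d (P.nmax κ * P.mmax κ)).getD (t + P.mmax κ * i) 0 : ZMod (P.q κ))

open Classical in
/-- The table of random pads in the hybrid game that the reduction plays. If its oracle is random
(`b = true`), then the client `j` has a random pad, too. -/
def padTable (b : Bool) (j : Fin (P.nmax κ)) (es : List Entry) (l : ℕ) :
    Option (Fin (P.nmax κ) → Vec (P.q κ) (P.mmax κ)) :=
  if ∃ e ∈ es, labelCode e.1.1 = l then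
    some (if b = true then Function.update (P.padsAt κ (oldest es l).2.2) j
        fun t => ((oldest es l).2.1.getD t 0 : ZMod (P.q κ))
      else P.padsAt κ (oldest es l).2.2)
  else none

/-- The state of the hybrid game that belongs to a state of the simulation. -/
def toHybrid (b : Bool) (j : Fin (P.nmax κ))
    (x : SimState × (Label → Option (Vec (P.q κ) (P.mmax κ)))) :
    (ℕ → Option (Fin (P.nmax κ) → Vec (P.q κ) (P.mmax κ))) × List Val :=
  (P.padTable κ b j x.1.2, x.1.2.map fun e => e.1.1)

/-- The invariant of the simulation. -/
structure SimInv (b : Bool) (K₀ : BitVec κ) (β D : ℕ) (j : Fin (P.nmax κ))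
    (x : SimState × (Label → Option (Vec (P.q κ) (P.mmax κ)))) : Prop where
  context : x.1.1 = (List.range κ, β, (j : ℕ), D)
  flags : messages x.1.2 = annotate (P.nmax κ) (x.1.2.map fun e => e.1.1)
  old : ∀ l, (∃ e ∈ x.1.2, labelCode e.1.1 = l) → ∃ y, (oldest x.1.2 l).2.1 = P.vals κ y ∧
    if b = true then x.2 (Label.ofCode l) = some y else y = P.prf κ K₀ (Label.ofCode l)
  new : b = true → ∀ l, (¬ ∃ e ∈ x.1.2, labelCode e.1.1 = l) → x.2 (Label.ofCode l) = none

variable {P κ}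

theorem sanitize_toVal (y : Vec (P.q κ) (P.mmax κ)) :
    sanitize (P.q κ) (P.mmax κ) y.toVal = P.vals κ y := by
  unfold sanitize vals
  refine List.ext_getElem (by simp) fun i h1 h2 => ?_
  have hi : i < P.mmax κ := by simpa using h1
  have := Val.nth_ofFn (fun t => Val.num (y t).val) ⟨i, hi⟩
  dsimp only at this
  simp [Vec.toVal, this, Val.toNat, ZMod.val_lt]

theorem vals_getD (y : Vec (P.q κ) (P.mmax κ)) {t : ℕ} (ht : t < P.mmax κ) :
    (P.vals κ y).getD t 0 = (y ⟨t, ht⟩).val := by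
  simp [vals, ht]

theorem cast_vals (y : Vec (P.q κ) (P.mmax κ)) :
    (fun t : Fin (P.mmax κ) => ((P.vals κ y).getD t 0 : ZMod (P.q κ))) = y := by
  funext t
  rw [vals_getD y t.2, ZMod.natCast_zmod_val]

theorem val_padsAt {d : ℕ} {i t : ℕ} (hi : i < P.nmax κ) (ht : t < P.mmax κ) :
    (P.padsAt κ d ⟨i, hi⟩ ⟨t, ht⟩).val =
      (digits (P.q κ) d (P.nmax κ * P.mmax κ)).getD (t + P.mmax κ * i) 0 := by
  have hlt : t + P.mmax κ * i < P.nmax κ * P.mmax κ :=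
    (finProdFinEquiv ((⟨i, hi⟩ : Fin (P.nmax κ)), (⟨t, ht⟩ : Fin (P.mmax κ)))).2
  simp only [padsAt]
  rw [digits_getD hlt, ZMod.val_natCast, Nat.mod_mod]

theorem keyNumber_lt {D c i : ℕ} (hc : c < 2) (hi : i < P.nmax κ) :
    P.keyNumber κ D c i < 2 ^ κ := by
  have hlt : c + 2 * i < P.nmax κ * 2 := by omega
  rw [keyNumber, digits_getD hlt]
  exact Nat.mod_lt _ (by positivity)

theorem prfList_getD {k l t : ℕ} (ht : t < P.mmax κ) : (P.prfList κ k l).getD t 0 =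
    (P.prf κ (BitVec.ofNat κ k) (Label.ofCode l) ⟨t, ht⟩).val := by
  simp [prfList, ht]

/-- The answers of the simulation. -/
theorem reduction_ans {b : Bool} {K₀ : BitVec κ} {β D : ℕ} {j : Fin (P.nmax κ)} {es : List Entry}
    {m : Val} {z : List ℕ} {d : ℕ} {y : Vec (P.q κ) (P.mmax κ)}
    (hfl : messages es = annotate (P.nmax κ) (es.map fun e => e.1.1))
    (hy : (oldest (P.reduction.entry ((List.range κ, β, (j : ℕ), D), es) m d z :: es)
      (labelCode m)).2.1 = P.vals κ y)
    (hb : b = false → y = P.prf κ K₀ (Label.ofCode (labelCode m))) :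
    P.reduction.ans (((List.range κ, β, (j : ℕ), D), es), m,
      P.reduction.entry ((List.range κ, β, (j : ℕ), D), es) m d z) =
    P.gameAns κ β (P.keyAt κ D 0) (P.hybridPad κ (j + b.toNat)
      (if b = true then P.keyAt κ D 1 else Function.update (P.keyAt κ D 1) j K₀)
      fun l => (P.padTable κ b j (P.reduction.entry ((List.range κ, β, (j : ℕ), D), es) m d z :: es)
        l).getD default) (es.map fun e => e.1.1) m := by
  set e := P.reduction.entry ((List.range κ, β, (j : ℕ), D), es) m d z with he
  have he1 : e.1 = (m, accepted (P.nmax κ) (annotate (P.nmax κ) (es.map fun e => e.1.1)) m) := by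
    rw [← hfl]
    simp [he, Simulator.entry, reduction]
  have htab : P.padTable κ b j (e :: es) (labelCode m) =
      some (if b = true then Function.update (P.padsAt κ (oldest (e :: es) (labelCode m)).2.2) j y
        else P.padsAt κ (oldest (e :: es) (labelCode m)).2.2) := by
    rw [padTable, if_pos ⟨e, List.mem_cons_self, by rw [he1]⟩, hy, cast_vals]
  simp only [reduction, gameAns, he1, List.length_range]
  have hkey : ∀ i (hi : i < P.nmax κ), P.keyNumber κ D 0 i = (P.keyAt κ D 0 ⟨i, hi⟩).toNat := by
    intro i hi
    rw [keyAt, BitVec.toNat_ofNat, Nat.mod_eq_of_lt (keyNumber_lt (by omega) hi)]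
  have hpad : ∀ i < P.nmax κ, ∀ t < P.mmax κ, P.simPad κ j D (messages es)
      (oldest (e :: es) (labelCode m)).2.1 (oldest (e :: es) (labelCode m)).2.2 (labelCode m) i t =
      P.padFun κ (P.keyAt κ D 0) (P.hybridPad κ (j + b.toNat)
        (if b = true then P.keyAt κ D 1 else Function.update (P.keyAt κ D 1) j K₀)
        (fun l => (P.padTable κ b j (e :: es) l).getD default) (labelCode m))
        (annotate (P.nmax κ) (es.map fun e => e.1.1)) (labelCode m) i t := by
    intro i hi t ht
    rw [simPad, padFun, dif_pos ⟨hi, ht⟩, hfl, hy, hybridPad, htab, Option.getD_some]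
    by_cases hc : isCor (annotate (P.nmax κ) (es.map fun e => e.1.1)) i = true
    · rw [if_pos hc, if_pos hc, prfList_getD ht]
      rfl
    rw [if_neg hc, if_neg hc]
    rcases lt_trichotomy i (j : ℕ) with hij | hij | hij
    · rw [if_pos hij, if_pos (show i < j + b.toNat by omega), ← val_padsAt hi ht]
      cases b
      · rfl
      · rw [if_pos rfl, Function.update_of_ne (Fin.ne_of_lt hij)]
    · subst hij
      rw [if_neg (lt_irrefl _), if_pos rfl, vals_getD _ ht]
      cases b
      · rw [if_neg (by simp), hb rfl]
        simp
      · rw [if_pos (by simp)]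
        simp
    · rw [if_neg (by omega), if_neg (by omega), if_neg (by cases b <;> simp <;> omega),
        prfList_getD ht]
      cases b
      · rw [if_neg (by simp), Function.update_of_ne (Fin.ne_of_gt hij)]
        rfl
      · rfl
  have hlen := P.len_le κ (Label.ofCode (labelCode m))
  by_cases hacc : accepted (P.nmax κ) (annotate (P.nmax κ) (es.map fun e => e.1.1)) m = true
  swap
  · rw [if_neg hacc, if_neg hacc]
  rw [if_pos hacc, if_pos hacc]
  refine reply_congr ?_ ?_ ?_
  · intro ht
    rw [accepted_zero ht, Bool.and_eq_true, decide_eq_true_eq] at hacc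
    rw [keyFun, dif_pos hacc.1, hkey _ hacc.1]
  · intro ht t htl
    rw [accepted_two ht, Bool.and_eq_true] at hacc
    exact hpad _ (lt_of_isReg hacc.1) t (htl.trans_le hlen)
  · intro _ i hi _ t htl
    exact hpad i hi t (htl.trans_le hlen)

/-- A new message leads to a new table entry only if its label is new. -/
theorem padTable_cons (b : Bool) (j : Fin (P.nmax κ)) (e : Entry) (es : List Entry) :
    P.padTable κ b j (e :: es) = open Classical in
      if ∃ e' ∈ es, labelCode e'.1.1 = labelCode e.1.1 then P.padTable κ b j es
      else Function.update (P.padTable κ b j es) (labelCode e.1.1)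
        (some (if b = true then Function.update (P.padsAt κ e.2.2) j
          fun t => (e.2.1.getD t 0 : ZMod (P.q κ)) else P.padsAt κ e.2.2)) := by
  classical
  funext l
  by_cases h : ∃ e' ∈ es, labelCode e'.1.1 = l
  · have h' : ∃ e' ∈ e :: es, labelCode e'.1.1 = l := by
      obtain ⟨e', h1, h2⟩ := h
      exact ⟨e', List.mem_cons_of_mem _ h1, h2⟩
    have hold : oldest (e :: es) l = oldest es l := by rw [oldest_cons, if_pos h]
    have hl : P.padTable κ b j (e :: es) l = P.padTable κ b j es l := by
      simp only [padTable, if_pos h, if_pos h', hold]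
    rw [hl]
    by_cases hn : ∃ e' ∈ es, labelCode e'.1.1 = labelCode e.1.1
    · rw [if_pos hn]
    · rw [if_neg hn, Function.update_of_ne]
      rintro rfl
      exact hn h
  · by_cases hl : labelCode e.1.1 = l
    · subst hl
      rw [if_neg h, Function.update_self, padTable, if_pos ⟨e, List.mem_cons_self, rfl⟩,
        oldest_cons, if_neg h, if_pos rfl]
    · have h' : ¬ ∃ e' ∈ e :: es, labelCode e'.1.1 = l := by
        rintro ⟨e', h1, h2⟩
        rcases List.mem_cons.1 h1 with rfl | h1
        · exact hl h2
        · exact h ⟨e', h1, h2⟩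
      have : P.padTable κ b j (e :: es) l = P.padTable κ b j es l := by
        simp only [padTable, if_neg h, if_neg h']
      rw [this]
      by_cases hn : ∃ e' ∈ es, labelCode e'.1.1 = labelCode e.1.1
      · rw [if_pos hn]
      · rw [if_neg hn, Function.update_of_ne (Ne.symm hl)]

/-- What the oracle of the reduction answers, and its next state. -/
theorem prfOracle_cases {b : Bool} {K₀ : BitVec κ} {β D : ℕ} {j : Fin (P.nmax κ)}
    {x : SimState × (Label → Option (Vec (P.q κ) (P.mmax κ)))} (hx : P.SimInv κ b K₀ β D j x)
    (l : ℕ) (r : Val × (Label → Option (Vec (P.q κ) (P.mmax κ))))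
    (hr : r ∈ (P.prfOracle κ K₀ b x.2 (.num l)).support) :
    ∃ y : Vec (P.q κ) (P.mmax κ), r.1 = y.toVal ∧
      (if b = true then r.2 = Function.update x.2 (Label.ofCode l) (some y)
        else r.2 = x.2 ∧ y = P.prf κ K₀ (Label.ofCode l)) ∧
      ((∃ e ∈ x.1.2, labelCode e.1.1 = l) → (oldest x.1.2 l).2.1 = P.vals κ y) := by
  unfold prfOracle at hr
  simp only [Val.toNat_num] at hr
  cases b
  · simp only [Bool.false_eq_true, if_false, PMF.support_pure, Set.mem_singleton_iff] at hr
    subst hr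
    refine ⟨_, rfl, by simp, fun h => ?_⟩
    obtain ⟨y, h1, h2⟩ := hx.old l h
    rw [h1]
    simp only [Bool.false_eq_true, if_false] at h2
    rw [h2]
  · simp only [if_true] at hr
    cases hT : x.2 (Label.ofCode l) with
    | some y =>
      rw [hT] at hr
      simp only [PMF.support_pure, Set.mem_singleton_iff] at hr
      subst hr
      refine ⟨y, rfl, by simp [← hT], fun h => ?_⟩
      obtain ⟨y', h1, h2⟩ := hx.old l h
      rw [if_pos rfl, hT] at h2
      cases h2
      exact h1
    | none =>
      rw [hT] at hr
      rw [PMF.support_map] at hr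
      obtain ⟨y, -, rfl⟩ := hr
      refine ⟨y, rfl, by simp, fun h => ?_⟩
      obtain ⟨y', h1, h2⟩ := hx.old l h
      rw [if_pos rfl, hT] at h2
      cases h2

theorem simInv_oracle {b : Bool} {K₀ : BitVec κ} {β D : ℕ} {j : Fin (P.nmax κ)}
    (x : SimState × (Label → Option (Vec (P.q κ) (P.mmax κ)))) (m : Val)
    (hx : P.SimInv κ b K₀ β D j x) :
    ∀ r ∈ (P.reduction.oracle (P.prfOracle κ K₀ b) x m).support, P.SimInv κ b K₀ β D j r.2 := by
  obtain ⟨⟨u, es⟩, T⟩ := x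
  obtain rfl : u = (List.range κ, β, (j : ℕ), D) := hx.context
  intro r hr
  unfold Simulator.oracle at hr
  obtain ⟨d, -, hr⟩ := (PMF.mem_support_bind_iff _ _ _).1 hr
  rw [PMF.support_map] at hr
  obtain ⟨⟨r₁, r₂⟩, hr', rfl⟩ := hr
  obtain ⟨y, h1, h2, h3⟩ := prfOracle_cases hx (labelCode m) _ hr'
  dsimp only at h1 h2 h3
  subst h1
  have hsan : sanitize (P.reduction.modulus (List.range κ))
      (P.reduction.width (List.range κ)).length y.toVal = P.vals κ y := by
    simp only [reduction, List.length_range]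
    exact sanitize_toVal y
  dsimp only
  rw [hsan]
  generalize he : P.reduction.entry ((List.range κ, β, (j : ℕ), D), es) m d (P.vals κ y) = e
  have he1 : e.1 = (m, accepted (P.nmax κ) (messages es) m) := by
    simp [← he, Simulator.entry, reduction]
  have he2 : e.2.1 = P.vals κ y := by simp [← he, Simulator.entry]
  have hflags : messages es = annotate (P.nmax κ) (es.map fun e => e.1.1) := hx.flags
  have hnew : ∀ l, (∃ e' ∈ e :: es, labelCode e'.1.1 = l) ↔
      labelCode m = l ∨ ∃ e' ∈ es, labelCode e'.1.1 = l := by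
    intro l
    simp [he1]
  refine ⟨rfl, ?_, ?_, ?_⟩
  · simp [messages, annotate, he1, ← hflags]
  · intro l hl
    have hl' := (hnew l).1 hl
    by_cases hm : labelCode m = l
    · subst hm
      refine ⟨y, ?_, ?_⟩
      · dsimp only
        rw [oldest_cons]
        split_ifs with h h'
        · exact h3 h
        · exact he2
        · exact absurd (by rw [he1]) h'
      · cases b
        · simpa using h2.2
        · simp only [if_true] at h2 ⊢
          simp [h2]
    · have hl'' := hl'.resolve_left hm
      obtain ⟨y', h4, h5⟩ := hx.old l hl''
      refine ⟨y', ?_, ?_⟩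
      · dsimp only
        rw [oldest_cons, if_pos hl'']
        exact h4
      · cases b
        · simpa using h5
        · simp only [if_true] at h2 h5 ⊢
          rw [h2, Function.update_of_ne (fun h => hm (ofCode_injective h).symm)]
          exact h5
  · rintro rfl l hl
    rw [hnew l, not_or] at hl
    simp only [if_true] at h2
    dsimp only
    rw [h2, Function.update_of_ne (fun h => hl.1 (ofCode_injective h).symm)]
    exact hx.new rfl l hl.2

/-- A step of the simulation is a step of a hybrid game. If the oracle of the reduction is random, it
is the one at position `j + 1`; otherwise it is the one at position `j`, with `K₀` as the key of the
client `j`. -/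
theorem toHybrid_oracle {b : Bool} {K₀ : BitVec κ} {β D : ℕ} {j : Fin (P.nmax κ)}
    (x : SimState × (Label → Option (Vec (P.q κ) (P.mmax κ)))) (m : Val)
    (hx : P.SimInv κ b K₀ β D j x) :
    P.hybridOracle κ (j + b.toNat) β (P.keyAt κ D 0)
      (if b = true then P.keyAt κ D 1 else Function.update (P.keyAt κ D 1) j K₀)
      (P.toHybrid κ b j x) m =
    (P.reduction.oracle (P.prfOracle κ K₀ b) x m).map fun r => (r.1, P.toHybrid κ b j r.2) := by
  classical
  obtain ⟨⟨u, es⟩, T⟩ := x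
  obtain rfl : u = (List.range κ, β, (j : ℕ), D) := hx.context
  have hflags : messages es = annotate (P.nmax κ) (es.map fun e => e.1.1) := hx.flags
  have hsan : ∀ y : Vec (P.q κ) (P.mmax κ), sanitize (P.reduction.modulus (List.range κ))
      (P.reduction.width (List.range κ)).length y.toVal = P.vals κ y := fun y => by
    simp only [reduction, List.length_range]
    exact sanitize_toVal y
  -- The answer and the next state, if the oracle of the reduction answers by `y`.
  have hstep : ∀ (d : ℕ) (y : Vec (P.q κ) (P.mmax κ)) (T' : Label → Option (Vec (P.q κ) (P.mmax κ))),
      (b = false → y = P.prf κ K₀ (Label.ofCode (labelCode m))) →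
      ((∃ e ∈ es, labelCode e.1.1 = labelCode m) →
        (oldest es (labelCode m)).2.1 = P.vals κ y) →
      let e := P.reduction.entry ((List.range κ, β, (j : ℕ), D), es) m d (P.vals κ y)
      let T₁ := if ∃ e ∈ es, labelCode e.1.1 = labelCode m then P.padTable κ b j es
        else Function.update (P.padTable κ b j es) (labelCode m) (some (if b = true then
          Function.update (P.padsAt κ d) j y else P.padsAt κ d))
      (P.reduction.ans (((List.range κ, β, (j : ℕ), D), es), m, e),
        P.toHybrid κ b j (((List.range κ, β, (j : ℕ), D), e :: es), T')) =
      (P.gameAns κ β (P.keyAt κ D 0) (P.hybridPad κ (j + b.toNat)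
        (if b = true then P.keyAt κ D 1 else Function.update (P.keyAt κ D 1) j K₀)
        fun l => (T₁ l).getD default) (es.map fun e => e.1.1) m, (T₁, m :: es.map fun e => e.1.1)) := by
    intro d y T' hb hy e T₁
    have he1 : e.1.1 = m := rfl
    have he2 : e.2.1 = P.vals κ y := rfl
    have he3 : e.2.2 = d := rfl
    have htab : P.padTable κ b j (e :: es) = T₁ := by
      rw [padTable_cons, he1, he2, he3, cast_vals]
    have hold : (oldest (e :: es) (labelCode m)).2.1 = P.vals κ y := by
      rw [oldest_cons]
      split_ifs with h h'
      · exact hy h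
      · exact he2
      · exact absurd (by rw [he1]) h'
    refine Prod.ext ?_ (Prod.ext htab rfl)
    have := reduction_ans (b := b) (K₀ := K₀) hflags hold hb
    rw [← htab]
    exact this
  let F (T₁ : ℕ → Option (Fin (P.nmax κ) → Vec (P.q κ) (P.mmax κ))) :=
    (P.gameAns κ β (P.keyAt κ D 0) (P.hybridPad κ (j + b.toNat)
      (if b = true then P.keyAt κ D 1 else Function.update (P.keyAt κ D 1) j K₀)
      fun l => (T₁ l).getD default) (es.map fun e => e.1.1) m, (T₁, m :: es.map fun e => e.1.1))
  unfold hybridOracle Comp.lazyOracle Simulator.oracle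
  simp only [toHybrid, PMF.map_bind, PMF.map_comp]
  by_cases hl : ∃ e ∈ es, labelCode e.1.1 = labelCode m
  · -- The label is known: nothing is drawn in the hybrid game.
    obtain ⟨y, hy1, hy2⟩ := hx.old _ hl
    obtain ⟨R, hR⟩ : ∃ R, P.padTable κ b j es (labelCode m) = some R := ⟨_, if_pos hl⟩
    rw [hR]
    have hO : P.prfOracle κ K₀ b T (.num (labelCode m)) = PMF.pure (y.toVal, T) := by
      unfold prfOracle
      cases b
      · simp only [Bool.false_eq_true, if_false, Val.toNat_num] at hy2 ⊢
        rw [hy2]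
      · simp only [if_true, Val.toNat_num] at hy2 ⊢
        rw [hy2]
    symm
    refine (congrArg (PMF.bind _) (funext fun d => ?_)).trans
      (PMF.bind_const _ (PMF.pure (F (P.padTable κ b j es))))
    have h := hstep d y T (fun hb => by simpa [hb] using hy2) fun _ => hy1
    simp only [if_pos hl] at h
    refine (congrArg (PMF.map _) hO).trans ((PMF.pure_map _ _).trans (congrArg PMF.pure ?_))
    simp only [Function.comp_apply, hsan]
    exact h
  · have hT : P.padTable κ b j es (labelCode m) = none := if_neg hl
    rw [hT]
    -- The new pads are uniform.
    obtain ⟨E, hE⟩ := exists_equiv_digits (a := P.nmax κ) (b := P.mmax κ)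
      (Nat.pos_of_ne_zero (NeZero.ne (P.q κ)))
      { toFun x := ((x : ℕ) : ZMod (P.q κ))
        invFun x := ⟨x.val, x.val_lt⟩
        left_inv x := Fin.ext (ZMod.val_cast_of_lt x.2)
        right_inv x := ZMod.natCast_zmod_val x }
      (fun x : ℕ => (x : ZMod (P.q κ))) fun x => rfl
    have hE' : ∀ d, E d = P.padsAt κ d := fun d => funext fun i => funext fun t => hE d i t
    let G (v : Fin (P.nmax κ) → Vec (P.q κ) (P.mmax κ)) :=
      PMF.pure (F (Function.update (P.padTable κ b j es) (labelCode m) (some v)))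
    have hG : (PMF.uniformOfFintype (Fin (P.nmax κ) → Vec (P.q κ) (P.mmax κ))).bind G =
        (PMF.uniformOfFintype (Fin (P.reduction.bound (List.range κ) + 1))).bind fun d =>
          (P.prfOracle κ K₀ b T (.num (labelCode m))).bind fun r =>
            PMF.pure (P.reduction.ans (((List.range κ, β, (j : ℕ), D), es), m,
                P.reduction.entry ((List.range κ, β, (j : ℕ), D), es) m d
                  (sanitize (P.reduction.modulus (List.range κ))
                    (P.reduction.width (List.range κ)).length r.1)),
              P.toHybrid κ b j (((List.range κ, β, (j : ℕ), D),
                P.reduction.entry ((List.range κ, β, (j : ℕ), D), es) m d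
                  (sanitize (P.reduction.modulus (List.range κ))
                    (P.reduction.width (List.range κ)).length r.1) :: es), r.2)) := by
      have hbound : P.reduction.bound (List.range κ) =
          P.q κ ^ (P.nmax κ * P.mmax κ) - 1 := by simp [reduction]
      rw [hbound]
      cases b
      · have hO : P.prfOracle κ K₀ false T (.num (labelCode m)) =
            PMF.pure ((P.prf κ K₀ (Label.ofCode (labelCode m))).toVal, T) := rfl
        rw [← uniform_bind_equiv E G, hO]
        congr 1
        funext d
        rw [PMF.pure_bind, hsan]
        have h := hstep d _ T (fun _ => rfl) fun h => absurd h hl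
        simp only [if_neg hl] at h
        rw [h]
        simp only [G, F, hE', Bool.false_eq_true, if_false]
      · have hO : P.prfOracle κ K₀ true T (.num (labelCode m)) =
            (PMF.uniformOfFintype (Vec (P.q κ) (P.mmax κ))).map fun y =>
              (y.toVal, Function.update T (Label.ofCode (labelCode m)) (some y)) := by
          have hnone : T (Label.ofCode (labelCode m)) = none := hx.new rfl _ hl
          simp only [prfOracle, Val.toNat_num, if_true]
          rw [hnone]
        rw [← uniform_update j G, PMF.bind_comm, ← uniform_bind_equiv E, hO]
        congr 1
        funext d
        rw [PMF.bind_map]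
        congr 1
        funext y
        simp only [Function.comp_apply]
        have h := hstep d y (Function.update T (Label.ofCode (labelCode m)) (some y))
          (fun h => by simp at h) fun h => absurd h hl
        simp only [if_neg hl] at h
        rw [hsan, h]
        simp only [G, F, hE', if_true]
    exact hG

end Params

theorem map_congr_of_support {α β : Type} {p : PMF α} {f g : α → β}
    (h : ∀ a ∈ p.support, f a = g a) : p.map f = p.map g := by
  ext b
  rw [PMF.map_apply, PMF.map_apply]
  refine tsum_congr fun a => ?_
  by_cases ha : a ∈ p.support
  · rw [h a ha]
  · rw [PMF.mem_support_iff, not_not] at ha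
    simp [ha]

theorem outputsOne_some (v : Val) : OutputsOne (some v) ↔ v.toNat = 1 := by
  simp [OutputsOne]

theorem PPT.noFail (A : PPT) (κ : ℕ) (v : Val) : (A.comp κ v).NoFail :=
  ((Comp.within_iff _ _).1 (A.within κ v)).noFail

namespace Params

variable {P : Params} {κ : ℕ}

open Classical in
/-- The outcome of the simulation for fixed choices of the reduction. -/
theorem reduction_run (A : PPT) (b : Bool) (K₀ : BitVec κ) (β D : ℕ) (j : Fin (P.nmax κ)) :
    (((A.comp κ (P.startVal κ)).run (P.reduction.oracle (P.prfOracle κ K₀ b))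
      (((List.range κ, β, (j : ℕ), D), []), fun _ => none)).map fun r =>
        decide (OutputsOne (r.1.map fun a =>
          rep (P.reduction.out (r.2.1, decide (a.toNat = 1)))))) =
    (P.hybridRun κ (j + b.toNat) β (P.keyAt κ D 0)
      (if b = true then P.keyAt κ D 1 else Function.update (P.keyAt κ D 1) j K₀)
      (A.comp κ (P.startVal κ))).map fun r => if β = 0 then P.wins κ r else !P.wins κ r := by
  have hinit : P.SimInv κ b K₀ β D j (((List.range κ, β, (j : ℕ), D), []), fun _ => none) :=
    ⟨rfl, rfl, by simp, by simp⟩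
  have hinit' : P.toHybrid κ b j (((List.range κ, β, (j : ℕ), D), []), fun _ => none) =
      (fun _ => none, []) := by
    simp only [toHybrid, List.map_nil, Prod.mk.injEq, and_true]
    funext l
    simp [padTable]
  have hrun := Comp.run_map (fun s m hs => toHybrid_oracle (b := b) (K₀ := K₀) s m hs)
    (fun s m hs => simInv_oracle s m hs) (A.comp κ (P.startVal κ)) _ hinit
  unfold hybridRun
  rw [← hinit', hrun, PMF.map_comp, PMF.map_comp]
  refine map_congr_of_support fun r hr => ?_
  obtain ⟨v, hv⟩ := Option.isSome_iff_exists.1 ((A.noFail κ _).isSome _ _ hr)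
  have hinv := Comp.run_invariant (fun s m hs => simInv_oracle s m hs) _ _ hinit _ hr
  obtain ⟨a, ⟨u, es⟩, T⟩ := r
  dsimp only at hv hinv
  subst hv
  have hu := hinv.context
  have hfl := hinv.flags
  dsimp only at hu hfl
  subst hu
  have hrep : ∀ x : Bool, decide ((rep x).toNat = 1) = x := by
    intro x
    cases x <;> rfl
  simp only [Function.comp_apply, Option.map_some, outputsOne_some, hrep]
  simp only [reduction, toHybrid, wins, admissible, outputsOne_some, List.length_range, hfl]

open Classical in
/-- The game of the reduction is the hybrid game at a random position, with a random bit. -/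
theorem prfGame_reduction (A B : PPT) (hB : ∀ v, (P.reduction.comp A κ).erase = (B.comp κ v).erase)
    (hn : 0 < P.nmax κ) (b : Bool) : P.prfGame B κ b =
      (PMF.uniformOfFintype (Fin 2)).bind fun β =>
      (PMF.uniformOfFintype (Fin (P.nmax κ - 1 + 1))).bind fun j =>
        (P.hybrid κ (j + b.toNat) β (A.comp κ (P.startVal κ))).map fun x =>
          if (β : ℕ) = 0 then x else !x := by
  have hrun : ∀ K₀, ((B.comp κ (.num 0)).run (P.prfOracle κ K₀ b) fun _ => none) =
      (P.reduction.comp A κ).run (P.prfOracle κ K₀ b) fun _ => none := fun K₀ => by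
    rw [← Comp.run_erase, ← hB, Comp.run_erase]
  have h1 : P.reduction.bound₁ (List.range κ) = 1 := rfl
  have h2 : P.reduction.bound₂ (List.range κ) = P.nmax κ - 1 := by simp [reduction]
  have h3 : P.reduction.bound₃ (List.range κ) = (2 ^ κ) ^ (P.nmax κ * 2) - 1 := by
    simp [reduction]
  have h4 : P.reduction.start (List.range κ) = P.startVal κ := by simp [reduction, startVal]
  have hN : P.nmax κ - 1 + 1 = P.nmax κ := Nat.sub_add_cancel hn
  obtain ⟨E, hE⟩ := exists_equiv_digits (a := P.nmax κ) (b := 2) (q := 2 ^ κ) (by positivity)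
    { toFun x := BitVec.ofNat κ x
      invFun x := ⟨x.toNat, x.isLt⟩
      left_inv x := Fin.ext (by simp)
      right_inv x := by simp }
    (fun x : ℕ => BitVec.ofNat κ x) fun x => rfl
  let E' : Fin ((2 ^ κ) ^ (P.nmax κ * 2) - 1 + 1) ≃
      (Fin (P.nmax κ) → BitVec κ) × (Fin (P.nmax κ) → BitVec κ) := E.trans
    { toFun R := (fun i => R i 0, fun i => R i 1)
      invFun K i c := if c = 0 then K.1 i else K.2 i
      left_inv R := by
        funext i c
        fin_cases c <;> rfl
      right_inv K := rfl }
  have hE' : ∀ D, E' D = (P.keyAt κ D 0, P.keyAt κ D 1) := by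
    intro D
    refine Prod.ext (funext fun i => ?_) (funext fun i => ?_)
    · exact hE D i 0
    · exact hE D i 1
  unfold prfGame
  simp only [hrun, Simulator.run_comp, PMF.map_bind, PMF.map_comp]
  rw [h1, h2, h3, h4]
  change _ = (PMF.uniformOfFintype (Fin (1 + 1))).bind _
  rw [PMF.bind_comm]
  congr 1
  funext β
  rw [PMF.bind_comm]
  congr 1
  funext j
  obtain ⟨j', hj'⟩ : ∃ j' : Fin (P.nmax κ), (j' : ℕ) = j := ⟨⟨j, j.2.trans_eq hN⟩, rfl⟩
  have hred := fun K₀ D => reduction_run A b K₀ (β : ℕ) D j'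
  simp only [hj'] at hred
  simp only [Function.comp_def] at hred ⊢
  simp only [hred]
  let G (K K' : Fin (P.nmax κ) → BitVec κ) := (P.hybridRun κ (j + b.toNat) β K K'
    (A.comp κ (P.startVal κ))).map fun r => if (β : ℕ) = 0 then P.wins κ r else !P.wins κ r
  have hrhs : ((P.hybrid κ (j + b.toNat) β (A.comp κ (P.startVal κ))).map fun x =>
      if (β : ℕ) = 0 then x else !x) =
      (PMF.uniformOfFintype (Fin (P.nmax κ) → BitVec κ)).bind fun K =>
        (PMF.uniformOfFintype (Fin (P.nmax κ) → BitVec κ)).bind fun K' => G K K' := by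
    simp only [hybrid, PMF.map_bind, PMF.map_comp]
    rfl
  rw [hrhs]
  have hlhs : ∀ K₀ : BitVec κ, ((PMF.uniformOfFintype
      (Fin ((2 ^ κ) ^ (P.nmax κ * 2) - 1 + 1))).bind fun D => G (P.keyAt κ D 0)
        (if b = true then P.keyAt κ D 1 else Function.update (P.keyAt κ D 1) j' K₀)) =
      (PMF.uniformOfFintype (Fin (P.nmax κ) → BitVec κ)).bind fun K =>
        (PMF.uniformOfFintype (Fin (P.nmax κ) → BitVec κ)).bind fun K' =>
          G K (if b = true then K' else Function.update K' j' K₀) := by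
    intro K₀
    rw [← uniform_prod fun K : (Fin (P.nmax κ) → BitVec κ) × (Fin (P.nmax κ) → BitVec κ) =>
      G K.1 (if b = true then K.2 else Function.update K.2 j' K₀), ← uniform_bind_equiv E']
    simp only [hE']
  refine (congrArg (PMF.bind _) (funext hlhs)).trans ?_
  rw [PMF.bind_comm]
  congr 1
  funext K
  cases b
  · simp only [Bool.false_eq_true, if_false]
    exact uniform_update j' (G K)
  · simp only [if_true]
    exact PMF.bind_const _ _

theorem toReal_map_not (p : PMF Bool) : (p.map (fun x => !x) true).toReal = 1 - (p true).toReal := by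
  have h := p.tsum_coe
  rw [tsum_bool] at h
  have h' := congrArg ENNReal.toReal h
  rw [ENNReal.toReal_add (PMF.apply_ne_top _ _) (PMF.apply_ne_top _ _)] at h'
  have : p.map (fun x => !x) true = p false := by
    rw [PMF.map_apply, tsum_bool]
    simp
  rw [this]
  simp only [ENNReal.toReal_one] at h'
  linarith

/-- The advantage against the scheme, in terms of the advantage against the keyed function. -/
theorem adv_eq (A B : PPT) (hB : ∀ v, (P.reduction.comp A κ).erase = (B.comp κ v).erase) :
    DyNMCFE.adv P.dyNo A κ = 2 * (P.nmax κ : ℝ) * P.prfAdv B κ := by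
  have hlast := congrArg ENNReal.toReal (hybrid_last (P := P) (κ := κ) (A.comp κ (P.startVal κ)))
  let h (j β : ℕ) : ℝ := (P.hybrid κ j β (A.comp κ (P.startVal κ)) true).toReal
  have hadv : DyNMCFE.adv P.dyNo A κ = |h 0 0 - h 0 1| := by
    simp only [DyNMCFE.adv, advantage, game_eq_hybrid, h]
    rfl
  have hl : h (P.nmax κ) 0 = h (P.nmax κ) 1 := hlast
  rcases Nat.eq_zero_or_pos (P.nmax κ) with hn | hn
  · rw [hn] at hl
    rw [hadv, hl, hn]
    simp
  have hgame : ∀ b : Bool, (P.prfGame B κ b true).toReal = 2⁻¹ * ((P.nmax κ : ℝ)⁻¹ *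
      (∑ j ∈ Finset.range (P.nmax κ), h (j + b.toNat) 0) +
      (P.nmax κ : ℝ)⁻¹ * (∑ j ∈ Finset.range (P.nmax κ), (1 - h (j + b.toNat) 1))) := by
    intro b
    rw [prfGame_reduction A B hB hn b, uniform_bind_apply]
    have hN : P.nmax κ - 1 + 1 = P.nmax κ := Nat.sub_add_cancel hn
    simp only [uniform_bind_apply, Fintype.card_fin, Fin.sum_univ_two, hN]
    have e0 : ∀ p : PMF Bool, (p.map fun x => if ((0 : Fin 2) : ℕ) = 0 then x else !x) = p :=
      fun p => PMF.map_id p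
    have e1 : ∀ p : PMF Bool, (p.map fun x => if ((1 : Fin 2) : ℕ) = 0 then x else !x) =
      p.map fun x => !x := fun p => rfl
    simp only [e0, e1, toReal_map_not]
    have hsum : ∀ f : ℕ → ℝ, ∑ j : Fin (P.nmax κ - 1 + 1), f j =
        ∑ j ∈ Finset.range (P.nmax κ), f j := fun f => by rw [← Finset.sum_range, hN]
    rw [← hsum fun j => h (j + b.toNat) 0, ← hsum fun j => 1 - h (j + b.toNat) 1, Nat.cast_two]
    rfl
  have htel : ∀ β, ∑ j ∈ Finset.range (P.nmax κ), h (j + 1) β =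
      ∑ j ∈ Finset.range (P.nmax κ), h j β + (h (P.nmax κ) β - h 0 β) := by
    intro β
    rw [← Finset.sum_range_sub fun j => h j β, ← Finset.sum_add_distrib]
    exact Finset.sum_congr rfl fun j _ => by ring
  have hdiff : (P.prfGame B κ false true).toReal - (P.prfGame B κ true true).toReal =
      (2 * (P.nmax κ : ℝ))⁻¹ * (h 0 0 - h 0 1) := by
    rw [hgame, hgame]
    simp only [Bool.toNat_false, Bool.toNat_true, add_zero, Finset.sum_sub_distrib, htel, hl]
    rw [mul_inv]
    ring
  have hpos : (0 : ℝ) < 2 * P.nmax κ := by positivity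
  rw [hadv, prfAdv, advantage, hdiff, abs_mul, abs_of_pos (inv_pos.2 hpos), ← mul_assoc,
    mul_inv_cancel₀ hpos.ne', one_mul]

end Params

/-! ### Adversaries that use no labels -/

namespace DyNMCFE

variable {𝓕 : FunctionFamily} {E : DyNMCFE 𝓕} {pp : E.PP} {s : State E} {m : Val}

/-- If no label has occurred after a step, then the step does not depend on the bit. -/
theorem oracle_congr_of_labels
    (h : ∃ r ∈ (E.oracle pp false s m).support ∪ (E.oracle pp true s m).support,
      r.2.labels = ∅) : E.oracle pp false s m = E.oracle pp true s m := by
  have henc : ∀ β Q, ∀ r ∈ (onEnc E pp β s Q).support, r.2.labels ≠ ∅ := by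
    intro β Q r hr
    unfold onEnc at hr
    split at hr
    · rw [PMF.support_pure, Set.mem_singleton_iff] at hr
      simp [hr]
    · split_ifs at hr
      · rw [PMF.support_pure, Set.mem_singleton_iff] at hr
        simp [hr]
      · rw [PMF.support_map] at hr
        obtain ⟨c, -, rfl⟩ := hr
        simp
  have hkey : ∀ β Q, ∀ r ∈ (onKeyGen E pp β s Q).support, r.2.labels ≠ ∅ := by
    intro β Q r hr
    unfold onKeyGen at hr
    split_ifs at hr
    · rw [PMF.support_map] at hr
      obtain ⟨c, -, rfl⟩ := hr
      simp
    · rw [PMF.support_pure, Set.mem_singleton_iff] at hr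
      simp [hr]
  obtain ⟨r, hr, hl⟩ := h
  unfold oracle at hr ⊢
  cases hq : Query.read 𝓕 m with
  | none => rfl
  | some q =>
    rw [hq] at hr
    cases q with
    | cor i => rfl
    | ekeygen i => rfl
    | enc Q => exact (hr.elim (henc _ _ r · hl) (henc _ _ r · hl)).elim
    | keygen Q => exact (hr.elim (hkey _ _ r · hl) (hkey _ _ r · hl)).elim

/-- Labels that have occurred are never forgotten. -/
theorem labels_subset_of_oracle {β : Bool} {r : Val × State E}
    (hr : r ∈ (E.oracle pp β s m).support) : s.labels ⊆ r.2.labels := by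
  unfold oracle at hr
  split at hr
  · rw [PMF.support_pure, Set.mem_singleton_iff] at hr
    simp [hr]
  · unfold onCor at hr
    split_ifs at hr
    · rw [PMF.support_pure, Set.mem_singleton_iff] at hr
      simp [hr]
    · split at hr
      · rw [PMF.support_pure, Set.mem_singleton_iff] at hr
        simp [hr]
      · rw [PMF.support_map] at hr
        obtain ⟨c, -, rfl⟩ := hr
        simp
  · unfold onEKeyGen at hr
    split at hr
    · rw [PMF.support_pure, Set.mem_singleton_iff] at hr
      simp [hr]
    · rw [PMF.support_map] at hr
      obtain ⟨c, -, rfl⟩ := hr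
      simp
  · unfold onEnc at hr
    split at hr
    · rw [PMF.support_pure, Set.mem_singleton_iff] at hr
      simp [hr]
    · split_ifs at hr
      · rw [PMF.support_pure, Set.mem_singleton_iff] at hr
        simp [hr]
      · rw [PMF.support_map] at hr
        obtain ⟨c, -, rfl⟩ := hr
        simp
  · unfold onKeyGen at hr
    split_ifs at hr
    · rw [PMF.support_map] at hr
      obtain ⟨c, -, rfl⟩ := hr
      simp
    · rw [PMF.support_pure, Set.mem_singleton_iff] at hr
      simp [hr]

/-- An adversary that makes neither encryption nor decryption key queries sees nothing of the
bit. -/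
theorem game_eq_of_labelBound {A : PPT} {κ : ℕ} (h : E.LabelBound A κ 0) :
    E.game A κ false = E.game A κ true := by
  have hexec : E.exec A κ false = E.exec A κ true := by
    ext r
    by_cases hl : r.2.labels = ∅
    · obtain ⟨a, s⟩ := r
      simp only [exec, PMF.bind_apply]
      refine tsum_congr fun x => ?_
      congr 1
      refine Comp.run_apply_congr (P := fun s => s.labels = ∅)
        (fun s m h => oracle_congr_of_labels h) (fun s m r hr h => ?_) _ _ a s hl
      have hsub : s.labels ⊆ r.2.labels :=
        hr.elim (fun hr => labels_subset_of_oracle hr) fun hr => labels_subset_of_oracle hr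
      rw [h] at hsub
      exact Finset.subset_empty.1 hsub
    · have h0 : ∀ β, E.exec A κ β r = 0 := fun β => by
        by_contra hr
        have := h β r ((PMF.mem_support_iff _ _).2 hr)
        exact hl (Finset.card_eq_zero.1 (Nat.le_zero.1 this))
      rw [h0, h0]
  rw [game, game, hexec]

end DyNMCFE

/-! ### Negligible functions -/

theorem eval_le_mul_pow (p : Polynomial ℕ) {x : ℕ} (hx : 1 ≤ x) :
    p.eval x ≤ p.eval 1 * x ^ p.natDegree := by
  rw [Polynomial.eval_eq_sum_range, Polynomial.eval_eq_sum_range, Finset.sum_mul]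
  refine Finset.sum_le_sum fun i hi => ?_
  rw [one_pow, mul_one]
  exact Nat.mul_le_mul_left _ (Nat.pow_le_pow_right hx (Nat.lt_succ_iff.1 (Finset.mem_range.1 hi)))

theorem Negligible.of_le_poly_mul {f g : ℕ → ℝ} (hf : Negligible f) {p : Polynomial ℕ}
    (hg : ∀ x, |g x| ≤ (p.eval x : ℕ) * |f x|) : Negligible g := by
  intro c
  obtain ⟨τ, hτ⟩ := hf (c + p.natDegree + 1)
  refine ⟨max τ (p.eval 1), fun x hx => ?_⟩
  have h1 := hτ x ((le_max_left _ _).trans_lt hx)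
  have h2 : ((p.eval 1 : ℕ) : ℝ) < x := by exact_mod_cast (le_max_right _ _).trans_lt hx
  have hx0 : 0 < x := (Nat.zero_le _).trans_lt hx
  have hx1 : (0 : ℝ) < x := by exact_mod_cast hx0
  have h3 : ((p.eval x : ℕ) : ℝ) ≤ (p.eval 1 : ℕ) * (x : ℝ) ^ p.natDegree := by
    exact_mod_cast eval_le_mul_pow p hx0
  calc |g x| ≤ (p.eval x : ℕ) * |f x| := hg x
    _ ≤ ((p.eval 1 : ℕ) * (x : ℝ) ^ p.natDegree) * (1 / (x : ℝ) ^ (c + p.natDegree + 1)) := by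
        gcongr
    _ = ((p.eval 1 : ℕ) : ℝ) / x * (1 / (x : ℝ) ^ c) := by
        rw [pow_succ, pow_add]
        field_simp
    _ < 1 * (1 / (x : ℝ) ^ c) := by
        refine mul_lt_mul_of_pos_right ((div_lt_one hx1).2 h2) (by positivity)
    _ = 1 / (x : ℝ) ^ c := one_mul _

end DyNoFE

end

theorem theorem2 (P : DyNoFE.Params) (hP : P.Efficient) :
    (P.PRFSecure → DyNoFE.DyNMCFE.INDSecure P.dyNo) ∧
    ∀ A : DyNoFE.PPT, ∃ B₁ B₂ : DyNoFE.PPT, ∀ κ qℓ : ℕ, (P.dyNo κ).LabelBound A κ qℓ →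
      DyNoFE.DyNMCFE.adv P.dyNo A κ ≤
        2 * (P.nmax κ : ℝ) * (qℓ : ℝ) * P.prfAdv B₁ κ +
          (qℓ : ℝ) * DyNoFE.NMIFE.adv P.oneTime B₂ κ := by
  have key : ∀ A : DyNoFE.PPT, ∃ B : DyNoFE.PPT, ∀ κ,
      DyNoFE.DyNMCFE.adv P.dyNo A κ = 2 * (P.nmax κ : ℝ) * P.prfAdv B κ := by
    intro A
    obtain ⟨B, hB⟩ := hP.reduction.exists_ppt A
    exact ⟨B, fun κ => DyNoFE.Params.adv_eq A B (hB κ)⟩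
  constructor
  · intro hprf A
    obtain ⟨B, hB⟩ := key A
    obtain ⟨p, hp⟩ := hP.nmax_le
    refine (hprf B).of_le_poly_mul (p := 2 * p) fun κ => ?_
    rw [hB, abs_mul, abs_mul, abs_two, Nat.abs_cast, Polynomial.eval_mul, Polynomial.eval_ofNat,
      Nat.cast_mul, Nat.cast_ofNat]
    gcongr
    exact_mod_cast hp κ
  · intro A
    obtain ⟨B, hB⟩ := key A
    -- The one-time pad is perfectly secure, and its perfect security has been used for the last
    -- hybrid game directly. So the second summand is only needed to be nonnegative.
    refine ⟨B, A, fun κ qℓ hl => ?_⟩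
    have h₁ : 0 ≤ P.prfAdv B κ := abs_nonneg _
    have h₂ : 0 ≤ DyNoFE.NMIFE.adv P.oneTime A κ := abs_nonneg _
    rcases Nat.eq_zero_or_pos qℓ with rfl | hq
    · have : DyNoFE.DyNMCFE.adv P.dyNo A κ = 0 := by
        rw [DyNoFE.DyNMCFE.adv, DyNoFE.advantage, DyNoFE.DyNMCFE.game_eq_of_labelBound hl, sub_self,
          abs_zero]
      simp [this]
    · have hq' : (1 : ℝ) ≤ qℓ := by exact_mod_cast hq
      calc DyNoFE.DyNMCFE.adv P.dyNo A κ = 2 * (P.nmax κ : ℝ) * 1 * P.prfAdv B κ + 0 := by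
            rw [hB, mul_one, add_zero]
        _ ≤ _ := by
            gcongr
            positivity
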